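/- Let $p>1$, $p^*=p/(p-1)$, $0<D\le\infty$; if $D=\infty$, read $[0,D]$, $(0,D]$ as $[0,\infty)$, $(0,\infty)$. Let $u,v$ be real functions, positive almost everywhere on $(0,D)$, such that $u$ and $\hat v:=v^{1-p^*}$ are locally integrable on $[0,D]$. Put $d\mu=u\,dx$, $d\nu=v\,dx$ on $(0,D)$ and assume $\mu(0,D)<\infty$. Let $D_p(f)=\int_0^D|f'|^p\,d\nu$ and $\mu(g)=\int_0^D g\,d\mu$. On an open interval $J$, "$v^{p^*-1}f'\in\mathscr C(J)$" means that $f$ is locally absolutely continuous on $J$ and that $v^{p^*-1}f'$ coincides a.e. on $J$ with a (unique) continuous function $w_f$; then "$f'>0$ on $J$" means $w_f>0$ on $J$, and $vf'|f'|^{p-2}$ stands for $w_f|w_f|^{p-2}$. The first eigenvalue of the Dirichlet–Neumann problem $(v|g'|^{p-2}g')'=-\lambda u|g|^{p-2}g$, $g(0)=0$ (and $g'(D)=0$ if $D<\infty$), is $$\lambda_p=\inf\Big\{\frac{D_p(f)}{\mu(|f|^p)}: f(0)=0,\ f\ne0,\ f\in\mathscr C[0,D],\ v^{p^*-1}f'\in\mathscr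 C(0,D),\ D_p(f)<\infty\Big\}.$$ With the convention $1/0=\infty$ (and $0\cdot\infty=0$), define for $x\in(0,D)$ $$I(f)(x)=\frac{1}{(vf'|f'|^{p-2})(x)}\int_x^D f^{p-1}d\mu,\qquad I\!I(f)(x)=\frac1{f^{p-1}(x)}\Big[\int_0^x\hat v(s)\Big(\int_s^Df^{p-1}d\mu\Big)^{p^*-1}ds\Big]^{p-1},$$ $$R(h)(x)=-u^{-1}\big\{|h|^{p-2}\big[v'h+(p-1)v(h^2+h')\big]\big\}(x),\qquad R(h)(x)=0\ \text{if } x\ge x_0 \text{ and } h=0 \text{ on } [x_0,D],$$ and the classes * $\mathscr F_I=\{f\in\mathscr C[0,D]: v^{p^*-1}f'\in\mathscr C(0,D),\ f(0)=0,\ f'>0\text{ on }(0,D)\}$; * $\mathscr F_{I\!I}=\{f\in\mathscr C[0,D]: f(0)=0,\ f>0\text{ on }(0,D)\}$; * $\widetilde{\mathscr F}_I$: the $f$ with $f(0)=0$ for which there is $x_0\in(0,D)$ with $f\in\mathscr C[0,x_0]$, $v^{p^*-1}f'\in\mathscr C(0,x_0)$, $f'>0$ on $(0,x_0)$ and $f=f(\cdot\wedge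 x_0)$ (for these, $vf'|f'|^{p-2}:=0$, hence $I(f)=\infty$, on $[x_0,D)$); * $\widetilde{\mathscr F}_{I\!I}$: the $f$ with $f(0)=0$ for which there is $x_0\in(0,D)$ with $f\in\mathscr C[0,x_0]$, $f=f(\cdot\wedge x_0)$ and $f>0$ on $(0,D)$; * $\widetilde{\mathscr F}_{I\!I}'=\{f\in\mathscr C[0,D]: f(0)=0,\ f\ge0,\ f\not\equiv0\text{ on }(0,D),\ f\,I\!I(f)\in L^p(\mu)\}$; * $\mathscr H=\{h\in\mathscr C^1(0,D)\cap\mathscr C(0,D]: h>0\text{ on }(0,D),\ \int_0^{\varepsilon}h\,dx=\infty\text{ for small }\varepsilon>0\}$; * $\widetilde{\mathscr H}$: the $h$ for which there is $x_0\in(0,D)$ with $h\in\mathscr C(0,x_0]\cap\mathscr C^1(0,x_0)$, $h>0$ on $(0,x_0)$, $h=0$ on $[x_0,D]$, $\int_0^\varepsilon h\,dx=\infty$ for small $\varepsilon>0$, and $v'h+(p-1)(h^2+h')v<0$ on $(0,x_0)$; * $\widetilde{\mathscr H}_+$: the same as $\widetilde{\mathscr H}$, with in addition $\sup_{(0,x_0)}u^{-1}|h|^{p-2}\big[v'h+(p-1)(h^2+h')v\big]<0$.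 Then: (0) if $v$ is locally integrable on $(0,D)$, also $\lambda_p=\inf\{D_p(f):\mu(|f|^p)=1,\ f(0)=0,\ f\in\mathscr C^1(0,D)\cap\mathscr C[0,D]\}$; (1) single integral forms: $$\inf_{f\in\widetilde{\mathscr F}_I}\sup_{x\in(0,D)}I(f)(x)^{-1}=\lambda_p=\sup_{f\in\mathscr F_I}\inf_{x\in(0,D)}I(f)(x)^{-1};$$ (2) double integral forms: $$\lambda_p=\inf_{f\in\widetilde{\mathscr F}_I}\sup_{x\in(0,D)}I\!I(f)(x)^{-1}=\inf_{f\in\widetilde{\mathscr F}_{I\!I}\cup\widetilde{\mathscr F}_{I\!I}'}\sup_{x\in(0,D)}I\!I(f)(x)^{-1},$$ $$\lambda_p=\sup_{f\in\mathscr F_I}\inf_{x\in(0,D)}I\!I(f)(x)^{-1}=\sup_{f\in\mathscr F_{I\!I}}\inf_{x\in(0,D)}I\!I(f)(x)^{-1};$$ (3) differential forms: if moreover $u$ is continuous and positive on $(0,D)$, $v\in\mathscr C^1(0,D)$, and $v$ is continuous and positive on $(0,D]$, then $$\inf_{h\in\widetilde{\mathscr H}}\sup_{x\in(0,D)}R(h)(x)=\inf_{h\in\widetilde{\mathscr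 H}_+}\sup_{x\in(0,D)}R(h)(x)=\lambda_p=\sup_{h\in\mathscr H}\inf_{x\in(0,D)}R(h)(x).$$ -/

import Mathlib

open MeasureTheory Set Filter Topology
open scoped ENNReal

namespace DNCase

noncomputable section

/-- The open interval `(0, D)`, where `D ≤ ∞`. -/
def oI (D : EReal) : Set ℝ := {x | 0 < x ∧ (x : EReal) < D}

/-- The interval `[0, D]`; this is `[0, ∞)` when `D = ∞`. -/
def cI (D : EReal) : Set ℝ := {x | 0 ≤ x ∧ (x : EReal) ≤ D}

/-- The interval `(0, D]`; this is `(0, ∞)` when `D = ∞`. -/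
def ocI (D : EReal) : Set ℝ := {x | 0 < x ∧ (x : EReal) ≤ D}

/-- The measure with density `ρ` with respect to Lebesgue measure on `(0, D)`. -/
def wMeasure (ρ : ℝ → ℝ) (D : EReal) : Measure ℝ :=
  (volume.restrict (oI D)).withDensity (fun x => ENNReal.ofReal (ρ x))

/-- `v̂ = v ^ (1 - p*)`, with `p*` the conjugate exponent of `p`. -/
def vhat (p : ℝ) (v : ℝ → ℝ) (x : ℝ) : ℝ := v x ^ (1 - Real.conjExponent p)

/-- `D_p(f) = ∫₀ᴰ |f'|^p dν`, `dν = v dx`. -/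
def energy (p : ℝ) (v : ℝ → ℝ) (D : EReal) (f : ℝ → ℝ) : ℝ≥0∞ :=
  ∫⁻ x, ENNReal.ofReal (|deriv f x| ^ p) ∂(wMeasure v D)

/-- `μ(|f|^p)`, `dμ = u dx`. -/
def mass (p : ℝ) (u : ℝ → ℝ) (D : EReal) (f : ℝ → ℝ) : ℝ≥0∞ :=
  ∫⁻ x, ENNReal.ofReal (|f x| ^ p) ∂(wMeasure u D)

/-- On the open interval `J`, `v ^ (p* - 1) f'` is the continuous function `w`. As the weight `v`
is only a measurable density, `f'` is the almost everywhere derivative of the locally absolutely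
continuous function `f`. The function `w` is determined by `f` on `J`. -/
structure IsQuasiDeriv (p : ℝ) (v : ℝ → ℝ) (J : Set ℝ) (f w : ℝ → ℝ) : Prop where
  cont : ContinuousOn w J
  ac : ∀ a ∈ J, ∀ b ∈ J, AbsolutelyContinuousOnInterval f a b
  deriv_eq : ∀ᵐ x ∂(volume.restrict J), v x ^ (Real.conjExponent p - 1) * deriv f x = w x

/-- Test functions of the classical variational formula for `λ_p`. -/
structure IsTest (p : ℝ) (v : ℝ → ℝ) (D : EReal) (f : ℝ → ℝ) : Prop where
  zero : f 0 = 0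
  ne_zero : ∃ x ∈ cI D, f x ≠ 0
  cont : ContinuousOn f (cI D)
  quasi : ∃ w, IsQuasiDeriv p v (oI D) f w
  finite : energy p v D f < ⊤

/-- The first eigenvalue `λ_p`: the infimum of `D_p(f) / μ(|f|^p)`. -/
def lam (p : ℝ) (u v : ℝ → ℝ) (D : EReal) : ℝ≥0∞ :=
  ⨅ (f : ℝ → ℝ) (_ : IsTest p v D f), energy p v D f / mass p u D f

/-- The infimum of `D_p(f)` over `f ∈ C¹(0, D) ∩ C[0, D]`, `f(0) = 0`, `μ(|f|^p) = 1`. -/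
def lamC1 (p : ℝ) (u v : ℝ → ℝ) (D : EReal) : ℝ≥0∞ :=
  ⨅ (f : ℝ → ℝ) (_ : f 0 = 0 ∧ ContDiffOn ℝ 1 f (oI D) ∧ ContinuousOn f (cI D) ∧
    mass p u D f = 1), energy p v D f

/-- The single integral operator. The denominator `v f' |f'|^(p-2)` is written as `w |w|^(p-2)`
with `w = v ^ (p* - 1) f'`; where it vanishes the value is `∞` (the integral is positive for the
functions to which the operator is applied). -/
def opI (p : ℝ) (u : ℝ → ℝ) (D : EReal) (f w : ℝ → ℝ) (x : ℝ) : ℝ≥0∞ :=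
  (∫⁻ t in Ioi x, ENNReal.ofReal (f t ^ (p - 1)) ∂(wMeasure u D)) /
    ENNReal.ofReal (w x * |w x| ^ (p - 2))

/-- The double integral operator. -/
def opII (p : ℝ) (u v : ℝ → ℝ) (D : EReal) (f : ℝ → ℝ) (x : ℝ) : ℝ≥0∞ :=
  (∫⁻ s in Ioo 0 x, ENNReal.ofReal (vhat p v s) *
    (∫⁻ t in Ioi s, ENNReal.ofReal (f t ^ (p - 1)) ∂(wMeasure u D)) ^
      (Real.conjExponent p - 1)) ^ (p - 1) /
    ENNReal.ofReal (f x ^ (p - 1))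

/-- `v' h + (p - 1) (h² + h') v`. -/
def bracket (p : ℝ) (v h : ℝ → ℝ) (x : ℝ) : ℝ :=
  deriv v x * h x + (p - 1) * (h x ^ 2 + deriv h x) * v x

/-- The differential operator `R`. -/
def opR (p : ℝ) (u v h : ℝ → ℝ) (x : ℝ) : ℝ :=
  -((u x)⁻¹ * (|h x| ^ (p - 2) * bracket p v h x))

/-- The class `F_I`; `w` is `v ^ (p* - 1) f'`, so that `f' > 0` means `w > 0`. -/
structure FI (p : ℝ) (v : ℝ → ℝ) (D : EReal) (f w : ℝ → ℝ) : Prop where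
  cont : ContinuousOn f (cI D)
  quasi : IsQuasiDeriv p v (oI D) f w
  zero : f 0 = 0
  pos : ∀ x ∈ oI D, 0 < w x

/-- The class `F_II`. -/
structure FII (D : EReal) (f : ℝ → ℝ) : Prop where
  cont : ContinuousOn f (cI D)
  zero : f 0 = 0
  pos : ∀ x ∈ oI D, 0 < f x

/-- The class `F̃_I`: functions of `F_I`-type on `[0, x₀]`, stopped at `x₀`. -/
def FtI (p : ℝ) (v : ℝ → ℝ) (D : EReal) (f w : ℝ → ℝ) : Prop :=
  ∃ x₀ ∈ oI D, f 0 = 0 ∧ ContinuousOn f (Icc 0 x₀) ∧ IsQuasiDeriv p v (Ioo 0 x₀) f w ∧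
    (∀ x ∈ Ioo 0 x₀, 0 < w x) ∧ (∀ x ∈ cI D, f x = f (min x x₀)) ∧
    (∀ x ∈ oI D, x₀ ≤ x → w x = 0)

/-- The class `F̃_II`. -/
def FtII (D : EReal) (f : ℝ → ℝ) : Prop :=
  f 0 = 0 ∧ ∃ x₀ ∈ oI D, (∀ x ∈ cI D, f x = f (min x x₀)) ∧ (∀ x ∈ oI D, 0 < f x) ∧
    ContinuousOn f (Icc 0 x₀)

/-- The class `F̃_II'`. The powers of `f` require `f ≥ 0`, and `f = 0` is excluded. -/
def FtII' (p : ℝ) (u v : ℝ → ℝ) (D : EReal) (f : ℝ → ℝ) : Prop :=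
  f 0 = 0 ∧ ContinuousOn f (cI D) ∧ (∀ x ∈ oI D, 0 ≤ f x) ∧ (∃ x ∈ oI D, f x ≠ 0) ∧
    ∫⁻ x, (ENNReal.ofReal (f x) * opII p u v D f x) ^ p ∂(wMeasure u D) < ⊤

/-- `∫_{0+} h = ∞`. -/
def DivergesAtZero (h : ℝ → ℝ) : Prop :=
  ∀ᶠ ε in 𝓝[>] (0 : ℝ), ∫⁻ x in Ioo 0 ε, ENNReal.ofReal (h x) = ⊤

/-- The class `H`. -/
structure HClass (D : EReal) (h : ℝ → ℝ) : Prop where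
  smooth : ContDiffOn ℝ 1 h (oI D)
  cont : ContinuousOn h (ocI D)
  pos : ∀ x ∈ oI D, 0 < h x
  div : DivergesAtZero h

/-- `h` belongs to the class `H̃` with the point `x₀`. -/
structure HtAt (p : ℝ) (v : ℝ → ℝ) (D : EReal) (x₀ : ℝ) (h : ℝ → ℝ) : Prop where
  mem : x₀ ∈ oI D
  cont : ContinuousOn h (Ioc 0 x₀)
  smooth : ContDiffOn ℝ 1 h (Ioo 0 x₀)
  pos : ∀ x ∈ Ioo 0 x₀, 0 < h x
  vanish : ∀ x ∈ cI D, x₀ ≤ x → h x = 0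
  div : DivergesAtZero h
  neg : ∀ x ∈ Ioo 0 x₀, bracket p v h x < 0

/-- The class `H̃`. -/
def Ht (p : ℝ) (v : ℝ → ℝ) (D : EReal) (h : ℝ → ℝ) : Prop :=
  ∃ x₀, HtAt p v D x₀ h

/-- The functions in `H̃` for which the negativity is uniform:
`sup_{(0, x₀)} u⁻¹ |h|^(p-2) (v' h + (p - 1) (h² + h') v) < 0`. -/
def HtUnif (p : ℝ) (u v : ℝ → ℝ) (D : EReal) (h : ℝ → ℝ) : Prop :=
  ∃ x₀, HtAt p v D x₀ h ∧ ∃ δ > 0, ∀ x ∈ Ioo 0 x₀,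
    (u x)⁻¹ * (|h x| ^ (p - 2) * bracket p v h x) ≤ -δ

end

end DNCase

open DNCase

namespace DNCase

noncomputable section

/-! Put dV = v̂ dx and w = v^(p*-1) f'. Since v^(p*-1) v̂ = 1, an increasing f with f(0) = 0 is the
V-primitive of w, and D_p(f) = ∫ |w|^p dV. Hence λ_p is the best constant L in the Hardy inequality
L ∫ (∫_0^x W dV)^p dμ ≤ ∫ W^p dV over all measurable W ≥ 0 (`Weights.le_lam_of_hardy`,
`Weights.hardy_lam`). The regularity imposed on test functions is only a question of density, which
also settles the C¹ description of λ_p.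

Every other formula compares this constant with one-sided solutions of the integrated eigenvalue
equation W^(p-1) = c ∫_x^D F^(p-1) dμ, F = ∫_0^x W dV. A supersolution (≥) proves the Hardy
inequality with constant c, by Hölder with weight W and Tonelli (`hardy_of_supersolution`). A
subsolution (≤) with finite nonzero mass, used as a test function, shows that no Hardy constant
exceeds c (`Hardy.le_of_subsolution`). A lower bound c for 1/I, 1/II or R says that f, or a function
built from f or h, is a supersolution; an upper bound gives a subsolution. Integrating the pointwise
bound on I gives the bound on II, so the single and double forms are nested.

Sharpness needs two constructions. For c < λ_p, the equation with an extra positive source η is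
solved by monotone iteration from 0; the Hardy inequality with the larger constant λ_p bounds the
energies uniformly (`Hardy.exists_supersolution`). For a > λ_p one shoots from 0 with W(0) = 1. If W
stayed positive on a long enough interval, it would be a supersolution and would prove a Hardy
inequality known to fail; so W reaches 0 at some x₀, and stopping there gives a subsolution. A small
delay in the shooting equation makes it solvable step by step, at the cost of a factor close to 1 in
the constant.

For the differential forms, h = f'/f: the flux v h^(p-1) f^(p-1) equals w^(p-1) and has derivative
-R(h) u f^(p-1) (`hasDerivAt_flux`). Bounds on R(h) therefore integrate to the super- and
subsolution inequalities, and conversely the constructed solutions yield nearly optimal h. -/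

/-! ### Primitives and tail integrals. -/

/-- The primitive `x ↦ ∫_{(-∞, x)} W dV`. -/
def prim (V : Measure ℝ) (W : ℝ → ℝ≥0∞) (x : ℝ) : ℝ≥0∞ := ∫⁻ s in Iio x, W s ∂V

/-- The tail integral `s ↦ ∫_{(s, ∞)} φ dμ`. -/
def tail (μ : Measure ℝ) (φ : ℝ → ℝ≥0∞) (s : ℝ) : ℝ≥0∞ := ∫⁻ t in Ioi s, φ t ∂μ

theorem prim_mono_right (V : Measure ℝ) (W : ℝ → ℝ≥0∞) : Monotone (prim V W) :=
  fun _ _ h => lintegral_mono_set (Iio_subset_Iio h)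

theorem tail_anti (μ : Measure ℝ) (φ : ℝ → ℝ≥0∞) : Antitone (tail μ φ) :=
  fun _ _ h => lintegral_mono_set (Ioi_subset_Ioi h)

theorem measurable_prim (V : Measure ℝ) (W : ℝ → ℝ≥0∞) : Measurable (prim V W) :=
  (prim_mono_right V W).measurable

theorem measurable_tail (μ : Measure ℝ) (φ : ℝ → ℝ≥0∞) : Measurable (tail μ φ) :=
  (tail_anti μ φ).measurable

theorem prim_mono {V : Measure ℝ} {W W' : ℝ → ℝ≥0∞} (h : ∀ᵐ s ∂V, W s ≤ W' s) (x : ℝ) :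
    prim V W x ≤ prim V W' x :=
  lintegral_mono_ae (ae_restrict_of_ae h)

theorem tail_mono {μ : Measure ℝ} {φ φ' : ℝ → ℝ≥0∞} (h : ∀ᵐ s ∂μ, φ s ≤ φ' s) (x : ℝ) :
    tail μ φ x ≤ tail μ φ' x :=
  lintegral_mono_ae (ae_restrict_of_ae h)

/-- Tonelli on the region s < x: primitive and tail are adjoint operators. -/
theorem lintegral_mul_prim {μ V : Measure ℝ} [SFinite μ] [SFinite V] {φ W : ℝ → ℝ≥0∞}
    (hφ : AEMeasurable φ μ) (hW : AEMeasurable W V) :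
    ∫⁻ x, φ x * prim V W x ∂μ = ∫⁻ s, W s * tail μ φ s ∂V := by
  have hS : MeasurableSet {z : ℝ × ℝ | z.2 < z.1} := measurableSet_lt measurable_snd measurable_fst
  have h1 : ∀ x, φ x * prim V W x
      = ∫⁻ s, {z : ℝ × ℝ | z.2 < z.1}.indicator (fun z => φ z.1 * W z.2) (x, s) ∂V := by
    intro x
    rw [prim, ← lintegral_indicator measurableSet_Iio, ← lintegral_const_mul'' _
      (hW.indicator measurableSet_Iio)]
    refine lintegral_congr fun s => ?_
    by_cases h : s < x <;> simp [indicator, h]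
  have h2 : ∀ s, W s * tail μ φ s
      = ∫⁻ x, {z : ℝ × ℝ | z.2 < z.1}.indicator (fun z => φ z.1 * W z.2) (x, s) ∂μ := by
    intro s
    rw [tail, ← lintegral_indicator measurableSet_Ioi, ← lintegral_const_mul'' _
      (hφ.indicator measurableSet_Ioi)]
    refine lintegral_congr fun x => ?_
    by_cases h : s < x <;> simp [indicator, h, mul_comm]
  simp_rw [h1, h2]
  refine lintegral_lintegral_swap ?_
  exact ((hφ.comp_quasiMeasurePreserving Measure.quasiMeasurePreserving_fst).mul
    (hW.comp_quasiMeasurePreserving Measure.quasiMeasurePreserving_snd)).indicator hS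

/-! ### Conjugate exponents and weighted Hölder. -/

theorem conj_sub_one_mul {p : ℝ} (hp : 1 < p) : (Real.conjExponent p - 1) * (p - 1) = 1 := by
  have : p - 1 ≠ 0 := by linarith
  rw [Real.conjExponent]; field_simp; ring

theorem conj_sub_one_mul_self {p : ℝ} (hp : 1 < p) :
    (Real.conjExponent p - 1) * p = Real.conjExponent p := by
  have : p - 1 ≠ 0 := by linarith
  rw [Real.conjExponent]; field_simp; ring

theorem sub_one_mul_conj {p : ℝ} (hp : 1 < p) : (p - 1) * Real.conjExponent p = p := by
  have : p - 1 ≠ 0 := by linarith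
  rw [Real.conjExponent]; field_simp

theorem conj_sub_one_pos {p : ℝ} (hp : 1 < p) : 0 < Real.conjExponent p - 1 := by
  nlinarith [conj_sub_one_mul hp]

theorem mul_rpow_sub_one {p : ℝ} (hp : 1 < p) (x : ℝ≥0∞) : x * x ^ (p - 1) = x ^ p := by
  conv_lhs => rw [← ENNReal.rpow_one x, ← ENNReal.rpow_mul, one_mul]
  rw [← ENNReal.rpow_add_of_nonneg _ _ zero_le_one (by linarith)]; simp

/-- Hölder for the splitting G = (G W^(-1/p*)) · W^(1/p*). The two powers of W cancel only where 0 <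
W < ∞. -/
theorem holder_weighted {p : ℝ} (hp : 1 < p) {V : Measure ℝ} {W G : ℝ → ℝ≥0∞}
    (hW : AEMeasurable W V) (hG : AEMeasurable G V)
    (hpos : ∀ᵐ s ∂V, W s ≠ 0) (hfin : ∀ᵐ s ∂V, W s ≠ ⊤) :
    (∫⁻ s, G s ∂V) ^ p ≤ (∫⁻ s, G s ^ p * W s ^ (1 - p) ∂V) * (∫⁻ s, W s ∂V) ^ (p - 1) := by
  set q := Real.conjExponent p with hq
  have hpq : p.HolderConjugate q := Real.HolderConjugate.conjExponent hp
  have hp0 : 0 < p := by linarith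
  have hq0 : 0 < q := hpq.symm.pos
  have hpq1 : p / q = p - 1 := by
    rw [div_eq_iff hq0.ne', hq, sub_one_mul_conj hp]
  have key := ENNReal.lintegral_mul_le_Lp_mul_Lq V hpq
    (hG.mul (hW.pow_const (-(1 / q)))) (hW.pow_const (1 / q))
  have e1 : ∫⁻ s, G s ∂V = ∫⁻ s, ((G * fun s => W s ^ (-(1 / q))) * fun s => W s ^ (1 / q)) s ∂V := by
    refine lintegral_congr_ae ?_
    filter_upwards [hpos, hfin] with s h0 h1
    simp only [Pi.mul_apply]
    rw [mul_assoc, ← ENNReal.rpow_add _ _ h0 h1]; simp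
  have e2 : ∫⁻ s, ((G * fun s => W s ^ (-(1 / q))) s) ^ p ∂V
      = ∫⁻ s, G s ^ p * W s ^ (1 - p) ∂V := by
    refine lintegral_congr fun s => ?_
    simp only [Pi.mul_apply]
    rw [ENNReal.mul_rpow_of_nonneg _ _ hp0.le, ← ENNReal.rpow_mul]
    congr 2
    rw [show -(1 / q) * p = -(p / q) by ring, hpq1]; ring
  have e3 : ∫⁻ s, (W s ^ (1 / q)) ^ q ∂V = ∫⁻ s, W s ∂V := by
    refine lintegral_congr fun s => ?_
    rw [← ENNReal.rpow_mul, one_div_mul_cancel hq0.ne', ENNReal.rpow_one]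
  rw [← e1, e2, e3] at key
  calc _ ≤ _ := ENNReal.rpow_le_rpow key hp0.le
    _ = _ := by
      rw [ENNReal.mul_rpow_of_nonneg _ _ hp0.le, ← ENNReal.rpow_mul, ← ENNReal.rpow_mul,
        one_div_mul_cancel hp0.ne', ENNReal.rpow_one, one_div_mul_eq_div, hpq1]

/-! ### Proving Hardy inequalities: supersolutions and approximation. -/

/-- Weighted Hölder bounds (∫G)^p by F^(p-1) times the primitive of G^p W^(1-p). Tonelli moves the
μ-integration onto the tail of F^(p-1), and the supersolution inequality turns that tail into
W^(p-1), cancelling the weight. -/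
theorem hardy_of_supersolution {p : ℝ} (hp : 1 < p) {μ V : Measure ℝ} [SFinite μ] [SFinite V]
    {c : ℝ≥0∞} {W F G : ℝ → ℝ≥0∞} (hW : AEMeasurable W V) (hF : AEMeasurable F μ)
    (hG : AEMeasurable G V) (hpos : ∀ᵐ s ∂V, W s ≠ 0) (hfin : ∀ᵐ s ∂V, W s ≠ ⊤)
    (hle : ∀ᵐ x ∂μ, prim V W x ≤ F x)
    (h : ∀ᵐ s ∂V, c * tail μ (fun t => F t ^ (p - 1)) s ≤ W s ^ (p - 1)) :
    c * ∫⁻ x, prim V G x ^ p ∂μ ≤ ∫⁻ s, G s ^ p ∂V := by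
  have hK : AEMeasurable (fun s => G s ^ p * W s ^ (1 - p)) V :=
    (hG.pow_const _).mul (hW.pow_const _)
  calc c * ∫⁻ x, prim V G x ^ p ∂μ
      ≤ c * ∫⁻ x, F x ^ (p - 1) * prim V (fun s => G s ^ p * W s ^ (1 - p)) x ∂μ := by
        refine mul_le_mul_right (lintegral_mono_ae ?_) _
        filter_upwards [hle] with x hx
        refine (holder_weighted hp hW.restrict hG.restrict (ae_restrict_of_ae hpos)
          (ae_restrict_of_ae hfin)).trans ?_
        rw [mul_comm]
        exact mul_le_mul_left (ENNReal.rpow_le_rpow hx (by linarith)) _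
    _ = c * ∫⁻ s, (G s ^ p * W s ^ (1 - p)) * tail μ (fun t => F t ^ (p - 1)) s ∂V := by
        rw [lintegral_mul_prim (hF.pow_const _) hK]
    _ ≤ ∫⁻ s, c * ((G s ^ p * W s ^ (1 - p)) * tail μ (fun t => F t ^ (p - 1)) s) ∂V :=
        lintegral_const_mul_le _ _
    _ ≤ ∫⁻ s, G s ^ p ∂V := by
        refine lintegral_mono_ae ?_
        filter_upwards [h, hpos, hfin] with s hs h0 h1
        calc _ = (G s ^ p * W s ^ (1 - p)) * (c * tail μ (fun t => F t ^ (p - 1)) s) := by ring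
          _ ≤ (G s ^ p * W s ^ (1 - p)) * W s ^ (p - 1) := by gcongr
          _ = G s ^ p := by
            rw [mul_assoc, ← ENNReal.rpow_add _ _ h0 h1]; simp

theorem holder_prim {p : ℝ} (hp : 1 < p) {V : Measure ℝ} {G : ℝ → ℝ≥0∞} (hG : AEMeasurable G V)
    (x : ℝ) : prim V G x ^ p ≤ (∫⁻ s, G s ^ p ∂V) * V (Iio x) ^ (p - 1) := by
  have := holder_weighted hp (V := V.restrict (Iio x)) (W := fun _ => 1) (G := G)
    aemeasurable_const hG.restrict (by simp) (by simp)
  simp only [ENNReal.one_rpow, mul_one, lintegral_const, one_mul, Measure.restrict_apply,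
    MeasurableSet.univ, univ_inter] at this
  exact this.trans (mul_le_mul_left (setLIntegral_le_lintegral _ _) _)

/-- Stability under L^p(V) limits: since V(-∞, x) is finite, Hölder makes the primitives of the
errors tend to 0 at every point. Fatou then handles the left side and Minkowski the right. -/
theorem hardy_of_approx {p : ℝ} (hp : 1 < p) {μ V : Measure ℝ} {c : ℝ≥0∞} {W : ℝ → ℝ≥0∞}
    (hV : ∀ x, V (Iio x) < ⊤) (hW : AEMeasurable W V)
    (h : ∀ ε : ℝ≥0∞, ε ≠ 0 → ∃ G d : ℝ → ℝ≥0∞, AEMeasurable G V ∧ AEMeasurable d V ∧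
      (∀ᵐ s ∂V, W s ≤ G s + d s) ∧ (∀ᵐ s ∂V, G s ≤ W s + d s) ∧ ∫⁻ s, d s ^ p ∂V ≤ ε ∧
      c * ∫⁻ x, prim V G x ^ p ∂μ ≤ ∫⁻ s, G s ^ p ∂V) :
    c * ∫⁻ x, prim V W x ^ p ∂μ ≤ ∫⁻ s, W s ^ p ∂V := by
  have hp0 : 0 < p := by linarith
  obtain ⟨ε, -, hε0, hε⟩ := exists_seq_strictAnti_tendsto' (show (0 : ℝ≥0∞) < 1 by simp)
  choose G d hG hd hWG hGW hdε hc using fun n => h (ε n) (hε0 n).1.ne'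
  have hd0 : Tendsto (fun n => ∫⁻ s, d n s ^ p ∂V) atTop (𝓝 0) :=
    tendsto_of_tendsto_of_tendsto_of_le_of_le tendsto_const_nhds hε (fun _ => zero_le) hdε
  have hpd : ∀ x, Tendsto (fun n => prim V (d n) x) atTop (𝓝 0) := by
    intro x
    have h1 : Tendsto (fun n => (∫⁻ s, d n s ^ p ∂V) * V (Iio x) ^ (p - 1)) atTop (𝓝 0) := by
      simpa using ENNReal.Tendsto.mul_const hd0
        (Or.inr (ENNReal.rpow_ne_top_of_nonneg (by linarith) (hV x).ne))
    have h2 : Tendsto (fun n => prim V (d n) x ^ p) atTop (𝓝 0) :=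
      tendsto_of_tendsto_of_tendsto_of_le_of_le tendsto_const_nhds h1 (fun _ => zero_le)
        (fun n => holder_prim hp (hd n) x)
    have h3 := (ENNReal.continuous_rpow_const (y := p⁻¹)).continuousAt.tendsto.comp h2
    simpa [Function.comp_def, ← ENNReal.rpow_mul, hp0.ne', hp0] using h3
  have hlim : ∀ x, prim V W x ^ p ≤ liminf (fun n => prim V (G n) x ^ p) atTop := by
    intro x
    have h1 : ∀ n, prim V W x - prim V (d n) x ≤ prim V (G n) x := by
      intro n
      rw [tsub_le_iff_right]
      refine (prim_mono (hWG n) x).trans ?_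
      rw [prim, lintegral_add_right' _ (hd n).restrict]; rfl
    have h2 : Tendsto (fun n => (prim V W x - prim V (d n) x) ^ p) atTop (𝓝 (prim V W x ^ p)) := by
      refine (ENNReal.continuous_rpow_const (y := p)).continuousAt.tendsto.comp ?_
      simpa using ENNReal.Tendsto.sub (tendsto_const_nhds (x := prim V W x)) (hpd x)
        (Or.inr ENNReal.zero_ne_top)
    rw [← h2.liminf_eq]
    exact liminf_le_liminf (Eventually.of_forall fun n => ENNReal.rpow_le_rpow (h1 n) hp0.le)
  have hnorm : Tendsto (fun n => ((∫⁻ s, W s ^ p ∂V) ^ (1 / p)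
      + (∫⁻ s, d n s ^ p ∂V) ^ (1 / p)) ^ p) atTop (𝓝 (∫⁻ s, W s ^ p ∂V)) := by
    have h3 := (ENNReal.continuous_rpow_const (y := 1 / p)).continuousAt.tendsto.comp hd0
    have h4 := (ENNReal.continuous_rpow_const (y := p)).continuousAt.tendsto.comp
      ((tendsto_const_nhds (x := (∫⁻ s, W s ^ p ∂V) ^ (1 / p))).add h3)
    simpa [Function.comp_def, ← ENNReal.rpow_mul, hp0.ne', hp0] using h4
  have hGn : ∀ n, ∫⁻ s, G n s ^ p ∂V ≤ ((∫⁻ s, W s ^ p ∂V) ^ (1 / p)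
      + (∫⁻ s, d n s ^ p ∂V) ^ (1 / p)) ^ p := by
    intro n
    calc ∫⁻ s, G n s ^ p ∂V ≤ ∫⁻ s, (W + d n) s ^ p ∂V := by
          refine lintegral_mono_ae ?_
          filter_upwards [hGW n] with s hs using ENNReal.rpow_le_rpow hs hp0.le
      _ = ((∫⁻ s, (W + d n) s ^ p ∂V) ^ (1 / p)) ^ p := by
          rw [← ENNReal.rpow_mul, one_div_mul_cancel hp0.ne', ENNReal.rpow_one]
      _ ≤ _ := ENNReal.rpow_le_rpow (ENNReal.lintegral_Lp_add_le hW (hd n) hp.le) hp0.le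
  calc c * ∫⁻ x, prim V W x ^ p ∂μ
      ≤ ∫⁻ x, c * prim V W x ^ p ∂μ := lintegral_const_mul_le _ _
    _ ≤ ∫⁻ x, liminf (fun n => c * prim V (G n) x ^ p) atTop ∂μ := by
        refine lintegral_mono fun x => ?_
        refine (mul_le_mul_right (hlim x) c).trans ?_
        -- A finite constant comes out of the liminf. For c = ∞ and a positive liminf, the terms are
        -- eventually positive, so the right side is ∞.
        rcases eq_or_ne c ⊤ with rfl | hctop
        · by_cases h0 : liminf (fun n => prim V (G n) x ^ p) atTop = 0
          · simp [h0]
          · obtain ⟨b, hb0, hb⟩ := exists_between (pos_iff_ne_zero.2 h0)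
            refine le_trans le_top (le_of_eq ?_)
            symm
            rw [eq_top_iff]
            refine le_liminf_of_le (by isBoundedDefault) ?_
            filter_upwards [eventually_lt_of_lt_liminf hb] with n hn
            rw [ENNReal.top_mul (hb0.trans hn).ne']
        · rw [ENNReal.liminf_const_mul_of_ne_top hctop]
    _ ≤ liminf (fun n => ∫⁻ x, c * prim V (G n) x ^ p ∂μ) atTop :=
        lintegral_liminf_le fun n => ((measurable_prim _ _).pow_const _).const_mul _
    _ ≤ liminf (fun n => ((∫⁻ s, W s ^ p ∂V) ^ (1 / p)
          + (∫⁻ s, d n s ^ p ∂V) ^ (1 / p)) ^ p) atTop := by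
        refine liminf_le_liminf (Eventually.of_forall fun n => ?_)
        rw [lintegral_const_mul _ ((measurable_prim _ _).pow_const _)]
        exact (hc n).trans (hGn n)
    _ = _ := hnorm.liminf_eq

/-! ### Subsolutions and upper bounds for the Hardy constant. -/

theorem energy_le_of_subsolution {p : ℝ} (hp : 1 < p) {μ V : Measure ℝ} [SFinite μ] [SFinite V]
    {φ W : ℝ → ℝ≥0∞} (hφ : AEMeasurable φ μ) (hW : AEMeasurable W V)
    (h : ∀ᵐ s ∂V, W s ^ (p - 1) ≤ tail μ φ s) :
    ∫⁻ s, W s ^ p ∂V ≤ ∫⁻ x, φ x * prim V W x ∂μ := by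
  rw [lintegral_mul_prim hφ hW]
  refine lintegral_mono_ae ?_
  filter_upwards [h] with s hs
  rw [← mul_rpow_sub_one hp]
  gcongr

/-- The Hardy inequality with constant `L` between `μ` and `V`. -/
def Hardy (p : ℝ) (μ V : Measure ℝ) (L : ℝ≥0∞) : Prop :=
  ∀ W : ℝ → ℝ≥0∞, AEMeasurable W V → L * ∫⁻ x, prim V W x ^ p ∂μ ≤ ∫⁻ s, W s ^ p ∂V

/-- Testing with W gives L · mass ≤ energy ≤ C · mass, and the mass cancels because it is neither 0
nor ∞. The function φ is kept apart from C (∫W)^(p-1) because in the double integral form W is built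
from f, not from its own primitive. -/
theorem Hardy.le_of_subsolution {p : ℝ} (hp : 1 < p) {μ V : Measure ℝ} [SFinite μ] [SFinite V]
    {L C : ℝ≥0∞} (hL : Hardy p μ V L) {φ W : ℝ → ℝ≥0∞} (hφ : AEMeasurable φ μ)
    (hW : AEMeasurable W V) (h : ∀ᵐ s ∂V, W s ^ (p - 1) ≤ tail μ φ s)
    (hle : ∀ᵐ x ∂μ, φ x ≤ C * prim V W x ^ (p - 1))
    (h0 : ∫⁻ x, prim V W x ^ p ∂μ ≠ 0) (h1 : ∫⁻ x, prim V W x ^ p ∂μ ≠ ⊤) : L ≤ C := by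
  have h2 : L * ∫⁻ x, prim V W x ^ p ∂μ ≤ C * ∫⁻ x, prim V W x ^ p ∂μ := by
    refine (hL W hW).trans ((energy_le_of_subsolution hp hφ hW h).trans ?_)
    rw [← lintegral_const_mul _ ((measurable_prim _ _).pow_const _)]
    refine lintegral_mono_ae ?_
    filter_upwards [hle] with x hx
    calc _ ≤ C * prim V W x ^ (p - 1) * prim V W x := by gcongr
      _ = _ := by rw [mul_assoc, mul_comm (_ ^ _), mul_rpow_sub_one hp]
  exact (ENNReal.mul_le_mul_iff_left h0 h1).1 h2

/-! ### Continuity of primitives and tails. -/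

theorem prim_eq_withDensity (V : Measure ℝ) (W : ℝ → ℝ≥0∞) (x : ℝ) :
    prim V W x = V.withDensity W (Iio x) :=
  (withDensity_apply _ measurableSet_Iio).symm

theorem tail_eq_withDensity (V : Measure ℝ) (W : ℝ → ℝ≥0∞) (x : ℝ) :
    tail V W x = V.withDensity W (Ioi x) :=
  (withDensity_apply _ measurableSet_Ioi).symm

theorem nullSingletonClass_withDensity (V : Measure ℝ) [NullSingletonClass V] (W : ℝ → ℝ≥0∞) :
    NullSingletonClass (V.withDensity W) :=
  ⟨fun x => withDensity_absolutelyContinuous V W (measure_singleton x)⟩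

/-- Near x the function is a constant plus the interval integral of 1, which is continuous because
the measure has no atoms. -/
theorem continuous_measure_Iio (m : Measure ℝ) [NullSingletonClass m] (h : ∀ x, m (Iio x) < ⊤) :
    Continuous fun x => m (Iio x) := by
  have hfin : IsLocallyFiniteMeasure m :=
    ⟨fun x => ⟨Iio (x + 1), Iio_mem_nhds (by linarith), h _⟩⟩
  rw [continuous_iff_continuousAt]
  intro x
  have hc := intervalIntegral.continuous_primitive (μ := m) (f := fun _ => (1 : ℝ))
    (fun a b => intervalIntegrable_const) (x - 1)
  have hc' : ContinuousAt (fun y => m (Iic (x - 1)) +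
      ENNReal.ofReal (∫ _ in (x - 1)..y, (1 : ℝ) ∂m)) x :=
    (continuous_const.add (ENNReal.continuous_ofReal.comp hc)).continuousAt
  refine hc'.congr ?_
  filter_upwards [Ioi_mem_nhds (show x - 1 < x by linarith)] with y hy
  have hy' : x - 1 ≤ y := le_of_lt hy
  rw [intervalIntegral.integral_of_le hy', setIntegral_const, smul_eq_mul, mul_one,
    Measure.real, ENNReal.ofReal_toReal, ← measure_union _ measurableSet_Ioc,
    Iic_union_Ioc_eq_Iic hy', measure_congr Iio_ae_eq_Iic]
  · exact disjoint_left.2 fun z hz hz' => not_lt.2 hz hz'.1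
  · exact ((measure_mono Ioc_subset_Iic_self).trans_lt
      ((measure_congr Iio_ae_eq_Iic).symm.trans_lt (h y))).ne

theorem continuous_prim {V : Measure ℝ} [NullSingletonClass V] {W : ℝ → ℝ≥0∞} (h : ∀ x, prim V W x ≠ ⊤) :
    Continuous (prim V W) := by
  have := nullSingletonClass_withDensity V W
  rw [show prim V W = fun x => V.withDensity W (Iio x) from funext (prim_eq_withDensity V W)]
  exact continuous_measure_Iio _ fun x => by
    rw [← prim_eq_withDensity]; exact (h x).lt_top

theorem continuous_tail {μ : Measure ℝ} [NullSingletonClass μ] {φ : ℝ → ℝ≥0∞} (h : ∫⁻ x, φ x ∂μ ≠ ⊤) :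
    Continuous (tail μ φ) := by
  have := nullSingletonClass_withDensity μ φ
  have huniv : μ.withDensity φ univ ≠ ⊤ := by
    rwa [withDensity_apply _ MeasurableSet.univ, Measure.restrict_univ]
  have hfin : IsFiniteMeasure (μ.withDensity φ) := ⟨huniv.lt_top⟩
  have : tail μ φ = fun x => μ.withDensity φ univ - μ.withDensity φ (Iio x) := by
    funext x
    rw [tail_eq_withDensity, measure_congr Iio_ae_eq_Iic, ← compl_Iic,
      measure_compl measurableSet_Iic (measure_ne_top _ _)]
  rw [this]
  exact (ENNReal.continuous_sub_left huniv).comp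
    (continuous_measure_Iio _ fun x => measure_lt_top _ _)

/-! ### Supersolutions below the Hardy constant, by monotone iteration. -/

/-- Subtract θA, then divide by A^(1/p); both operations need A finite beforehand, but the resulting
bound does not depend on A. -/
theorem le_of_absorb {p : ℝ} (hp : 1 < p) {A N θ : ℝ≥0∞} (hA : A ≠ ⊤) (hθ : θ < 1)
    (h : A ≤ N * A ^ (1 / p) + θ * A) : A ≤ (N / (1 - θ)) ^ Real.conjExponent p := by
  have hpq : p.HolderConjugate (Real.conjExponent p) := Real.HolderConjugate.conjExponent hp
  have hq0 := hpq.symm.pos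
  have hp0 : 0 < p := by linarith
  rcases eq_or_ne A 0 with rfl | hA0
  · exact zero_le
  have hθ' : 1 - θ ≠ 0 := (tsub_pos_of_lt hθ).ne'
  have h1 : (1 - θ) * A ≤ N * A ^ (1 / p) := by
    have : (1 - θ) * A + θ * A ≤ N * A ^ (1 / p) + θ * A := by
      rwa [← add_mul, tsub_add_cancel_of_le hθ.le, one_mul]
    exact (ENNReal.add_le_add_iff_right (ENNReal.mul_ne_top hθ.ne_top hA)).1 this
  have h2 : A ≤ N / (1 - θ) * A ^ (1 / p) := by
    rw [← ENNReal.mul_div_right_comm, ENNReal.le_div_iff_mul_le (Or.inl hθ')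
      (Or.inl (ENNReal.sub_ne_top ENNReal.one_ne_top)), mul_comm]
    exact h1
  have hpow0 : A ^ (1 / p) ≠ 0 := (ENNReal.rpow_pos (pos_iff_ne_zero.2 hA0) hA).ne'
  have hpowt : A ^ (1 / p) ≠ ⊤ := ENNReal.rpow_ne_top_of_nonneg (by positivity) hA
  have h3 : A ^ (1 / Real.conjExponent p) ≤ N / (1 - θ) := by
    refine (ENNReal.mul_le_mul_iff_left hpow0 hpowt).1 ?_
    rw [← ENNReal.rpow_add _ _ hA0 hA]
    have : 1 / Real.conjExponent p + 1 / p = 1 := by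
      rw [one_div, one_div, add_comm]; exact hpq.inv_add_inv_eq_one
    rwa [this, ENNReal.rpow_one]
  calc A = (A ^ (1 / Real.conjExponent p)) ^ Real.conjExponent p := by
        rw [← ENNReal.rpow_mul, one_div_mul_cancel hq0.ne', ENNReal.rpow_one]
    _ ≤ _ := ENNReal.rpow_le_rpow h3 hq0.le

/-- The dual Hardy inequality: W = (tail φ)^(p*-1) satisfies W^p = (tail φ)^(p*), and ∫ W^p ≤ ∫ φ ·
prim W ≤ ‖φ‖_(p*) L^(-1/p) ‖W‖_p, so ‖W‖_p can be divided out. -/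
theorem Hardy.dual {p : ℝ} (hp : 1 < p) {μ V : Measure ℝ} [SFinite μ] [SFinite V] {L : ℝ≥0∞}
    (hL : Hardy p μ V L) (hL0 : L ≠ 0) (hV : ∀ x, V (Iio x) < ⊤) {φ : ℝ → ℝ≥0∞}
    (hφ : AEMeasurable φ μ) (hfin : ∫⁻ x, φ x ^ Real.conjExponent p ∂μ ≠ ⊤) :
    ∫⁻ s, tail μ φ s ^ Real.conjExponent p ∂V ≠ ⊤ := by
  set q := Real.conjExponent p with hq
  have hpq : p.HolderConjugate q := Real.HolderConjugate.conjExponent hp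
  have hq0 := hpq.symm.pos
  have hp0 : 0 < p := by linarith
  have hq1 : 0 < q - 1 := conj_sub_one_pos hp
  -- Truncation in height and in range makes each energy finite, as the division requires; Fatou
  -- removes it at the end.
  let W : ℕ → ℝ → ℝ≥0∞ := fun n => (Iio (n : ℝ)).indicator fun s => min (tail μ φ s) n ^ (q - 1)
  have hWm : ∀ n, Measurable (W n) := fun n =>
    (((measurable_tail μ φ).min measurable_const).pow_const _).indicator measurableSet_Iio
  have hWt : ∀ n, ∀ᵐ s ∂V, W n s ^ (p - 1) ≤ tail μ φ s := by
    intro n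
    refine Eventually.of_forall fun s => ?_
    by_cases hs : s < n
    · simp only [W, indicator, mem_Iio, hs, if_true]
      rw [← ENNReal.rpow_mul, conj_sub_one_mul hp, ENNReal.rpow_one]
      exact min_le_left _ _
    · simp [W, hs, show 0 < p - 1 by linarith]
  have hA : ∀ n, ∫⁻ s, W n s ^ p ∂V ≠ ⊤ := by
    intro n
    have : ∫⁻ s, W n s ^ p ∂V ≤ ∫⁻ s in Iio (n : ℝ), ((n : ℝ≥0∞) ^ (q - 1)) ^ p ∂V := by
      rw [← lintegral_indicator measurableSet_Iio]
      refine lintegral_mono fun s => ?_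
      by_cases hs : s < n
      · simp only [W, indicator, mem_Iio, hs, if_true]
        gcongr
        exact min_le_right _ _
      · simp [W, indicator, hs, hp0]
    refine ne_top_of_le_ne_top ?_ this
    rw [lintegral_const, Measure.restrict_apply_univ]
    exact ENNReal.mul_ne_top (ENNReal.rpow_ne_top_of_nonneg hp0.le
      (ENNReal.rpow_ne_top_of_nonneg hq1.le (ENNReal.natCast_ne_top n))) (hV _).ne
  set N := (∫⁻ x, φ x ^ q ∂μ) ^ (1 / q) * (L⁻¹) ^ (1 / p) with hN
  have hNt : N ≠ ⊤ := ENNReal.mul_ne_top (ENNReal.rpow_ne_top_of_nonneg (by positivity) hfin)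
    (ENNReal.rpow_ne_top_of_nonneg (by positivity) (ENNReal.inv_ne_top.2 hL0))
  have hbound : ∀ n, ∫⁻ s, W n s ^ p ∂V ≤ N ^ q := by
    intro n
    have h1 := energy_le_of_subsolution hp hφ (hWm n).aemeasurable (hWt n)
    have h2 := ENNReal.lintegral_mul_le_Lp_mul_Lq μ hpq.symm hφ
      (measurable_prim V (W n)).aemeasurable
    have h3 : ∫⁻ x, prim V (W n) x ^ p ∂μ ≤ (∫⁻ s, W n s ^ p ∂V) * L⁻¹ := by
      rw [← div_eq_mul_inv, ENNReal.le_div_iff_mul_le (Or.inl hL0) (Or.inr (hA n)), mul_comm]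
      exact hL _ (hWm n).aemeasurable
    have h4 : ∫⁻ s, W n s ^ p ∂V ≤ N * (∫⁻ s, W n s ^ p ∂V) ^ (1 / p) + 0 * ∫⁻ s, W n s ^ p ∂V := by
      refine h1.trans (h2.trans ?_)
      calc _ ≤ (∫⁻ x, φ x ^ q ∂μ) ^ (1 / q) * ((∫⁻ s, W n s ^ p ∂V) * L⁻¹) ^ (1 / p) := by
            gcongr
        _ = _ := by
          rw [ENNReal.mul_rpow_of_nonneg _ _ (by positivity), hN]; ring
    simpa using le_of_absorb hp (hA n) (by simp) h4
  have hlim : ∀ s, Tendsto (fun n => W n s ^ p) atTop (𝓝 (tail μ φ s ^ q)) := by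
    intro s
    have h1 : Tendsto (fun n : ℕ => (min (tail μ φ s) n ^ (q - 1)) ^ p) atTop
        (𝓝 (tail μ φ s ^ q)) := by
      have h2 : Tendsto (fun n : ℕ => min (tail μ φ s) (n : ℝ≥0∞)) atTop
          (𝓝 (min (tail μ φ s) ⊤)) :=
        tendsto_const_nhds.min ENNReal.tendsto_nat_nhds_top
      have h3 := (ENNReal.continuous_rpow_const (y := q)).continuousAt.tendsto.comp h2
      simpa [Function.comp_def, ← ENNReal.rpow_mul, conj_sub_one_mul_self hp, hq] using h3
    refine h1.congr' ?_
    obtain ⟨m, hm⟩ := exists_nat_gt s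
    filter_upwards [eventually_ge_atTop m] with n hn
    have : s < n := hm.trans_le (by exact_mod_cast hn)
    simp [W, this]
  have : ∫⁻ s, tail μ φ s ^ q ∂V ≤ N ^ q :=
    calc ∫⁻ s, tail μ φ s ^ q ∂V = ∫⁻ s, liminf (fun n => W n s ^ p) atTop ∂V :=
          lintegral_congr fun s => (hlim s).liminf_eq.symm
      _ ≤ liminf (fun n => ∫⁻ s, W n s ^ p ∂V) atTop :=
          lintegral_liminf_le fun n => (hWm n).pow_const _
      _ ≤ liminf (fun _ : ℕ => N ^ q) atTop :=
          liminf_le_liminf (Eventually.of_forall hbound)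
      _ = N ^ q := liminf_const _
  exact ne_top_of_le_ne_top (ENNReal.rpow_ne_top_of_nonneg hq0.le hNt) this

/-- The equation is a fixed point problem for an order-preserving map, iterated from 0. Because c/L
< 1, the nonlocal term is absorbed into the energy, so the increasing limit still has finite energy.
-/
theorem Hardy.exists_supersolution {p : ℝ} (hp : 1 < p) {μ V : Measure ℝ} [SFinite μ] [SFinite V]
    {L c : ℝ≥0∞} (hL : Hardy p μ V L) (hc : c < L) (hV : ∀ x, V (Iio x) < ⊤) {η : ℝ → ℝ≥0∞}
    (hη : Measurable η) (hηfin : ∫⁻ s, η s ^ Real.conjExponent p ∂V ≠ ⊤) :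
    ∃ W : ℝ → ℝ≥0∞, Measurable W ∧
      (∀ s, W s = (η s + c * tail μ (fun t => prim V W t ^ (p - 1)) s)
        ^ (Real.conjExponent p - 1)) ∧ ∫⁻ s, W s ^ p ∂V ≠ ⊤ := by
  set q := Real.conjExponent p with hq
  have hpq : p.HolderConjugate q := Real.HolderConjugate.conjExponent hp
  have hq0 := hpq.symm.pos
  have hp0 : 0 < p := by linarith
  have hp1 : 0 < p - 1 := by linarith
  have hq1 : 0 < q - 1 := conj_sub_one_pos hp
  have hL0 : L ≠ 0 := (zero_le.trans_lt hc).ne'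
  let y : (ℝ → ℝ≥0∞) → ℝ → ℝ≥0∞ := fun W s => η s + c * tail μ (fun t => prim V W t ^ (p - 1)) s
  let W : ℕ → ℝ → ℝ≥0∞ := fun n => (fun W s => y W s ^ (q - 1))^[n] 0
  have hW0 : W 0 = 0 := rfl
  have hWs : ∀ n s, W (n + 1) s = y (W n) s ^ (q - 1) := fun n s => by
    simp only [W, Function.iterate_succ_apply']
  have hym : ∀ W, Measurable (y W) := fun W => hη.add ((measurable_tail _ _).const_mul _)
  have hWm : ∀ n, Measurable (W n) := by
    intro n
    cases n with
    | zero => exact measurable_const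
    | succ n => rw [show W (n + 1) = _ from funext (hWs n)]; exact (hym _).pow_const _
  have hprim : ∀ {W W' : ℝ → ℝ≥0∞}, W ≤ W' → ∀ s, y W s ≤ y W' s := by
    intro W W' h s
    have : tail μ (fun t => prim V W t ^ (p - 1)) s ≤ tail μ (fun t => prim V W' t ^ (p - 1)) s :=
      tail_mono (Eventually.of_forall fun t =>
        ENNReal.rpow_le_rpow (prim_mono (Eventually.of_forall h) t) hp1.le) s
    simp only [y]
    gcongr
  have hmono1 : ∀ n, W n ≤ W (n + 1) := by
    intro n
    induction n with
    | zero => rw [hW0]; exact fun s => zero_le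
    | succ n ih =>
      intro s
      rw [hWs, hWs]
      exact ENNReal.rpow_le_rpow (hprim ih s) hq1.le
  have hmono : Monotone W := monotone_nat_of_le_succ hmono1
  have hmass : ∀ n, ∫⁻ s, W n s ^ p ∂V ≠ ⊤ → ∫⁻ x, prim V (W n) x ^ p ∂μ
      ≤ (∫⁻ s, W n s ^ p ∂V) * L⁻¹ := by
    intro n hn
    rw [← div_eq_mul_inv, ENNReal.le_div_iff_mul_le (Or.inl hL0) (Or.inr hn), mul_comm]
    exact hL _ (hWm n).aemeasurable
  -- Qualitative finiteness, by induction through the dual inequality; the bound uniform in n needs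
  -- it before it can absorb.
  have hA : ∀ n, ∫⁻ s, W n s ^ p ∂V ≠ ⊤ := by
    intro n
    induction n with
    | zero => simp [hW0, hp0]
    | succ n ih =>
      have h1 : ∫⁻ x, prim V (W n) x ^ p ∂μ ≠ ⊤ :=
        ne_top_of_le_ne_top (ENNReal.mul_ne_top ih (ENNReal.inv_ne_top.2 hL0)) (hmass n ih)
      have h2 : ∫⁻ x, (prim V (W n) x ^ (p - 1)) ^ q ∂μ ≠ ⊤ := by
        simpa only [← ENNReal.rpow_mul, sub_one_mul_conj hp, hq] using h1
      have h3 := hL.dual hp hL0 hV ((measurable_prim V (W n)).pow_const (p - 1)).aemeasurable h2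
      have h4 : ∫⁻ s, W (n + 1) s ^ p ∂V = ∫⁻ s, (η + fun s => c * tail μ
          (fun t => prim V (W n) t ^ (p - 1)) s) s ^ q ∂V := by
        refine lintegral_congr fun s => ?_
        rw [hWs, ← ENNReal.rpow_mul, conj_sub_one_mul_self hp]; rfl
      rw [h4]
      refine (ENNReal.lintegral_rpow_add_lt_top_of_lintegral_rpow_lt_top hη.aemeasurable
        hηfin.lt_top ?_ hpq.symm.lt.le).ne
      have h5 : ∀ s, (c * tail μ (fun t => prim V (W n) t ^ (p - 1)) s) ^ q
          = c ^ q * tail μ (fun t => prim V (W n) t ^ (p - 1)) s ^ q := fun s =>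
        ENNReal.mul_rpow_of_nonneg _ _ hq0.le
      simp_rw [h5]
      rw [lintegral_const_mul _ ((measurable_tail _ _).pow_const _)]
      exact (ENNReal.mul_ne_top (ENNReal.rpow_ne_top_of_nonneg hq0.le hc.ne_top) h3).lt_top
  set N := (∫⁻ s, η s ^ q ∂V) ^ (1 / q) with hN
  have hNt : N ≠ ⊤ := ENNReal.rpow_ne_top_of_nonneg (by positivity) hηfin
  have hθ : c * L⁻¹ < 1 := by
    rw [← div_eq_mul_inv, ENNReal.div_lt_iff (Or.inl hL0) (Or.inr hc.ne_top), one_mul]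
    exact hc
  -- Test the recursion with the new iterate: the source contributes N ‖W‖_p by Hölder, and the
  -- nonlocal term at most c/L times the energy, since the old iterate lies below the new one.
  have hbound : ∀ n, ∫⁻ s, W (n + 1) s ^ p ∂V ≤ (N / (1 - c * L⁻¹)) ^ q := by
    intro n
    refine le_of_absorb hp (hA _) hθ ?_
    have h1 : ∫⁻ s, W (n + 1) s ^ p ∂V = ∫⁻ s, η s * W (n + 1) s ∂V
        + c * ∫⁻ s, W (n + 1) s * tail μ (fun t => prim V (W n) t ^ (p - 1)) s ∂V := by
      rw [← lintegral_const_mul (μ := V) c (f := fun s => W (n + 1) s *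
        tail μ (fun t => prim V (W n) t ^ (p - 1)) s) ((hWm (n + 1)).mul (measurable_tail _ _)),
        ← lintegral_add_left (f := fun s => η s * W (n + 1) s) (hη.mul (hWm _))]
      refine lintegral_congr fun s => ?_
      have e2 : W (n + 1) s ^ (p - 1) = y (W n) s := by
        rw [hWs, ← ENNReal.rpow_mul, conj_sub_one_mul hp, ENNReal.rpow_one]
      rw [← mul_rpow_sub_one hp, e2]; simp only [y]; ring
    refine h1.le.trans ?_
    rw [← lintegral_mul_prim ((measurable_prim V (W n)).pow_const (p - 1)).aemeasurable
      (hWm _).aemeasurable]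
    refine add_le_add ?_ ?_
    · exact (ENNReal.lintegral_mul_le_Lp_mul_Lq V hpq.symm hη.aemeasurable
        (hWm (n + 1)).aemeasurable)
    · rw [mul_assoc, mul_comm L⁻¹]
      refine mul_le_mul_right (le_trans (lintegral_mono fun x => ?_) (hmass _ (hA _))) _
      calc _ ≤ prim V (W (n + 1)) x ^ (p - 1) * prim V (W (n + 1)) x := by
            gcongr
            exact prim_mono (Eventually.of_forall (hmono1 n)) x
        _ = _ := by rw [mul_comm, mul_rpow_sub_one hp]
  let Wi : ℝ → ℝ≥0∞ := fun s => ⨆ n, W n s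
  have hlim : ∀ s, Tendsto (fun n => W n s) atTop (𝓝 (Wi s)) := fun s =>
    tendsto_atTop_iSup fun m n h => hmono h s
  have hlimp : ∀ x, Tendsto (fun n => prim V (W n) x) atTop (𝓝 (prim V Wi x)) := fun x =>
    lintegral_tendsto_of_tendsto_of_monotone (fun n => (hWm n).aemeasurable)
      (Eventually.of_forall fun s m n h => hmono h s) (Eventually.of_forall hlim)
  have hlimt : ∀ x, Tendsto (fun n => tail μ (fun t => prim V (W n) t ^ (p - 1)) x) atTop
      (𝓝 (tail μ (fun t => prim V Wi t ^ (p - 1)) x)) := fun x =>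
    lintegral_tendsto_of_tendsto_of_monotone
      (fun n => ((measurable_prim _ _).pow_const _).aemeasurable)
      (Eventually.of_forall fun s m n h => ENNReal.rpow_le_rpow
        (prim_mono (Eventually.of_forall (hmono h)) s) hp1.le)
      (Eventually.of_forall fun s =>
        (ENNReal.continuous_rpow_const (y := p - 1)).continuousAt.tendsto.comp (hlimp s))
  refine ⟨Wi, Measurable.iSup hWm, fun s => ?_, ?_⟩
  · refine tendsto_nhds_unique ((tendsto_add_atTop_iff_nat 1).2 (hlim s)) ?_
    simp_rw [hWs]
    refine (ENNReal.continuous_rpow_const (y := q - 1)).continuousAt.tendsto.comp ?_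
    exact tendsto_const_nhds.add (ENNReal.Tendsto.const_mul (hlimt s) (Or.inr hc.ne_top))
  · have h1 : Tendsto (fun n => ∫⁻ s, W (n + 1) s ^ p ∂V) atTop (𝓝 (∫⁻ s, Wi s ^ p ∂V)) :=
      (tendsto_add_atTop_iff_nat 1).2 (lintegral_tendsto_of_tendsto_of_monotone
        (fun n => ((hWm n).pow_const p).aemeasurable)
        (Eventually.of_forall fun s m n h => ENNReal.rpow_le_rpow (hmono h s) hp0.le)
        (Eventually.of_forall fun s =>
          (ENNReal.continuous_rpow_const (y := p)).continuousAt.tendsto.comp (hlim s)))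
    refine ne_top_of_le_ne_top ?_ (le_of_tendsto' h1 hbound)
    exact ENNReal.rpow_ne_top_of_nonneg hq0.le (ENNReal.div_ne_top hNt (tsub_pos_of_lt hθ).ne')

/-! ### Shooting above the Hardy constant, with a delay. -/

theorem prim_congr {V : Measure ℝ} {W W' : ℝ → ℝ≥0∞} {x : ℝ} (h : ∀ s < x, W s = W' s) :
    prim V W x = prim V W' x :=
  setLIntegral_congr_fun measurableSet_Iio h

theorem prim_add_Ico (V : Measure ℝ) (W : ℝ → ℝ≥0∞) {x y : ℝ} (h : x ≤ y) :
    prim V W y = prim V W x + ∫⁻ s in Ico x y, W s ∂V := by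
  rw [prim, prim, ← lintegral_union measurableSet_Ico, Iio_union_Ico_eq_Iio h]
  exact disjoint_left.2 fun z hz hz' => not_lt.2 hz'.1 hz

theorem prim_zero {V : Measure ℝ} (hV : V (Iio 0) = 0) (W : ℝ → ℝ≥0∞) {x : ℝ} (hx : x ≤ 0) :
    prim V W x = 0 :=
  setLIntegral_measure_zero _ _ (measure_mono_null (Iio_subset_Iio hx) hV)

theorem antitone_mul_le_prim {V : Measure ℝ} {W : ℝ → ℝ≥0∞} (hW : Antitone W) (x : ℝ) :
    W x * V (Iio x) ≤ prim V W x := by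
  rw [← setLIntegral_const]
  exact setLIntegral_mono hW.measurable fun s hs => hW (le_of_lt hs)

/-- W is at least W x to the left of x and at most W x on [x, y), so the relative growth of its
primitive is controlled by that of V. -/
theorem prim_le_of_antitone {V : Measure ℝ} {W : ℝ → ℝ≥0∞} (hW : Antitone W) {x y : ℝ}
    (hxy : x ≤ y) {ε : ℝ≥0∞} (h : V (Ico x y) ≤ ε * V (Iio x)) :
    prim V W y ≤ (1 + ε) * prim V W x := by
  rw [prim_add_Ico V W hxy, add_mul, one_mul]
  gcongr
  calc ∫⁻ s in Ico x y, W s ∂V ≤ ∫⁻ s in Ico x y, W x ∂V :=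
        setLIntegral_mono measurable_const fun s hs => hW hs.1
    _ = W x * V (Ico x y) := setLIntegral_const _ _
    _ ≤ W x * (ε * V (Iio x)) := by gcongr
    _ = ε * (W x * V (Iio x)) := by ring
    _ ≤ _ := by gcongr; exact antitone_mul_le_prim hW x

/-- The right-hand side of the delayed initial value problem. -/
def delayed (p : ℝ) (μ : Measure ℝ) (c : ℝ≥0∞) (δ : ℝ) (F : ℝ → ℝ≥0∞) (s : ℝ) : ℝ≥0∞ :=
  (1 - c * prim μ (fun t => F (t - δ) ^ (p - 1)) s) ^ (Real.conjExponent p - 1)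

theorem delayed_antitone {p : ℝ} (hp : 1 < p) (μ : Measure ℝ) (c : ℝ≥0∞) (δ : ℝ)
    (F : ℝ → ℝ≥0∞) : Antitone (delayed p μ c δ F) := fun x y h => by
  refine ENNReal.rpow_le_rpow (tsub_le_tsub_left ?_ _) (conj_sub_one_pos hp).le
  gcongr
  exact prim_mono_right _ _ h

theorem delayed_le_one {p : ℝ} (hp : 1 < p) (μ : Measure ℝ) (c : ℝ≥0∞) (δ : ℝ)
    (F : ℝ → ℝ≥0∞) (s : ℝ) : delayed p μ c δ F s ≤ 1 :=
  ENNReal.rpow_le_one tsub_le_self (conj_sub_one_pos hp).le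

theorem delayed_rpow {p : ℝ} (hp : 1 < p) (μ : Measure ℝ) (c : ℝ≥0∞) (δ : ℝ)
    (F : ℝ → ℝ≥0∞) (s : ℝ) : delayed p μ c δ F s ^ (p - 1)
      = 1 - c * prim μ (fun t => F (t - δ) ^ (p - 1)) s := by
  rw [delayed, ← ENNReal.rpow_mul, conj_sub_one_mul hp, ENNReal.rpow_one]

/-- The delayed initial value problem has a solution on `(-∞, b]`, by the method of steps. -/
theorem exists_delayed_solution {p : ℝ} (hp : 1 < p) {μ V : Measure ℝ}
    (hV0 : V (Iio 0) = 0) (c : ℝ≥0∞) {δ : ℝ} (hδ : 0 < δ) (b : ℝ) :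
    ∃ F : ℝ → ℝ≥0∞, Measurable F ∧ (∀ x, F x ≤ V (Iio x)) ∧
      ∀ x ≤ b, prim V (delayed p μ c δ F) x = F x := by
  let T : (ℝ → ℝ≥0∞) → ℝ → ℝ≥0∞ := fun F => prim V (delayed p μ c δ F)
  -- Up to (n+1)δ the map T reads its argument only below nδ, so each iteration fixes one more
  -- interval of length δ.
  have hstep : ∀ n : ℕ, ∀ x ≤ n * δ, T^[n + 1] 0 x = T^[n] 0 x := by
    intro n
    induction n with
    | zero =>
      intro x hx
      simp only [Nat.cast_zero, zero_mul] at hx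
      simpa [T] using prim_zero hV0 _ hx
    | succ n ih =>
      intro x hx
      rw [Function.iterate_succ_apply' T (n + 1), Function.iterate_succ_apply' T n]
      refine prim_congr fun s hs => ?_
      unfold delayed
      congr 3
      refine prim_congr fun t ht => ?_
      rw [← Function.iterate_succ_apply' T n, ih]
      push_cast at hx
      linarith
  obtain ⟨N, hN⟩ := exists_nat_gt (b / δ)
  rw [div_lt_iff₀ hδ] at hN
  refine ⟨T^[N] 0, ?_, fun x => ?_, fun x hx => ?_⟩
  · cases N with
    | zero => exact measurable_const
    | succ N => rw [Function.iterate_succ_apply']; exact measurable_prim _ _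
  · cases N with
    | zero => exact zero_le
    | succ N =>
      rw [Function.iterate_succ_apply']
      exact (prim_mono (Eventually.of_forall (delayed_le_one hp _ _ _ _)) x).trans_eq
        (by simp [prim])
  · rw [← hstep N x (by linarith), Function.iterate_succ_apply']

/-- The gap between c₁ and c pays for the factor lost when the delay is removed. -/
theorem exists_one_add_rpow_le {p : ℝ} {c₁ c : ℝ≥0∞} (h : c₁ < c) :
    ∃ ε : ℝ, 0 < ε ∧ c₁ * (1 + ENNReal.ofReal ε) ^ (p - 1) ≤ c := by
  have h1 : Tendsto (fun ε : ℝ => c₁ * (1 + ENNReal.ofReal ε) ^ (p - 1)) (𝓝[>] 0) (𝓝 c₁) := by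
    have : Tendsto (fun ε : ℝ => (1 + ENNReal.ofReal ε) ^ (p - 1)) (𝓝[>] 0)
        (𝓝 ((1 + ENNReal.ofReal 0) ^ (p - 1))) :=
      ((ENNReal.continuous_rpow_const.comp
        (continuous_const.add ENNReal.continuous_ofReal)).tendsto 0).mono_left nhdsWithin_le_nhds
    simpa using ENNReal.Tendsto.const_mul this (Or.inr h.ne_top)
  obtain ⟨ε, h2, h3⟩ := ((h1.eventually_lt_const h).and self_mem_nhdsWithin).exists
  exact ⟨ε, h3, h2.le⟩

/-- The distribution function of V is uniformly continuous on [a/2, b], and its positive value at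
a/2 turns absolute smallness into relative smallness. This is why the shooting argument works with
an interval bounded away from 0. -/
theorem exists_small_Ico {V : Measure ℝ} [NullSingletonClass V] (hV : ∀ x, V (Iio x) < ⊤)
    (hVpos : ∀ x > 0, V (Iio x) ≠ 0) {a b ε : ℝ} (ha : 0 < a) (hε : 0 < ε) :
    ∃ δ > 0, ∀ t ∈ Icc a b, V (Ico (t - δ) t) ≤ ENNReal.ofReal ε * V (Iio (t - δ)) := by
  have hcont : Continuous fun x => (V (Iio x)).toReal :=
    ENNReal.continuousOn_toReal.comp_continuous (continuous_measure_Iio V hV) fun x => (hV x).ne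
  have huc := isCompact_Icc.uniformContinuousOn_of_continuous (s := Icc (a / 2) b)
    hcont.continuousOn
  rw [Metric.uniformContinuousOn_iff] at huc
  have hpos : 0 < (V (Iio (a / 2))).toReal :=
    ENNReal.toReal_pos (hVpos _ (by linarith)) (hV _).ne
  obtain ⟨δ, hδ, h⟩ := huc (ε * (V (Iio (a / 2))).toReal) (by positivity)
  refine ⟨min (δ / 2) (a / 2), lt_min (by linarith) (by linarith), fun t ht => ?_⟩
  set e := min (δ / 2) (a / 2) with he
  have he1 : e ≤ δ / 2 := min_le_left _ _
  have he2 : e ≤ a / 2 := min_le_right _ _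
  have he0 : 0 < e := lt_min (by linarith) (by linarith)
  have ht1 := ht.1
  have ht2 := ht.2
  have h1 := h t ⟨by linarith, ht.2⟩ (t - e) ⟨by linarith, by linarith⟩
    (by rw [Real.dist_eq, sub_sub_cancel, abs_of_pos he0]; linarith)
  rw [Real.dist_eq] at h1
  have h2 : V (Iio t) = V (Iio (t - e)) + V (Ico (t - e) t) := by
    rw [← measure_union _ measurableSet_Ico, Iio_union_Ico_eq_Iio (by linarith)]
    exact disjoint_left.2 fun z hz hz' => not_lt.2 hz'.1 hz
  have hI : V (Ico (t - e) t) ≠ ⊤ :=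
    ((measure_mono fun z hz => hz.2).trans_lt (hV t)).ne
  have h3 : (V (Ico (t - e) t)).toReal ≤ ε * (V (Iio (a / 2))).toReal := by
    have := (abs_lt.1 h1).2
    rw [h2, ENNReal.toReal_add (hV _).ne hI] at this
    linarith
  calc V (Ico (t - e) t) = ENNReal.ofReal (V (Ico (t - e) t)).toReal :=
        (ENNReal.ofReal_toReal hI).symm
    _ ≤ ENNReal.ofReal (ε * (V (Iio (a / 2))).toReal) := ENNReal.ofReal_le_ofReal h3
    _ = ENNReal.ofReal ε * V (Iio (a / 2)) := by
        rw [ENNReal.ofReal_mul hε.le, ENNReal.ofReal_toReal (hV _).ne]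
    _ ≤ _ := by gcongr; linarith

/-- Shooting: if the Hardy inequality fails with a constant `c₁ < c`, there is a decreasing
subsolution with constant `c` that is stopped before `b`. -/
theorem exists_stopped_subsolution {p : ℝ} (hp : 1 < p) {μ V : Measure ℝ} [IsFiniteMeasure μ]
    [SFinite V] [NullSingletonClass μ] [NullSingletonClass V] (hV : ∀ x, V (Iio x) < ⊤)
    (hV0 : V (Iio 0) = 0) (hμ0 : μ (Iio 0) = 0) (hVpos : ∀ x > 0, V (Iio x) ≠ 0) {a b : ℝ}
    (ha : 0 < a) (hab : a < b) {c₁ c : ℝ≥0∞} (hc : c₁ < c) (hctop : c ≠ ⊤) {G : ℝ → ℝ≥0∞}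
    (hG : AEMeasurable G V)
    (hlt : ∫⁻ s, G s ^ p ∂V < c₁ * ∫⁻ x in Ioo a b, prim V G x ^ p ∂μ) :
    ∃ x₀ ∈ Ioc 0 b, ∃ W : ℝ → ℝ≥0∞, Continuous W ∧ Antitone W ∧ (∀ s, W s ≤ 1) ∧
      (∀ s < x₀, W s ≠ 0) ∧
      ∀ s < x₀, W s ^ (p - 1) ≤ c * ∫⁻ t in Ioo s x₀, prim V W t ^ (p - 1) ∂μ := by
  have hp1 : 0 < p - 1 := by linarith
  obtain ⟨ε, hε, hεc⟩ := exists_one_add_rpow_le (p := p) hc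
  obtain ⟨δ, hδ, hδV⟩ := exists_small_Ico hV hVpos (b := b) ha hε
  obtain ⟨F, hFm, hFV, hF⟩ := exists_delayed_solution hp (μ := μ) hV0 c hδ b
  set W := delayed p μ c δ F with hW
  set g : ℝ → ℝ≥0∞ := fun t => F (t - δ) ^ (p - 1) with hg
  set Z : ℝ → ℝ≥0∞ := fun s => c * prim μ g s with hZ
  have hanti : Antitone W := delayed_antitone hp _ _ _ _
  have hWle : ∀ s, W s ≤ 1 := delayed_le_one hp _ _ _ _
  have hWZ : ∀ s, W s ^ (p - 1) = 1 - Z s := delayed_rpow hp _ _ _ _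
  have hgfin : ∀ s, prim μ g s ≠ ⊤ := by
    intro s
    have : prim μ g s ≤ ∫⁻ t in Iio s, V (Iio s) ^ (p - 1) ∂μ := by
      refine setLIntegral_mono measurable_const fun t ht => ?_
      refine ENNReal.rpow_le_rpow ((hFV _).trans (measure_mono (Iio_subset_Iio ?_))) hp1.le
      have : t < s := ht
      linarith
    refine ne_top_of_le_ne_top ?_ this
    rw [setLIntegral_const]
    exact ENNReal.mul_ne_top (ENNReal.rpow_ne_top_of_nonneg hp1.le (hV s).ne) (measure_ne_top _ _)
  have hZfin : ∀ s, Z s ≠ ⊤ := fun s => ENNReal.mul_ne_top hctop (hgfin s)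
  have hZcont : Continuous Z :=
    (ENNReal.continuous_const_mul hctop).comp (continuous_prim hgfin)
  have hWcont : Continuous W :=
    ENNReal.continuous_rpow_const.comp ((ENNReal.continuous_sub_left ENNReal.one_ne_top).comp hZcont)
  have hZ0 : Z 0 = 0 := by simp [hZ, prim_zero hμ0]
  have hZadd : ∀ {x y : ℝ}, x ≤ y → Z y = Z x + c * ∫⁻ t in Ico x y, g t ∂μ := by
    intro x y h
    simp only [hZ]
    rw [prim_add_Ico μ g h, mul_add]
  have hFmono : ∀ t ≤ b, F (t - δ) ≤ F t := fun t ht => by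
    rw [← hF t ht, ← hF (t - δ) (by linarith)]
    exact prim_mono_right _ _ (by linarith)
  have hq0 : Real.conjExponent p - 1 ≠ 0 := (conj_sub_one_pos hp).ne'
  have hWne : ∀ s, Z s < 1 → W s ≠ 0 := fun s hs h => by
    have := hWZ s
    rw [h, ENNReal.zero_rpow_of_pos hp1] at this
    exact (tsub_pos_of_lt hs).ne this
  -- Z is the amount subtracted from 1 in W^(p-1). If it stays below 1 up to b, then W is a
  -- supersolution with constant c₁ and contradicts the failure of Hardy; otherwise W vanishes
  -- somewhere in (0, b].
  rcases lt_or_ge (Z b) 1 with hb | hb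
  · exfalso
    have key := hardy_of_supersolution hp (μ := μ.restrict (Ioo a b)) (V := V.restrict (Iio b))
      (c := c₁) (W := W) (F := F) (G := G) hWcont.measurable.aemeasurable hFm.aemeasurable
      hG.restrict ?_ ?_ ?_ ?_
    · have h1 : ∫⁻ x in Ioo a b, prim V G x ^ p ∂μ
          = ∫⁻ x in Ioo a b, prim (V.restrict (Iio b)) G x ^ p ∂μ := by
        refine setLIntegral_congr_fun measurableSet_Ioo fun x hx => ?_
        simp only [prim]
        rw [Measure.restrict_restrict measurableSet_Iio, inter_eq_left.2 (Iio_subset_Iio hx.2.le)]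
      rw [h1] at hlt
      exact absurd (key.trans (setLIntegral_le_lintegral _ _)) (not_le.2 hlt)
    · filter_upwards [ae_restrict_mem measurableSet_Iio] with s hs
      refine hWne s (lt_of_le_of_lt ?_ hb)
      rw [hZadd (le_of_lt hs)]
      exact le_self_add
    · exact Eventually.of_forall fun s => ((hWle s).trans_lt ENNReal.one_lt_top).ne
    · filter_upwards [ae_restrict_mem measurableSet_Ioo] with x hx
      rw [← hF x hx.2.le]
      exact lintegral_mono' (Measure.restrict_mono le_rfl Measure.restrict_le_self) le_rfl
    · filter_upwards [ae_restrict_mem measurableSet_Iio] with s hs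
      have hs' : s ≤ b := le_of_lt hs
      -- Here the delay is undone: W is decreasing, so F(t) ≤ (1 + ε) F(t - δ) on (a, b).
      have h1 : tail (μ.restrict (Ioo a b)) (fun t => F t ^ (p - 1)) s
          ≤ (1 + ENNReal.ofReal ε) ^ (p - 1) * ∫⁻ t in Ico s b, g t ∂μ := by
        have hgm : Measurable g := (hFm.comp (measurable_id.sub_const δ)).pow_const _
        rw [tail, Measure.restrict_restrict measurableSet_Ioi, ← lintegral_const_mul _ hgm]
        refine le_trans (setLIntegral_mono (hgm.const_mul ((1 + ENNReal.ofReal ε) ^ (p - 1)))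
          fun t ht => ?_) (lintegral_mono_set fun t ht => ⟨le_of_lt ht.1, ht.2.2⟩)
        rw [hg, ← ENNReal.mul_rpow_of_nonneg _ _ hp1.le]
        refine ENNReal.rpow_le_rpow ?_ hp1.le
        rw [← hF t ht.2.2.le, ← hF (t - δ) (by linarith [ht.2.2])]
        exact prim_le_of_antitone hanti (by linarith) (hδV t ⟨ht.2.1.le, ht.2.2.le⟩)
      rw [hWZ]
      refine ENNReal.le_sub_of_add_le_right (hZfin s) ?_
      calc c₁ * tail (μ.restrict (Ioo a b)) (fun t => F t ^ (p - 1)) s + Z s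
          ≤ c₁ * ((1 + ENNReal.ofReal ε) ^ (p - 1) * ∫⁻ t in Ico s b, g t ∂μ) + Z s := by gcongr
        _ ≤ c * ∫⁻ t in Ico s b, g t ∂μ + Z s := by rw [← mul_assoc]; gcongr
        _ = Z b := by rw [hZadd hs', add_comm]
        _ ≤ 1 := hb.le
  · have hcomp : IsCompact (Icc 0 b ∩ {s | 1 ≤ Z s}) :=
      isCompact_Icc.inter_right (isClosed_le continuous_const hZcont)
    obtain ⟨x₀, ⟨hx₀, hZx₀⟩, hleast⟩ := hcomp.exists_isLeast ⟨b, ⟨(ha.trans hab).le, le_rfl⟩, hb⟩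
    have hx₀pos : 0 < x₀ := by
      refine lt_of_le_of_ne hx₀.1 fun h => ?_
      rw [mem_ofPred_eq, ← h, hZ0] at hZx₀
      exact absurd hZx₀ (by simp)
    have hlt1 : ∀ s < x₀, Z s < 1 := by
      intro s hs
      rcases lt_or_ge s 0 with h0 | h0
      · refine lt_of_le_of_lt ?_ zero_lt_one
        rw [← hZ0, hZadd h0.le]
        exact le_self_add
      · by_contra h
        exact absurd (hleast ⟨⟨h0, hs.le.trans hx₀.2⟩, not_lt.1 h⟩) (not_le.2 hs)
    refine ⟨x₀, ⟨hx₀pos, hx₀.2⟩, W, hWcont, hanti, hWle, fun s hs => hWne s (hlt1 s hs),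
      fun s hs => ?_⟩
    -- Since Z x₀ ≥ 1, the difference 1 - Z s is at most c times the delayed integral over (s, x₀).
    -- In this direction the delay is harmless because F is increasing up to b.
    rw [hWZ, tsub_le_iff_left]
    refine (show (1 : ℝ≥0∞) ≤ Z x₀ from hZx₀).trans ?_
    rw [hZadd hs.le, Measure.restrict_congr_set (Ioo_ae_eq_Ico (μ := μ)).symm]
    gcongr 2
    refine setLIntegral_mono ((measurable_prim _ _).pow_const _)
      fun t ht => ENNReal.rpow_le_rpow ?_ hp1.le
    have htb : t ≤ b := ht.2.le.trans hx₀.2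
    rw [hF t htb]
    exact hFmono t htb

/-! ### The intervals with end D and the weighted measures. -/

theorem isOpen_oI (D : EReal) : IsOpen (oI D) :=
  (isOpen_lt continuous_const continuous_id).inter
    (isOpen_lt continuous_coe_real_ereal continuous_const)

theorem measurableSet_oI (D : EReal) : MeasurableSet (oI D) := (isOpen_oI D).measurableSet

theorem oI_subset_cI (D : EReal) : oI D ⊆ cI D := fun _ hx => ⟨hx.1.le, hx.2.le⟩

theorem mem_oI_of_le {D : EReal} {x y : ℝ} (hx : x ∈ oI D) (hy : 0 < y) (h : y ≤ x) : y ∈ oI D :=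
  ⟨hy, lt_of_le_of_lt (by exact_mod_cast h) hx.2⟩

theorem Ioc_subset_oI {D : EReal} {x : ℝ} (hx : x ∈ oI D) : Ioc 0 x ⊆ oI D :=
  fun _ hy => mem_oI_of_le hx hy.1 hy.2

theorem oI_nonempty {D : EReal} (hD : 0 < D) : (oI D).Nonempty := by
  obtain ⟨x, h1, h2⟩ := EReal.lt_iff_exists_real_btwn.1 hD
  exact ⟨x, by exact_mod_cast h1, h2⟩

theorem exists_gt_mem_oI {D : EReal} {x : ℝ} (hx : x ∈ oI D) : ∃ y ∈ oI D, x < y := by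
  obtain ⟨y, h1, h2⟩ := EReal.lt_iff_exists_real_btwn.1 hx.2
  have h1' : x < y := by exact_mod_cast h1
  exact ⟨y, ⟨hx.1.trans h1', h2⟩, h1'⟩

theorem exists_exhaustion {D : EReal} (hD : 0 < D) :
    ∃ b : ℕ → ℝ, Monotone b ∧ (∀ n, b n ∈ oI D) ∧ ∀ x ∈ oI D, ∃ n, x < b n := by
  induction D with
  | bot => simp at hD
  | top =>
    refine ⟨fun n => n + 1, fun m n h => by simpa using h, fun n => ⟨by positivity, ?_⟩,
      fun x _ => ?_⟩
    · exact EReal.coe_lt_top _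
    · obtain ⟨n, hn⟩ := exists_nat_gt x
      exact ⟨n, by linarith⟩
  | coe d =>
    have hd : 0 < d := by exact_mod_cast hD
    refine ⟨fun n => d - d / (n + 2), fun m n h => ?_, fun n => ⟨?_, ?_⟩, fun x hx => ?_⟩
    · have : (m : ℝ) ≤ n := by exact_mod_cast h
      simp only
      gcongr
    · have : d / (n + 2) < d := by
        rw [div_lt_iff₀ (by positivity)]
        nlinarith [(Nat.cast_nonneg n : (0 : ℝ) ≤ n)]
      linarith
    · have : 0 < d / ((n : ℝ) + 2) := by positivity
      exact_mod_cast (by linarith : d - d / ((n : ℝ) + 2) < d)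
    · have hxd : x < d := by exact_mod_cast hx.2
      obtain ⟨n, hn⟩ := exists_nat_gt (d / (d - x))
      refine ⟨n, ?_⟩
      have h0 : 0 < d - x := by linarith
      rw [div_lt_iff₀ h0] at hn
      have : d / ((n : ℝ) + 2) < d - x := by
        rw [div_lt_iff₀ (by positivity)]
        nlinarith
      linarith

/-- Standing assumptions on the weights `u` and `v`. -/
structure Weights (p : ℝ) (D : EReal) (u v : ℝ → ℝ) : Prop where
  one_lt : 1 < p
  pos : 0 < D
  u_pos : ∀ᵐ x ∂(volume.restrict (oI D)), 0 < u x
  v_pos : ∀ᵐ x ∂(volume.restrict (oI D)), 0 < v x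
  u_loc : LocallyIntegrableOn u (cI D)
  v_loc : LocallyIntegrableOn (vhat p v) (cI D)
  finite : wMeasure u D (oI D) < ⊤

section wMeasure

variable {ρ : ℝ → ℝ} {D : EReal}

theorem wMeasure_ac : wMeasure ρ D ≪ volume.restrict (oI D) := withDensity_absolutelyContinuous _ _

instance : NullSingletonClass (wMeasure ρ D) :=
  nullSingletonClass_withDensity (volume.restrict (oI D)) _

instance : SFinite (wMeasure ρ D) := by unfold wMeasure; infer_instance

theorem ae_mem_oI : ∀ᵐ x ∂(wMeasure ρ D), x ∈ oI D :=
  wMeasure_ac.ae_le (ae_restrict_mem (measurableSet_oI D))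

theorem wMeasure_Iio_zero : wMeasure ρ D (Iio 0) = 0 :=
  measure_mono_null (t := (oI D)ᶜ) (fun _ hx h => lt_asymm hx h.1) (mem_ae_iff.1 ae_mem_oI)

theorem setLIntegral_wMeasure (hρ : AEMeasurable ρ (volume.restrict (oI D))) (g : ℝ → ℝ≥0∞)
    {s : Set ℝ} (hs : MeasurableSet s) :
    ∫⁻ x in s, g x ∂(wMeasure ρ D) = ∫⁻ x in s ∩ oI D, ENNReal.ofReal (ρ x) * g x := by
  rw [wMeasure, setLIntegral_withDensity_eq_setLIntegral_mul_non_measurable₀ _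
    hρ.ennreal_ofReal.restrict _ hs (by simp), Measure.restrict_restrict hs]
  rfl

theorem lintegral_wMeasure (hρ : AEMeasurable ρ (volume.restrict (oI D))) (g : ℝ → ℝ≥0∞) :
    ∫⁻ x, g x ∂(wMeasure ρ D) = ∫⁻ x in oI D, ENNReal.ofReal (ρ x) * g x := by
  rw [← setLIntegral_univ, setLIntegral_wMeasure hρ g MeasurableSet.univ, univ_inter]

theorem restrict_ac_wMeasure (hρ : AEMeasurable ρ (volume.restrict (oI D)))
    (hpos : ∀ᵐ x ∂(volume.restrict (oI D)), 0 < ρ x) :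
    volume.restrict (oI D) ≪ wMeasure ρ D :=
  withDensity_absolutelyContinuous' hρ.ennreal_ofReal
    (hpos.mono fun x hx => by simpa using hx)

theorem wMeasure_ne_zero (hρ : AEMeasurable ρ (volume.restrict (oI D)))
    (hpos : ∀ᵐ x ∂(volume.restrict (oI D)), 0 < ρ x) {U : Set ℝ} (hU : IsOpen U)
    (hne : (U ∩ oI D).Nonempty) : wMeasure ρ D U ≠ 0 := by
  intro h
  have h1 := restrict_ac_wMeasure hρ hpos h
  rw [Measure.restrict_apply hU.measurableSet] at h1
  exact ((hU.inter (isOpen_oI D)).measure_pos volume hne).ne' h1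

end wMeasure

/-! ### Quasi-derivatives as densities with respect to v̂ dx. -/

namespace Weights

variable {p : ℝ} {D : EReal} {u v : ℝ → ℝ}

theorem aemeasurable_u (H : Weights p D u v) : AEMeasurable u (volume.restrict (oI D)) :=
  (H.u_loc.aestronglyMeasurable.mono_measure
    (Measure.restrict_mono (oI_subset_cI D) le_rfl)).aemeasurable

theorem aemeasurable_vhat (H : Weights p D u v) :
    AEMeasurable (vhat p v) (volume.restrict (oI D)) :=
  (H.v_loc.aestronglyMeasurable.mono_measure
    (Measure.restrict_mono (oI_subset_cI D) le_rfl)).aemeasurable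

theorem vhat_rpow (hp : 1 < p) {x : ℝ} (hx : 0 < v x) : vhat p v x ^ (1 - p) = v x := by
  rw [vhat, ← Real.rpow_mul hx.le,
    show (1 - Real.conjExponent p) * (1 - p) = (Real.conjExponent p - 1) * (p - 1) by ring,
    conj_sub_one_mul hp, Real.rpow_one]

theorem vhat_pos {x : ℝ} (hx : 0 < v x) : 0 < vhat p v x := Real.rpow_pos_of_pos hx _

theorem vhat_mul_rpow {x : ℝ} (hx : 0 < v x) :
    v x ^ (Real.conjExponent p - 1) * vhat p v x = 1 := by
  rw [vhat, ← Real.rpow_add hx]; simp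

theorem ae_vhat_pos (H : Weights p D u v) : ∀ᵐ x ∂(volume.restrict (oI D)), 0 < vhat p v x :=
  H.v_pos.mono fun _ hx => vhat_pos hx

/-- The hypotheses give measurability of v̂; v is recovered almost everywhere as v̂^(1-p). -/
theorem aemeasurable_v (H : Weights p D u v) : AEMeasurable v (volume.restrict (oI D)) :=
  (H.aemeasurable_vhat.pow_const (1 - p)).congr
    (H.v_pos.mono fun _ hx => vhat_rpow H.one_lt hx)

theorem isFiniteMeasure (H : Weights p D u v) : IsFiniteMeasure (wMeasure u D) := by
  refine ⟨lt_of_le_of_lt (le_of_eq ?_) H.finite⟩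
  exact measure_congr ((eventuallyEq_univ.2 ae_mem_oI).symm)

/-- Local integrability on the closed interval includes the end D when D is finite, so (0, x) ∩ (0,
D) always lies in a compact subset of [0, D]. -/
theorem V_lt_top (H : Weights p D u v) (x : ℝ) : wMeasure (vhat p v) D (Iio x) < ⊤ := by
  obtain ⟨K, hK, hKc, hKx⟩ : ∃ K, IsCompact K ∧ K ⊆ cI D ∧ Iio x ∩ oI D ⊆ K := by
    rcases le_or_gt (x : EReal) D with h | h
    · refine ⟨Icc 0 x, isCompact_Icc, fun y hy => ⟨hy.1, le_trans (by exact_mod_cast hy.2) h⟩,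
        fun y hy => ⟨hy.2.1.le, le_of_lt hy.1⟩⟩
    · have hD := H.pos
      have hDt : D ≠ ⊤ := ne_top_of_lt h
      have hDb : D ≠ ⊥ := ne_bot_of_gt H.pos
      have hcoe := EReal.coe_toReal hDt hDb
      refine ⟨Icc 0 D.toReal, isCompact_Icc, fun y hy => ⟨hy.1, ?_⟩,
        fun y hy => ⟨hy.2.1.le, ?_⟩⟩
      · rw [← hcoe]; exact_mod_cast hy.2
      · have := hy.2.2
        rw [← hcoe] at this
        exact le_of_lt (by exact_mod_cast this)
  have h1 := (H.v_loc.integrableOn_compact_subset hKc hK).mono_set hKx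
  rw [← setLIntegral_one, setLIntegral_wMeasure H.aemeasurable_vhat _ measurableSet_Iio]
  simp only [mul_one]
  refine lt_of_le_of_lt (lintegral_mono fun y => ?_) h1.2
  rw [← ofReal_norm]
  exact ENNReal.ofReal_le_ofReal (le_abs_self _)

theorem V_ne_zero (H : Weights p D u v) {x : ℝ} (hx : 0 < x) :
    wMeasure (vhat p v) D (Iio x) ≠ 0 := by
  refine wMeasure_ne_zero H.aemeasurable_vhat H.ae_vhat_pos isOpen_Iio ?_
  obtain ⟨y, hy⟩ := oI_nonempty H.pos
  exact ⟨min (x / 2) y, lt_of_le_of_lt (min_le_left _ _) (half_lt_self hx),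
    mem_oI_of_le hy (lt_min (half_pos hx) hy.1) (min_le_right _ _)⟩

/-- The exponents match because v̂ v^((p*-1)p) = v. No derivative enters: the C¹ approximation
applies this to a difference of densities. -/
theorem lintegral_rpow_eq (H : Weights p D u v) {z w : ℝ → ℝ}
    (h : ∀ᵐ x ∂(volume.restrict (oI D)), v x ^ (Real.conjExponent p - 1) * z x = w x) :
    ∫⁻ x, ENNReal.ofReal |z x| ^ p ∂(wMeasure v D)
      = ∫⁻ x, ENNReal.ofReal |w x| ^ p ∂(wMeasure (vhat p v) D) := by
  have hp0 : 0 < p := by linarith [H.one_lt]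
  rw [lintegral_wMeasure H.aemeasurable_v, lintegral_wMeasure H.aemeasurable_vhat]
  refine lintegral_congr_ae ?_
  filter_upwards [h, H.v_pos] with x hx hvx
  have hpow : 0 ≤ v x ^ (Real.conjExponent p - 1) := Real.rpow_nonneg hvx.le _
  rw [ENNReal.ofReal_rpow_of_nonneg (abs_nonneg _) hp0.le,
    ENNReal.ofReal_rpow_of_nonneg (abs_nonneg _) hp0.le, ← ENNReal.ofReal_mul hvx.le,
    ← ENNReal.ofReal_mul (vhat_pos hvx).le, ← hx, abs_mul, abs_of_nonneg hpow,
    Real.mul_rpow hpow (abs_nonneg _), ← mul_assoc]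
  congr 2
  rw [vhat, ← Real.rpow_mul hvx.le, ← Real.rpow_add hvx, conj_sub_one_mul_self H.one_lt]
  simp

theorem energy_eq' (hp : 1 < p) (f : ℝ → ℝ) :
    energy p v D f = ∫⁻ x, ENNReal.ofReal |deriv f x| ^ p ∂(wMeasure v D) :=
  lintegral_congr fun x => by
    rw [ENNReal.ofReal_rpow_of_nonneg (abs_nonneg _) (by linarith)]

theorem energy_eq (H : Weights p D u v) {f w : ℝ → ℝ}
    (h : ∀ᵐ x ∂(volume.restrict (oI D)), v x ^ (Real.conjExponent p - 1) * deriv f x = w x) :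
    energy p v D f = ∫⁻ x, ENNReal.ofReal |w x| ^ p ∂(wMeasure (vhat p v) D) := by
  rw [energy_eq' H.one_lt, H.lintegral_rpow_eq h]

theorem mass_eq (hp : 1 < p) (f : ℝ → ℝ) :
    mass p u D f = ∫⁻ x, ENNReal.ofReal |f x| ^ p ∂(wMeasure u D) :=
  lintegral_congr fun x => by
    rw [ENNReal.ofReal_rpow_of_nonneg (abs_nonneg _) (by linarith)]

theorem setLIntegral_deriv_eq (H : Weights p D u v) {J : Set ℝ} (hJ : J ⊆ oI D) {f w : ℝ → ℝ}
    (h : ∀ᵐ x ∂(volume.restrict J), v x ^ (Real.conjExponent p - 1) * deriv f x = w x)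
    {s : Set ℝ} (hs : MeasurableSet s) (hsJ : s ⊆ J) :
    (∀ᵐ x ∂(volume.restrict s), deriv f x = w x * vhat p v x ∧ 0 < vhat p v x) ∧
    ∫⁻ x in s, ENNReal.ofReal |deriv f x|
      = ∫⁻ x in s, ENNReal.ofReal |w x| ∂(wMeasure (vhat p v) D) := by
  have h1 : ∀ᵐ x ∂(volume.restrict s), deriv f x = w x * vhat p v x ∧ 0 < vhat p v x := by
    filter_upwards [ae_restrict_of_ae_restrict_of_subset hsJ h,
      ae_restrict_of_ae_restrict_of_subset (hsJ.trans hJ) H.v_pos] with x hx hvx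
    refine ⟨?_, vhat_pos hvx⟩
    rw [← hx, mul_right_comm, vhat_mul_rpow hvx, one_mul]
  refine ⟨h1, ?_⟩
  rw [setLIntegral_wMeasure H.aemeasurable_vhat _ hs, inter_eq_left.2 (hsJ.trans hJ)]
  refine lintegral_congr_ae ?_
  filter_upwards [h1] with x hx
  rw [hx.1, abs_mul, abs_of_pos hx.2, ENNReal.ofReal_mul (abs_nonneg _), mul_comm]

/-- A function vanishing at `0` is dominated by the primitive of its quasi-derivative. -/
theorem abs_le_prim (H : Weights p D u v) {J : Set ℝ} (hJ : J ⊆ oI D)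
    (hJ' : ∀ x ∈ J, Ioc 0 x ⊆ J) {f w : ℝ → ℝ} (h0 : Tendsto f (𝓝[>] 0) (𝓝 0))
    (hac : ∀ a ∈ J, ∀ b ∈ J, AbsolutelyContinuousOnInterval f a b)
    (h : ∀ᵐ x ∂(volume.restrict J), v x ^ (Real.conjExponent p - 1) * deriv f x = w x)
    {x : ℝ} (hx : x ∈ J) :
    ENNReal.ofReal |f x| ≤ prim (wMeasure (vhat p v) D) (fun s => ENNReal.ofReal |w s|) x := by
  have hx0 : 0 < x := (hJ hx).1
  -- Absolute continuity is available only on compact intervals inside J, so integrate from a > 0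
  -- and let a tend to 0.
  have hlim : Tendsto (fun a => ENNReal.ofReal |f x - f a|) (𝓝[>] 0)
      (𝓝 (ENNReal.ofReal |f x|)) := by
    have := (ENNReal.continuous_ofReal.comp continuous_abs).continuousAt.tendsto.comp
      (h0.const_sub (f x))
    simpa [Function.comp_def] using this
  refine le_of_tendsto hlim ?_
  filter_upwards [Ioo_mem_nhdsGT hx0] with a ha
  have haJ : a ∈ J := hJ' x hx ⟨ha.1, ha.2.le⟩
  rw [← (hac a haJ x hx).integral_deriv_eq_sub, intervalIntegral.integral_of_le ha.2.le,
    integral_Ioc_eq_integral_Ioo, ← Real.norm_eq_abs, ofReal_norm]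
  refine (enorm_integral_le_lintegral_enorm _).trans ?_
  have hsub : Ioo a x ⊆ J := fun y hy => hJ' x hx ⟨ha.1.trans hy.1, hy.2.le⟩
  have h2 := (H.setLIntegral_deriv_eq hJ h measurableSet_Ioo hsub).2
  simp_rw [← Real.norm_eq_abs, ofReal_norm] at h2 ⊢
  rw [h2]
  exact lintegral_mono_set fun y hy => hy.2

/-- An increasing function vanishing at `0` is the primitive of its quasi-derivative. -/
theorem ofReal_eq_prim (H : Weights p D u v) {J : Set ℝ} (hJ : J ⊆ oI D)
    (hJ' : ∀ x ∈ J, Ioc 0 x ⊆ J) {f w : ℝ → ℝ} (h0 : Tendsto f (𝓝[>] 0) (𝓝 0))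
    (hac : ∀ a ∈ J, ∀ b ∈ J, AbsolutelyContinuousOnInterval f a b)
    (h : ∀ᵐ x ∂(volume.restrict J), v x ^ (Real.conjExponent p - 1) * deriv f x = w x)
    (hw : ∀ x ∈ J, 0 ≤ w x) {x : ℝ} (hx : x ∈ J) :
    0 ≤ f x ∧
    ENNReal.ofReal (f x) = prim (wMeasure (vhat p v) D) (fun s => ENNReal.ofReal (w s)) x := by
  have hsub : ∀ {a x}, x ∈ J → a ∈ Ioo 0 x → a ∈ J ∧ Ioo a x ⊆ J := fun hx ha =>
    ⟨hJ' _ hx ⟨ha.1, ha.2.le⟩, fun y hy => hJ' _ hx ⟨ha.1.trans hy.1, hy.2.le⟩⟩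
  have hdiff : ∀ {a x}, x ∈ J → a ∈ Ioo 0 x → 0 ≤ f x - f a ∧ ENNReal.ofReal (f x - f a)
      = ∫⁻ s in Ioo a x, ENNReal.ofReal (w s) ∂(wMeasure (vhat p v) D) := by
    intro a x hx ha
    obtain ⟨h1, h2⟩ := H.setLIntegral_deriv_eq hJ h measurableSet_Ioo (hsub hx ha).2
    have hac' := hac a (hsub hx ha).1 x hx
    have hint : IntegrableOn (deriv f) (Ioo a x) :=
      (intervalIntegrable_iff_integrableOn_Ioo_of_le ha.2.le).1 hac'.intervalIntegrable_deriv
    have hnn : ∀ᵐ y ∂(volume.restrict (Ioo a x)), 0 ≤ deriv f y := by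
      filter_upwards [h1, ae_restrict_mem measurableSet_Ioo] with y hy hyI
      rw [hy.1]
      exact mul_nonneg (hw y ((hsub hx ha).2 hyI)) hy.2.le
    rw [← hac'.integral_deriv_eq_sub, intervalIntegral.integral_of_le ha.2.le,
      integral_Ioc_eq_integral_Ioo]
    refine ⟨integral_nonneg_of_ae hnn, ?_⟩
    rw [ofReal_integral_eq_lintegral_ofReal hint hnn]
    calc _ = ∫⁻ x in Ioo a x, ENNReal.ofReal |deriv f x| :=
          lintegral_congr_ae (hnn.mono fun y hy => by simp only; rw [abs_of_nonneg hy])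
      _ = _ := h2
      _ = _ := setLIntegral_congr_fun measurableSet_Ioo fun y hy => by
          rw [abs_of_nonneg (hw y ((hsub hx ha).2 hy))]
  have hnonneg : ∀ {x}, x ∈ J → 0 ≤ f x := by
    intro x hx
    refine le_of_tendsto h0 ?_
    filter_upwards [Ioo_mem_nhdsGT (hJ hx).1] with a ha
    linarith [(hdiff hx ha).1]
  refine ⟨hnonneg hx, le_antisymm ?_ ?_⟩
  · have h1 := H.abs_le_prim hJ hJ' h0 hac h hx
    rw [abs_of_nonneg (hnonneg hx)] at h1
    refine h1.trans (le_of_eq ?_)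
    refine lintegral_congr_ae ?_
    filter_upwards [ae_restrict_of_ae ae_mem_oI, ae_restrict_mem measurableSet_Iio] with y hy hyx
    rw [abs_of_nonneg (hw y (hJ' x hx ⟨hy.1, le_of_lt hyx⟩))]
  · have hx0 := (hJ hx).1
    have h1 : prim (wMeasure (vhat p v) D) (fun s => ENNReal.ofReal (w s)) x
        = ⨆ n : ℕ, ∫⁻ s in Ioo (x / (n + 2)) x, ENNReal.ofReal (w s) ∂(wMeasure (vhat p v) D) := by
      rw [← setLIntegral_iUnion_of_directed]
      · refine setLIntegral_congr ?_
        filter_upwards [ae_mem_oI (ρ := vhat p v) (D := D)] with y hy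
        refine propext ⟨fun (hyx : y < x) => mem_iUnion.2 ?_, fun h => ?_⟩
        · obtain ⟨n, hn⟩ := exists_nat_gt (x / y)
          refine ⟨n, ?_, hyx⟩
          rw [div_lt_iff₀ hy.1] at hn
          rw [div_lt_iff₀ (by positivity)]
          nlinarith [hy.1]
        · obtain ⟨n, hn⟩ := mem_iUnion.1 h
          exact hn.2
      · refine Monotone.directed_le fun m n hmn => Ioo_subset_Ioo_left ?_
        have : (m : ℝ) ≤ n := by exact_mod_cast hmn
        gcongr
    rw [h1]
    refine iSup_le fun n => ?_
    have ha : x / ((n : ℝ) + 2) ∈ Ioo 0 x := by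
      refine ⟨by positivity, ?_⟩
      rw [div_lt_iff₀ (by positivity)]
      nlinarith [(Nat.cast_nonneg n : (0 : ℝ) ≤ n)]
    rw [← (hdiff hx ha).2]
    exact ENNReal.ofReal_le_ofReal (by linarith [hnonneg (hsub hx ha).1])

/-- Primitives are locally absolutely continuous, with the expected derivative. -/
theorem prim_toReal (H : Weights p D u v) {W : ℝ → ℝ≥0∞} (hW : Measurable W)
    (hfin : ∀ x, prim (wMeasure (vhat p v) D) W x ≠ ⊤) :
    (∀ a b, AbsolutelyContinuousOnInterval
      (fun x => (prim (wMeasure (vhat p v) D) W x).toReal) a b) ∧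
    ∀ᵐ x ∂(volume.restrict (oI D)),
      deriv (fun x => (prim (wMeasure (vhat p v) D) W x).toReal) x = (W x).toReal * vhat p v x := by
  set V := wMeasure (vhat p v) D with hV
  set g : ℝ → ℝ := (oI D).indicator fun t => (W t).toReal * vhat p v t with hg
  -- Finite primitives force W to be finite almost everywhere, so its real values determine the
  -- primitive and Lebesgue differentiation applies.
  have hWtop : ∀ᵐ x ∂(volume.restrict (oI D)), W x ≠ ⊤ := by
    refine (restrict_ac_wMeasure H.aemeasurable_vhat H.ae_vhat_pos).ae_le ?_
    have h1 : ∀ n : ℕ, ∀ᵐ x ∂V, x ∈ Iio (n : ℝ) → W x ≠ ⊤ := fun n => by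
      rw [← ae_restrict_iff' measurableSet_Iio]
      exact (ae_lt_top hW (hfin n)).mono fun x hx => hx.ne
    filter_upwards [ae_all_iff.2 h1] with x hx using
      (exists_nat_gt x).elim fun n hn => hx n hn
  have hgm : AEStronglyMeasurable g :=
    ((aemeasurable_indicator_iff (measurableSet_oI D)).2
      (hW.ennreal_toReal.aemeasurable.mul H.aemeasurable_vhat)).aestronglyMeasurable
  have hgnn : ∀ᵐ x, 0 ≤ g x := by
    have := (ae_restrict_iff' (measurableSet_oI D)).1 H.ae_vhat_pos
    filter_upwards [this] with x hx
    by_cases h : x ∈ oI D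
    · simp only [hg, indicator_of_mem h]
      exact mul_nonneg ENNReal.toReal_nonneg (hx h).le
    · simp [hg, h]
  have hlint : ∀ x, ∫⁻ t in Iic x, ENNReal.ofReal (g t) = prim V W x := by
    intro x
    rw [prim, hV, setLIntegral_wMeasure H.aemeasurable_vhat _ measurableSet_Iio,
      inter_comm, ← Measure.restrict_restrict (measurableSet_oI D),
      Measure.restrict_congr_set Iio_ae_eq_Iic, ← lintegral_indicator (measurableSet_oI D)]
    refine lintegral_congr_ae (ae_restrict_of_ae ?_)
    filter_upwards [(ae_restrict_iff' (measurableSet_oI D)).1 hWtop] with t ht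
    by_cases h : t ∈ oI D
    · simp only [hg, indicator_of_mem h]
      rw [ENNReal.ofReal_mul ENNReal.toReal_nonneg, ENNReal.ofReal_toReal (ht h), mul_comm]
    · simp [hg, h]
  have hint : ∀ x, IntegrableOn g (Iic x) := fun x =>
    ⟨hgm.restrict, by
      rw [hasFiniteIntegral_iff_ofReal (ae_restrict_of_ae hgnn), hlint]
      exact (hfin x).lt_top⟩
  have hf : ∀ x, (prim V W x).toReal = ∫ t in Iic x, g t := fun x => by
    rw [integral_eq_lintegral_of_nonneg_ae (ae_restrict_of_ae hgnn) hgm.restrict, hlint]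
  have hf' : ∀ a, (fun x => (prim V W x).toReal)
      = fun x => (prim V W a).toReal + ∫ t in a..x, g t := fun a => by
    funext x
    rw [hf, hf, ← intervalIntegral.integral_Iic_sub_Iic (hint a) (hint x)]
    ring
  have hloc : LocallyIntegrable g := fun x =>
    ⟨Iic (x + 1), Iic_mem_nhds (by linarith), hint _⟩
  refine ⟨fun a b => ?_, ?_⟩
  · rw [hf' a]
    have h1 : IntervalIntegrable g volume a b :=
      intervalIntegrable_iff.2 ((hint (max a b)).mono_set fun y hy => hy.2)
    have h2 := h1.absolutelyContinuousOnInterval_intervalIntegral (c := a) (by simp)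
    have h3 : AbsolutelyContinuousOnInterval (fun _ : ℝ => (prim V W a).toReal) a b :=
      ContDiffOn.absolutelyContinuousOnInterval contDiffOn_const
    exact h3.add h2
  · rw [hf' 0]
    filter_upwards [ae_restrict_of_ae (LocallyIntegrable.ae_hasDerivAt_integral hloc),
      ae_restrict_mem (measurableSet_oI D)] with x hx hxo
    rw [((hx 0).const_add _).deriv, hg, indicator_of_mem hxo]

theorem isQuasiDeriv_prim (H : Weights p D u v) {W : ℝ → ℝ≥0∞} (hW : Measurable W)
    (hfin : ∀ x, prim (wMeasure (vhat p v) D) W x ≠ ⊤) {J : Set ℝ} (hJ : J ⊆ oI D)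
    {w : ℝ → ℝ} (hw : ContinuousOn w J) (hJm : MeasurableSet J)
    (hwW : ∀ x ∈ J, w x = (W x).toReal) :
    IsQuasiDeriv p v J (fun x => (prim (wMeasure (vhat p v) D) W x).toReal) w where
  cont := hw
  ac := fun a _ b _ => (H.prim_toReal hW hfin).1 a b
  deriv_eq := by
    filter_upwards [ae_restrict_of_ae_restrict_of_subset hJ (H.prim_toReal hW hfin).2,
      ae_restrict_of_ae_restrict_of_subset hJ H.v_pos, ae_restrict_mem hJm] with x hx hvx hxJ
    rw [hx, hwW x hxJ, mul_left_comm, vhat_mul_rpow hvx, mul_one]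

end Weights

/-! ### Approximation by continuous compactly supported functions. -/

theorem abs_sub_rpow_le {p a b : ℝ} (hp : 0 ≤ p) (ha : 0 ≤ a) (hb : 0 ≤ b) :
    ENNReal.ofReal |a - b| ^ p ≤ ENNReal.ofReal a ^ p + ENNReal.ofReal b ^ p := by
  rcases le_total a b with h | h
  · refine le_trans (ENNReal.rpow_le_rpow (ENNReal.ofReal_le_ofReal ?_) hp) le_add_self
    rw [abs_of_nonpos (by linarith)]; linarith
  · refine le_trans (ENNReal.rpow_le_rpow (ENNReal.ofReal_le_ofReal ?_) hp) le_self_add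
    rw [abs_of_nonneg (by linarith)]; linarith

theorem exists_exhaustion_Icc {D : EReal} (hD : 0 < D) :
    ∃ a b : ℕ → ℝ, Antitone a ∧ Monotone b ∧ (∀ n, 0 < a n ∧ a n < b n ∧ b n ∈ oI D) ∧
      ∀ x ∈ oI D, ∃ n, x ∈ Ioo (a n) (b n) := by
  obtain ⟨b, hb, hbo, hbx⟩ := exists_exhaustion hD
  refine ⟨fun n => b 0 / (n + 2), b, fun m n h => ?_, hb, fun n => ⟨?_, ?_, hbo n⟩, fun x hx => ?_⟩
  · have h1 : (m : ℝ) ≤ n := by exact_mod_cast h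
    have h2 := (hbo 0).1
    simp only
    gcongr
  · have := (hbo 0).1
    positivity
  · have h0 := (hbo 0).1
    refine lt_of_lt_of_le ?_ (hb (Nat.zero_le n))
    rw [div_lt_iff₀ (by positivity)]
    nlinarith [(Nat.cast_nonneg n : (0 : ℝ) ≤ n)]
  · obtain ⟨n, hn⟩ := hbx x hx
    obtain ⟨m, hm⟩ := exists_nat_gt (b 0 / x)
    have h0 := (hbo 0).1
    rw [div_lt_iff₀ hx.1] at hm
    refine ⟨max n m, ?_, hn.trans_le (hb (le_max_left _ _))⟩
    rw [div_lt_iff₀ (by positivity)]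
    have : (m : ℝ) ≤ max n m := by exact_mod_cast le_max_right _ _
    push_cast at this ⊢
    nlinarith [hx.1]

/-- Nonnegative continuous functions with compact support in `(0, D)` are dense in the nonnegative
functions of `L^p`. -/
theorem exists_continuous_approx {ρ : ℝ → ℝ} {D : EReal} (hD : 0 < D)
    (hρ : LocallyIntegrableOn ρ (oI D)) {p : ℝ} (hp : 1 < p) {g : ℝ → ℝ}
    (hg : AEMeasurable g (wMeasure ρ D)) (hg0 : ∀ x, 0 ≤ g x)
    (hgp : ∫⁻ x, ENNReal.ofReal (g x) ^ p ∂(wMeasure ρ D) ≠ ⊤) {ε : ℝ≥0∞} (hε : ε ≠ 0) :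
    ∃ φ : ℝ → ℝ, Continuous φ ∧ (∀ x, 0 ≤ φ x) ∧
      (∃ a b, 0 < a ∧ a < b ∧ b ∈ oI D ∧ ∀ x ∉ Ioo a b, φ x = 0) ∧
      ∫⁻ x, ENNReal.ofReal |φ x - g x| ^ p ∂(wMeasure ρ D) ≤ ε := by
  have hp0 : 0 < p := by linarith
  set m := wMeasure ρ D with hm
  obtain ⟨a, b, ha, hb, hab, hcov⟩ := exists_exhaustion_Icc hD
  have hρm : AEMeasurable ρ (volume.restrict (oI D)) := hρ.aestronglyMeasurable.aemeasurable
  -- the part of `g` near the endpoints is small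
  obtain ⟨n, hn⟩ : ∃ n, ∫⁻ x in (Icc (a n) (b n))ᶜ, ENNReal.ofReal (g x) ^ p ∂m ≤ ε / 2 := by
    have hfin : IsFiniteMeasure (m.withDensity fun x => ENNReal.ofReal (g x) ^ p) :=
      ⟨by rw [withDensity_apply _ MeasurableSet.univ, Measure.restrict_univ]; exact hgp.lt_top⟩
    have h1 := tendsto_measure_iInter_atTop (s := fun n => (Icc (a n) (b n))ᶜ)
      (μ := m.withDensity fun x => ENNReal.ofReal (g x) ^ p)
      (fun n => measurableSet_Icc.compl.nullMeasurableSet)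
      (fun i j h => compl_subset_compl.2 (Icc_subset_Icc (ha h) (hb h)))
      ⟨0, measure_ne_top _ _⟩
    have h2 : m.withDensity (fun x => ENNReal.ofReal (g x) ^ p) (⋂ n, (Icc (a n) (b n))ᶜ) = 0 := by
      refine withDensity_absolutelyContinuous _ _ ?_
      refine measure_mono_null (t := (oI D)ᶜ) (fun x hx hxo => ?_) (mem_ae_iff.1 ae_mem_oI)
      obtain ⟨n, hn⟩ := hcov x hxo
      exact mem_iInter.1 hx n (Ioo_subset_Icc_self hn)
    rw [h2] at h1
    obtain ⟨n, hn⟩ := (h1.eventually_lt_const (ENNReal.half_pos hε)).exists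
    refine ⟨n, ?_⟩
    rw [Function.comp_apply, withDensity_apply _ measurableSet_Icc.compl] at hn
    exact hn.le
  obtain ⟨b', hb'o, hb'⟩ := exists_gt_mem_oI (hab n).2.2
  have ha0 := (hab n).1
  set S := Icc (a n) (b n) with hS
  set S' := Icc (a n / 2) b' with hS'
  have hSo : S' ⊆ oI D := fun x hx => mem_oI_of_le hb'o (lt_of_lt_of_le (half_pos ha0) hx.1) hx.2
  have hfin : IsFiniteMeasure (m.restrict S') := by
    refine ⟨?_⟩
    rw [Measure.restrict_apply_univ, ← setLIntegral_one, hm,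
      setLIntegral_wMeasure hρm _ measurableSet_Icc, inter_eq_left.2 hSo]
    simp only [mul_one]
    refine lt_of_le_of_lt (lintegral_mono fun y => ?_)
      (hρ.integrableOn_compact_subset hSo isCompact_Icc).2
    rw [← ofReal_norm]
    exact ENNReal.ofReal_le_ofReal (le_abs_self _)
  have hpe : ENNReal.ofReal p ≠ ⊤ := ENNReal.ofReal_ne_top
  have hp0e : ENNReal.ofReal p ≠ 0 := by simpa using hp0
  have hpr : (ENNReal.ofReal p).toReal = p := ENNReal.toReal_ofReal hp0.le
  have hmem : MemLp (S.indicator g) (ENNReal.ofReal p) (m.restrict S') := by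
    refine ⟨(hg.restrict.indicator measurableSet_Icc).aestronglyMeasurable, ?_⟩
    rw [eLpNorm_lt_top_iff_lintegral_rpow_enorm_lt_top hp0e hpe, hpr]
    refine lt_of_le_of_lt ?_ hgp.lt_top
    refine (setLIntegral_le_lintegral _ _).trans (lintegral_mono fun x => ?_)
    refine ENNReal.rpow_le_rpow ?_ hp0.le
    by_cases hx : x ∈ S
    · rw [indicator_of_mem hx, ← ofReal_norm, Real.norm_of_nonneg (hg0 x)]
    · simp [indicator_of_notMem hx]
  have hε2 : (ε / 2) ^ (1 / p) ≠ 0 := by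
    simp only [ne_eq, ENNReal.rpow_eq_zero_iff, not_or, not_and]
    refine ⟨fun h => absurd h (ENNReal.half_pos hε).ne', fun h => ?_⟩
    exact not_lt.2 (by positivity)
  obtain ⟨ψ, -, hψ, hψc, -⟩ := hmem.exists_hasCompactSupport_eLpNorm_sub_le hpe hε2
  have hψ' : ∫⁻ x in S', ENNReal.ofReal |S.indicator g x - ψ x| ^ p ∂m ≤ ε / 2 := by
    rw [eLpNorm_eq_lintegral_rpow_enorm_toReal hp0e hpe, hpr] at hψ
    have := (ENNReal.rpow_le_rpow_iff (by positivity)).1 hψ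
    refine le_trans (le_of_eq (lintegral_congr fun x => ?_)) this
    rw [← Real.norm_eq_abs, ofReal_norm]; rfl
  have hdisj : Disjoint (Ioo (a n / 2) b')ᶜ S := by
    refine disjoint_left.2 fun x hx hxS => hx ⟨?_, hxS.2.trans_lt hb'⟩
    exact lt_of_lt_of_le (half_lt_self ha0) hxS.1
  obtain ⟨χ, hχ0, hχ1, hχ⟩ := exists_continuous_zero_one_of_isClosed
    (isOpen_Ioo.isClosed_compl) isClosed_Icc hdisj
  -- The positive part brings ψ no further from g because g ≥ 0. The cutoff is 1 on S; off S the
  -- error is bounded by ψ, which approximates 0 there, and by the small remaining part of g.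
  refine ⟨fun x => χ x * max (ψ x) 0, χ.continuous.mul (hψc.max continuous_const),
    fun x => mul_nonneg (hχ x).1 (le_max_right _ _),
    ⟨a n / 2, b', half_pos ha0, by linarith [half_lt_self ha0, (hab n).2.1], hb'o, fun x hx => ?_⟩, ?_⟩
  · have : χ x = 0 := hχ0 hx
    simp [this]
  have hpt : ∀ x, ENNReal.ofReal |χ x * max (ψ x) 0 - g x| ^ p
      ≤ S'.indicator (fun x => ENNReal.ofReal |S.indicator g x - ψ x| ^ p) x
        + Sᶜ.indicator (fun x => ENNReal.ofReal (g x) ^ p) x := by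
    intro x
    have hχx := hχ x
    by_cases hxS : x ∈ S
    · have hxS' : x ∈ S' := ⟨by linarith [hxS.1, half_lt_self ha0], by linarith [hxS.2]⟩
      have h1 : χ x = 1 := hχ1 hxS
      rw [indicator_of_mem hxS', indicator_of_mem hxS, h1, one_mul]
      refine le_trans (ENNReal.rpow_le_rpow (ENNReal.ofReal_le_ofReal ?_) hp0.le) le_self_add
      have := hg0 x
      rcases le_total (ψ x) 0 with h | h
      · rw [max_eq_right h, abs_of_nonpos (by linarith), abs_of_nonneg (by linarith)]
        linarith
      · rw [max_eq_left h, abs_sub_comm]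
    · have h3 : Sᶜ.indicator (fun x => ENNReal.ofReal (g x) ^ p) x = ENNReal.ofReal (g x) ^ p :=
        indicator_of_mem (s := Sᶜ) hxS _
      rw [h3]
      refine (abs_sub_rpow_le hp0.le (mul_nonneg hχx.1 (le_max_right _ _)) (hg0 x)).trans ?_
      refine add_le_add ?_ le_rfl
      by_cases hxS' : x ∈ S'
      · rw [indicator_of_mem hxS', indicator_of_notMem hxS, zero_sub, abs_neg]
        refine ENNReal.rpow_le_rpow (ENNReal.ofReal_le_ofReal ?_) hp0.le
        calc χ x * max (ψ x) 0 ≤ 1 * max (ψ x) 0 :=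
              mul_le_mul_of_nonneg_right hχx.2 (le_max_right _ _)
          _ ≤ |ψ x| := by rw [one_mul]; exact max_le (le_abs_self _) (abs_nonneg _)
      · have : χ x = 0 := hχ0 fun h => hxS' (Ioo_subset_Icc_self h)
        simp [this, hp0]
  have hm1 : AEMeasurable (fun x => S'.indicator
      (fun x => ENNReal.ofReal |S.indicator g x - ψ x| ^ p) x) m := by
    refine AEMeasurable.indicator ?_ measurableSet_Icc
    have := (hg.indicator (s := S) measurableSet_Icc).sub hψc.measurable.aemeasurable
    exact (this.abs.ennreal_ofReal).pow_const _
  calc _ ≤ ∫⁻ x, (S'.indicator (fun x => ENNReal.ofReal |S.indicator g x - ψ x| ^ p) x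
        + Sᶜ.indicator (fun x => ENNReal.ofReal (g x) ^ p) x) ∂m := lintegral_mono hpt
    _ = ∫⁻ x in S', ENNReal.ofReal |S.indicator g x - ψ x| ^ p ∂m
        + ∫⁻ x in Sᶜ, ENNReal.ofReal (g x) ^ p ∂m := by
        rw [lintegral_add_left' hm1, lintegral_indicator measurableSet_Icc,
          lintegral_indicator measurableSet_Icc.compl]
    _ ≤ ε / 2 + ε / 2 := add_le_add hψ' hn
    _ = ε := ENNReal.add_halves ε

/-! ### The eigenvalue as the best Hardy constant. -/

namespace Weights

variable {p : ℝ} {D : EReal} {u v : ℝ → ℝ}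

theorem vhat_locallyIntegrableOn (H : Weights p D u v) : LocallyIntegrableOn (vhat p v) (oI D) :=
  H.v_loc.mono_set (oI_subset_cI D)

theorem exists_ne_zero_oI {f : ℝ → ℝ} (hf : ContinuousOn f (cI D)) (h0 : f 0 = 0)
    (hne : ∃ x ∈ cI D, f x ≠ 0) : ∃ x ∈ oI D, f x ≠ 0 := by
  obtain ⟨x, hx, hfx⟩ := hne
  have hx0 : 0 < x := lt_of_le_of_ne hx.1 fun h => hfx (h ▸ h0)
  have h1 : ∀ᶠ y in 𝓝[cI D] x, f y ≠ 0 := (hf x hx).eventually_ne hfx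
  have h2 : ∀ᶠ y in 𝓝[<] x, f y ≠ 0 := by
    have h3 : Ioo 0 x ⊆ cI D := fun y hy => ⟨hy.1.le, le_trans (by exact_mod_cast hy.2.le) hx.2⟩
    rw [← nhdsWithin_Ioo_eq_nhdsLT hx0]
    exact nhdsWithin_mono x h3 h1
  obtain ⟨y, hy, hyx⟩ := (h2.and (Ioo_mem_nhdsLT hx0)).exists
  exact ⟨y, ⟨hyx.1, lt_of_lt_of_le (by exact_mod_cast hyx.2) hx.2⟩, hy⟩

theorem mass_ne_zero (H : Weights p D u v) {f : ℝ → ℝ} (hf : ContinuousOn f (cI D))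
    (hne : ∃ x ∈ oI D, f x ≠ 0) : mass p u D f ≠ 0 := by
  have hp0 : 0 < p := by linarith [H.one_lt]
  rw [mass_eq H.one_lt]
  intro h
  have hfo : ContinuousOn f (oI D) := hf.mono (oI_subset_cI D)
  have hm : AEMeasurable (fun x => ENNReal.ofReal |f x| ^ p) (wMeasure u D) :=
    (((hfo.aemeasurable (measurableSet_oI D)).abs.ennreal_ofReal).pow_const _).mono_ac wMeasure_ac
  rw [lintegral_eq_zero_iff' hm] at h
  have hU : IsOpen (oI D ∩ f ⁻¹' {0}ᶜ) :=
    hfo.isOpen_inter_preimage (isOpen_oI D) isOpen_compl_singleton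
  obtain ⟨x, hx, hfx⟩ := hne
  refine wMeasure_ne_zero H.aemeasurable_u H.u_pos hU ⟨x, ⟨hx, hfx⟩, hx⟩ ?_
  refine measure_mono_null (fun y hy => ?_) h
  intro hy0
  have hfy : f y ≠ 0 := hy.2
  have : ENNReal.ofReal |f y| ^ p = 0 := hy0
  simp [hp0, hp0.le, hfy, not_lt.2] at this

theorem aemeasurable_of_continuousOn {ρ : ℝ → ℝ} {f : ℝ → ℝ} (hf : ContinuousOn f (oI D)) :
    AEMeasurable f (wMeasure ρ D) :=
  (hf.aemeasurable (measurableSet_oI D)).mono_ac wMeasure_ac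

theorem tendsto_zero_of_continuousOn {f : ℝ → ℝ} {s : Set ℝ} (hf : ContinuousOn f s)
    (h0 : f 0 = 0) {x : ℝ} (hx : 0 < x) (hs : Icc 0 x ⊆ s) : Tendsto f (𝓝[>] 0) (𝓝 0) := by
  have := (hf 0 (hs ⟨le_rfl, hx.le⟩)).mono (Ioo_subset_Icc_self.trans hs)
  rw [ContinuousWithinAt, h0, nhdsWithin_Ioo_eq_nhdsGT hx] at this
  exact this

theorem Icc_subset_cI {x : ℝ} (hx : x ∈ oI D) : Icc 0 x ⊆ cI D :=
  fun _ hy => ⟨hy.1, le_trans (by exact_mod_cast hy.2) hx.2.le⟩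

theorem tendsto_zero (H : Weights p D u v) {f : ℝ → ℝ} (hf : ContinuousOn f (cI D))
    (h0 : f 0 = 0) : Tendsto f (𝓝[>] 0) (𝓝 0) := by
  obtain ⟨x, hx⟩ := oI_nonempty H.pos
  exact tendsto_zero_of_continuousOn hf h0 hx.1 (Icc_subset_cI hx)

theorem hardy_mul_mass_le (H : Weights p D u v) {c : ℝ≥0∞}
    (hc : Hardy p (wMeasure u D) (wMeasure (vhat p v) D) c) {f w : ℝ → ℝ}
    (h0 : Tendsto f (𝓝[>] 0) (𝓝 0))
    (hac : ∀ a ∈ oI D, ∀ b ∈ oI D, AbsolutelyContinuousOnInterval f a b)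
    (h : ∀ᵐ x ∂(volume.restrict (oI D)), v x ^ (Real.conjExponent p - 1) * deriv f x = w x)
    (hw : AEMeasurable w (wMeasure (vhat p v) D)) :
    c * mass p u D f ≤ energy p v D f := by
  rw [mass_eq H.one_lt, H.energy_eq h]
  refine le_trans ?_ (hc _ hw.abs.ennreal_ofReal)
  refine mul_le_mul_right (lintegral_mono_ae ?_) _
  filter_upwards [ae_mem_oI] with x hx
  exact ENNReal.rpow_le_rpow (H.abs_le_prim Subset.rfl (fun x hx => Ioc_subset_oI hx) h0 hac h hx)
    (by linarith [H.one_lt])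

theorem le_lam_of_hardy (H : Weights p D u v) {c : ℝ≥0∞}
    (hc : Hardy p (wMeasure u D) (wMeasure (vhat p v) D) c) : c ≤ lam p u v D := by
  refine le_iInf₂ fun f hf => ?_
  obtain ⟨w, hw⟩ := hf.quasi
  rw [ENNReal.le_div_iff_mul_le (Or.inl (H.mass_ne_zero hf.cont
    (exists_ne_zero_oI hf.cont hf.zero hf.ne_zero))) (Or.inr hf.finite.ne)]
  exact H.hardy_mul_mass_le hc (H.tendsto_zero hf.cont hf.zero) hw.ac hw.deriv_eq
    (aemeasurable_of_continuousOn hw.cont)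

/-- Approximate W in L^p(V) by a continuous φ ≥ 0. The V-primitive of φ has the continuous
quasi-derivative φ, hence is a test function unless it vanishes. -/
theorem hardy_lam (H : Weights p D u v) :
    Hardy p (wMeasure u D) (wMeasure (vhat p v) D) (lam p u v D) := by
  have hp0 : 0 < p := by linarith [H.one_lt]
  intro W hW
  by_cases hfin : ∫⁻ s, W s ^ p ∂(wMeasure (vhat p v) D) = ⊤
  · rw [hfin]; exact le_top
  have hWtop : ∀ᵐ s ∂(wMeasure (vhat p v) D), ENNReal.ofReal (W s).toReal = W s := by
    filter_upwards [ae_lt_top' (hW.pow_const p) hfin] with s hs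
    refine ENNReal.ofReal_toReal fun h => ?_
    simp [h, hp0] at hs
  refine hardy_of_approx H.one_lt H.V_lt_top hW fun ε hε => ?_
  obtain ⟨φ, hφc, hφ0, -, hφε⟩ := exists_continuous_approx H.pos H.vhat_locallyIntegrableOn H.one_lt
    (g := fun s => (W s).toReal) hW.ennreal_toReal (fun _ => ENNReal.toReal_nonneg)
    (by rwa [lintegral_congr_ae (hWtop.mono fun s hs => by rw [hs])]) hε
  refine ⟨fun s => ENNReal.ofReal (φ s), fun s => ENNReal.ofReal |φ s - (W s).toReal|,
    hφc.measurable.ennreal_ofReal.aemeasurable,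
    (hφc.measurable.aemeasurable.sub hW.ennreal_toReal).abs.ennreal_ofReal, ?_, ?_, hφε, ?_⟩
  · filter_upwards [hWtop] with s hs
    refine hs.symm.le.trans ?_
    rw [← ENNReal.ofReal_add (hφ0 s) (abs_nonneg _)]
    exact ENNReal.ofReal_le_ofReal (by linarith [neg_abs_le (φ s - (W s).toReal)])
  · filter_upwards [hWtop] with s hs
    refine (ENNReal.ofReal_le_ofReal (q := (W s).toReal + |φ s - (W s).toReal|)
      (by linarith [le_abs_self (φ s - (W s).toReal)])).trans_eq ?_
    rw [ENNReal.ofReal_add ENNReal.toReal_nonneg (abs_nonneg _), hs]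
  set V := wMeasure (vhat p v) D with hV
  set G : ℝ → ℝ≥0∞ := fun s => ENNReal.ofReal (φ s) with hG
  have hGm : Measurable G := hφc.measurable.ennreal_ofReal
  by_cases hGfin : ∫⁻ s, G s ^ p ∂V = ⊤
  · rw [hGfin]; exact le_top
  have hpf : ∀ x, prim V G x ≠ ⊤ := fun x h => by
    have h1 := holder_prim H.one_lt hGm.aemeasurable (V := V) x
    rw [h, ENNReal.top_rpow_of_pos hp0] at h1
    exact ENNReal.mul_ne_top hGfin (ENNReal.rpow_ne_top_of_nonneg (by linarith [H.one_lt])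
      (H.V_lt_top x).ne) (top_le_iff.1 h1)
  have hq := H.isQuasiDeriv_prim hGm hpf Subset.rfl hφc.continuousOn (measurableSet_oI D)
    (fun x _ => by rw [hG, ENNReal.toReal_ofReal (hφ0 x)])
  set f := fun x => (prim V G x).toReal with hf
  have hE : energy p v D f = ∫⁻ s, G s ^ p ∂V := by
    rw [H.energy_eq hq.deriv_eq]
    exact lintegral_congr fun x => by rw [abs_of_nonneg (hφ0 x)]
  have hM : mass p u D f = ∫⁻ x, prim V G x ^ p ∂(wMeasure u D) := by
    rw [mass_eq H.one_lt]
    exact lintegral_congr fun x => by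
      rw [hf, abs_of_nonneg ENNReal.toReal_nonneg, ENNReal.ofReal_toReal (hpf x)]
  by_cases hne : ∃ x ∈ cI D, f x ≠ 0
  · have htest : IsTest p v D f :=
      { zero := by simp [hf, prim_zero wMeasure_Iio_zero, hV]
        ne_zero := hne
        cont := (ENNReal.continuousOn_toReal.comp_continuous (continuous_prim hpf) hpf).continuousOn
        quasi := ⟨_, hq⟩
        finite := by rw [hE]; exact lt_top_iff_ne_top.2 hGfin }
    rw [← hE, ← hM]
    exact ENNReal.mul_le_of_le_div (iInf₂_le f htest)
  -- The zero function is not an admissible test function, but then the left side of the inequality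
  -- is 0.
  · push Not at hne
    have : ∫⁻ x, prim V G x ^ p ∂(wMeasure u D) = 0 := by
      rw [← hM, mass_eq H.one_lt, lintegral_congr_ae (g := 0), Pi.zero_def, lintegral_zero]
      filter_upwards [ae_mem_oI] with x hx
      simp [hne x (oI_subset_cI D hx), hp0]
    simp [this]

theorem mass_const_mul (hp : 1 < p) {k : ℝ} (hk : 0 ≤ k) (f : ℝ → ℝ) :
    mass p u D (fun x => k * f x) = ENNReal.ofReal k ^ p * mass p u D f := by
  rw [mass_eq hp, mass_eq hp, ← lintegral_const_mul' _ _
    (ENNReal.rpow_ne_top_of_nonneg (by linarith) ENNReal.ofReal_ne_top)]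
  refine lintegral_congr fun x => ?_
  rw [abs_mul, abs_of_nonneg hk, ENNReal.ofReal_mul hk,
    ENNReal.mul_rpow_of_nonneg _ _ (by linarith)]

theorem energy_const_mul (hp : 1 < p) {k : ℝ} (hk : 0 ≤ k) (f : ℝ → ℝ) :
    energy p v D (fun x => k * f x) = ENNReal.ofReal k ^ p * energy p v D f := by
  rw [energy_eq' hp, energy_eq' hp, ← lintegral_const_mul' _ _
    (ENNReal.rpow_ne_top_of_nonneg (by linarith) ENNReal.ofReal_ne_top)]
  refine lintegral_congr fun x => ?_
  rw [deriv_const_mul_field, abs_mul, abs_of_nonneg hk, ENNReal.ofReal_mul hk,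
    ENNReal.mul_rpow_of_nonneg _ _ (by linarith)]

theorem lamC1_mul_mass_le (hp : 1 < p) {f : ℝ → ℝ} (h0 : f 0 = 0)
    (hf : ContDiffOn ℝ 1 f (oI D)) (hc : ContinuousOn f (cI D)) (hM : mass p u D f ≠ ⊤) :
    lamC1 p u v D * mass p u D f ≤ energy p v D f := by
  have hp0 : 0 < p := by linarith
  rcases eq_or_ne (mass p u D f) 0 with hM0 | hM0
  · simp [hM0]
  set M := mass p u D f with hMdef
  set k : ℝ := (M⁻¹ ^ (1 / p)).toReal with hk
  have hinv : M⁻¹ ^ (1 / p) ≠ ⊤ :=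
    ENNReal.rpow_ne_top_of_nonneg (by positivity) (ENNReal.inv_ne_top.2 hM0)
  have hkp : ENNReal.ofReal k ^ p = M⁻¹ := by
    rw [hk, ENNReal.ofReal_toReal hinv, ← ENNReal.rpow_mul, one_div_mul_cancel hp0.ne',
      ENNReal.rpow_one]
  have hk0 : 0 ≤ k := ENNReal.toReal_nonneg
  have h1 : lamC1 p u v D ≤ energy p v D (fun x => k * f x) := by
    refine iInf₂_le (fun x => k * f x) ⟨by simp [h0], contDiffOn_const.mul hf,
      continuousOn_const.mul hc, ?_⟩
    rw [mass_const_mul hp hk0, hkp, ENNReal.inv_mul_cancel hM0 hM]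
  rw [energy_const_mul hp hk0, hkp, mul_comm, ← div_eq_mul_inv] at h1
  exact ENNReal.mul_le_of_le_div h1

/-- A C¹ function need not have a continuous quasi-derivative, as v is only measurable, so it need
not be a test function for λ_p. The Hardy inequality for measurable densities covers it. -/
theorem lam_le_lamC1 (H : Weights p D u v) : lam p u v D ≤ lamC1 p u v D := by
  refine le_iInf₂ fun f hf => ?_
  obtain ⟨h0, hf1, hc, hM⟩ := hf
  have h1 := H.hardy_mul_mass_le H.hardy_lam (H.tendsto_zero hc h0) (f := f)
    (w := fun x => v x ^ (Real.conjExponent p - 1) * deriv f x) (fun a ha b hb => ?_)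
    (Eventually.of_forall fun x => rfl) ?_
  · rwa [hM, mul_one] at h1
  · refine ContDiffOn.absolutelyContinuousOnInterval (hf1.mono fun y hy => ?_)
    rcases le_total a b with hab | hab
    · rw [uIcc_of_le hab] at hy
      exact mem_oI_of_le hb (ha.1.trans_le hy.1) hy.2
    · rw [uIcc_of_ge hab] at hy
      exact mem_oI_of_le ha (hb.1.trans_le hy.1) hy.2
  · exact ((H.aemeasurable_v.pow_const _).mul (measurable_deriv f).aemeasurable).mono_ac wMeasure_ac

/-- Now the classical derivative is approximated: local integrability of v makes C_c dense in L^p(v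
dx), where W v̂ lives, and the Lebesgue primitive of the approximant is C¹. -/
theorem hardy_lamC1 (H : Weights p D u v) (hv : LocallyIntegrableOn v (oI D)) :
    Hardy p (wMeasure u D) (wMeasure (vhat p v) D) (lamC1 p u v D) := by
  have hp0 : 0 < p := by linarith [H.one_lt]
  set V := wMeasure (vhat p v) D with hV
  have hfinμ := H.isFiniteMeasure
  have hac1 : wMeasure v D ≪ volume.restrict (oI D) := wMeasure_ac
  have hac2 : volume.restrict (oI D) ≪ V := restrict_ac_wMeasure H.aemeasurable_vhat H.ae_vhat_pos
  intro W hW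
  by_cases hfin : ∫⁻ s, W s ^ p ∂V = ⊤
  · rw [hfin]; exact le_top
  have hWtop : ∀ᵐ s ∂V, ENNReal.ofReal (W s).toReal = W s := by
    filter_upwards [ae_lt_top' (hW.pow_const p) hfin] with s hs
    refine ENNReal.ofReal_toReal fun h => ?_
    simp [h, hp0] at hs
  have hvV : ∀ᵐ s ∂V, 0 < v s := wMeasure_ac.ae_le H.v_pos
  have hWv : ∀ᵐ s ∂(volume.restrict (oI D)),
      v s ^ (Real.conjExponent p - 1) * ((W s).toReal * |vhat p v s|) = (W s).toReal := by
    filter_upwards [H.v_pos] with s hs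
    rw [abs_of_pos (vhat_pos hs), mul_left_comm, vhat_mul_rpow hs, mul_one]
  refine hardy_of_approx H.one_lt H.V_lt_top hW fun ε hε => ?_
  obtain ⟨φ, hφc, hφ0, ⟨a, b, ha, hab, hb, hφab⟩, hφε⟩ := exists_continuous_approx H.pos hv H.one_lt
    (g := fun s => (W s).toReal * |vhat p v s|)
    ((hW.ennreal_toReal.mono_ac (hac1.trans hac2)).mul (H.aemeasurable_vhat.abs.mono_ac hac1))
    (fun _ => mul_nonneg ENNReal.toReal_nonneg (abs_nonneg _))
    (by
      have h1 := H.lintegral_rpow_eq hWv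
      simp only [abs_mul, abs_abs, abs_of_nonneg ENNReal.toReal_nonneg] at h1
      rwa [h1, lintegral_congr_ae (hWtop.mono fun s hs => by rw [hs])]) hε
  set w : ℝ → ℝ := fun s => v s ^ (Real.conjExponent p - 1) * φ s with hw
  have hwm : AEMeasurable w V :=
    ((H.aemeasurable_v.pow_const _).mul hφc.measurable.aemeasurable).mono_ac wMeasure_ac
  have hw0 : ∀ᵐ s ∂V, 0 ≤ w s := by
    filter_upwards [hvV] with s hs
    exact mul_nonneg (Real.rpow_nonneg hs.le _) (hφ0 s)
  refine ⟨fun s => ENNReal.ofReal (w s), fun s => ENNReal.ofReal |w s - (W s).toReal|,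
    hwm.ennreal_ofReal, (hwm.sub hW.ennreal_toReal).abs.ennreal_ofReal, ?_, ?_, ?_, ?_⟩
  · filter_upwards [hWtop, hw0] with s hs hws
    refine hs.symm.le.trans ?_
    rw [← ENNReal.ofReal_add hws (abs_nonneg _)]
    exact ENNReal.ofReal_le_ofReal (by linarith [neg_abs_le (w s - (W s).toReal)])
  · filter_upwards [hWtop] with s hs
    refine (ENNReal.ofReal_le_ofReal (q := (W s).toReal + |w s - (W s).toReal|)
      (by linarith [le_abs_self (w s - (W s).toReal)])).trans_eq ?_
    rw [ENNReal.ofReal_add ENNReal.toReal_nonneg (abs_nonneg _), hs]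
  · rw [← H.lintegral_rpow_eq (z := fun s => φ s - (W s).toReal * |vhat p v s|)]
    · exact hφε
    · filter_upwards [hWv] with s hs
      rw [mul_sub, hs]
  -- the test function is the primitive of `φ`
  set f : ℝ → ℝ := fun x => ∫ t in (0 : ℝ)..x, φ t with hf
  have hderiv : ∀ x, HasDerivAt f (φ x) x := fun x =>
    intervalIntegral.integral_hasDerivAt_right (hφc.intervalIntegrable _ _)
      (hφc.stronglyMeasurableAtFilter _ _) hφc.continuousAt
  have hfd : deriv f = φ := funext fun x => (hderiv x).deriv
  have hfC : ContDiff ℝ 1 f := by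
    rw [contDiff_one_iff_deriv, hfd]
    exact ⟨fun x => (hderiv x).differentiableAt, hφc⟩
  have hprim : ∀ x ∈ oI D, prim V (fun s => ENNReal.ofReal (w s)) x = ENNReal.ofReal (f x) := by
    intro x hx
    have hI : Iio x ∩ oI D = Ioo 0 x := by
      ext y
      exact ⟨fun h => ⟨h.2.1, h.1⟩, fun h => ⟨h.2, mem_oI_of_le hx h.1 h.2.le⟩⟩
    rw [prim, hV, setLIntegral_wMeasure H.aemeasurable_vhat _ measurableSet_Iio, hI, hf]
    simp only
    rw [intervalIntegral.integral_of_le hx.1.le, integral_Ioc_eq_integral_Ioo,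
      ofReal_integral_eq_lintegral_ofReal ((hφc.integrableOn_Icc).mono_set Ioo_subset_Icc_self)
        (Eventually.of_forall hφ0)]
    refine lintegral_congr_ae ?_
    have hsub : Ioo 0 x ⊆ oI D := fun y hy => mem_oI_of_le hx hy.1 hy.2.le
    filter_upwards [ae_restrict_of_ae_restrict_of_subset hsub H.v_pos] with s hs
    rw [← ENNReal.ofReal_mul (vhat_pos hs).le, hw]
    congr 1
    rw [← mul_assoc, mul_comm (vhat p v s), vhat_mul_rpow hs, one_mul]
  have hf0 : ∀ x ∈ oI D, 0 ≤ f x := fun x hx =>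
    intervalIntegral.integral_nonneg hx.1.le fun t _ => hφ0 t
  have hE : energy p v D f = ∫⁻ s, ENNReal.ofReal (w s) ^ p ∂V := by
    rw [H.energy_eq (w := w) (Eventually.of_forall fun x => by rw [hfd])]
    exact lintegral_congr_ae (hw0.mono fun s hs => by simp only; rw [abs_of_nonneg hs])
  have hM : mass p u D f = ∫⁻ x, prim V (fun s => ENNReal.ofReal (w s)) x ^ p ∂(wMeasure u D) := by
    rw [mass_eq H.one_lt]
    refine lintegral_congr_ae ?_
    filter_upwards [ae_mem_oI] with x hx
    rw [hprim x hx, abs_of_nonneg (hf0 x hx)]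
  rw [← hE, ← hM]
  refine lamC1_mul_mass_le H.one_lt (by simp [hf]) hfC.contDiffOn hfC.continuous.continuousOn ?_
  -- Since φ vanishes beyond b, f is bounded; as μ is finite, its mass is finite and can be
  -- normalised to 1.
  have hbd : ∀ x ∈ oI D, f x ≤ f b := by
    intro x hx
    rcases le_total x b with h | h
    · exact monotone_of_deriv_nonneg (fun x => (hderiv x).differentiableAt)
        (fun x => by rw [hfd]; exact hφ0 x) h
    · have : f x = f b := by
        simp only [hf]
        rw [← intervalIntegral.integral_add_adjacent_intervals (hφc.intervalIntegrable 0 b)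
          (hφc.intervalIntegrable b x)]
        have : ∫ t in b..x, φ t = 0 := by
          rw [intervalIntegral.integral_congr (g := fun _ => 0)]
          · simp
          · intro t ht
            rw [uIcc_of_le h] at ht
            exact hφab t fun h' => absurd h'.2 (not_lt.2 ht.1)
        rw [this, add_zero]
      exact this.le
  rw [mass_eq H.one_lt]
  have : ∫⁻ x, ENNReal.ofReal |f x| ^ p ∂(wMeasure u D)
      ≤ ∫⁻ _, ENNReal.ofReal (f b) ^ p ∂(wMeasure u D) := by
    refine lintegral_mono_ae ?_
    filter_upwards [ae_mem_oI] with x hx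
    rw [abs_of_nonneg (hf0 x hx)]
    exact ENNReal.rpow_le_rpow (ENNReal.ofReal_le_ofReal (hbd x hx)) hp0.le
  refine ne_top_of_le_ne_top ?_ this
  rw [lintegral_const]
  exact ENNReal.mul_ne_top (ENNReal.rpow_ne_top_of_nonneg hp0.le ENNReal.ofReal_ne_top)
    (measure_ne_top _ _)

theorem lamC1_eq_lam (H : Weights p D u v) (hv : LocallyIntegrableOn v (oI D)) :
    lamC1 p u v D = lam p u v D :=
  le_antisymm (H.le_lam_of_hardy (H.hardy_lamC1 hv)) H.lam_le_lamC1

end Weights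

/-! ### Bounds on reciprocal quotients in the extended half-line. -/

theorem mul_le_of_le_inv_div {a b c : ℝ≥0∞} (hb : b ≠ ⊤) (h : c ≤ (a / b)⁻¹) : c * a ≤ b := by
  rcases eq_or_ne b 0 with rfl | hb0
  · rcases eq_or_ne a 0 with rfl | ha
    · simp
    · rw [ENNReal.div_zero ha, ENNReal.inv_top] at h
      simp [le_zero_iff.1 h]
  · rw [ENNReal.inv_div (Or.inl hb) (Or.inl hb0)] at h
    exact ENNReal.mul_le_of_le_div h

theorem le_mul_of_inv_div_le {a b c : ℝ≥0∞} (hb : b ≠ ⊤) (hc0 : c ≠ 0) (hc : c ≠ ⊤)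
    (h : (a / b)⁻¹ ≤ c) : b ≤ c * a := by
  rcases eq_or_ne b 0 with rfl | hb0
  · simp
  rw [ENNReal.inv_div (Or.inl hb) (Or.inl hb0)] at h
  rw [mul_comm]
  exact (ENNReal.div_le_iff_le_mul (Or.inr hc) (Or.inr hc0)).1 h |>.trans_eq (mul_comm _ _)

theorem le_inv_div_of_mul_le {a b c : ℝ≥0∞} (hb : b ≠ ⊤) (hb0 : b ≠ 0) (h : c * a ≤ b) :
    c ≤ (a / b)⁻¹ := by
  rw [ENNReal.inv_div (Or.inl hb) (Or.inl hb0)]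
  exact (ENNReal.le_div_iff_mul_le (Or.inr hb0) (Or.inr hb)).2 h

theorem inv_div_le_of_le_mul {a b c : ℝ≥0∞} (hb : b ≠ ⊤) (hb0 : b ≠ 0) (hc : c ≠ ⊤) (hc0 : c ≠ 0)
    (h : b ≤ c * a) : (a / b)⁻¹ ≤ c := by
  rw [ENNReal.inv_div (Or.inl hb) (Or.inl hb0)]
  exact (ENNReal.div_le_iff_le_mul (Or.inr hc) (Or.inr hc0)).2 h

theorem prim_le_of_forall_lt {V : Measure ℝ} {W : ℝ → ℝ≥0∞} {x : ℝ} {K : ℝ≥0∞}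
    (h : ∀ y < x, prim V W y ≤ K) : prim V W x ≤ K := by
  have h1 : Iio x = ⋃ n : ℕ, Iio (x - 1 / (n + 1)) := by
    ext y
    simp only [mem_Iio, mem_iUnion]
    refine ⟨fun hy => ?_, fun ⟨n, hn⟩ => hn.trans_le (by simp; positivity)⟩
    obtain ⟨n, hn⟩ := exists_nat_one_div_lt (sub_pos.2 hy)
    exact ⟨n, by linarith⟩
  rw [prim, h1, setLIntegral_iUnion_of_directed]
  · refine iSup_le fun n => h _ ?_
    have : (0 : ℝ) < 1 / (n + 1) := by positivity
    linarith
  · refine Monotone.directed_le fun m n hmn => Iio_subset_Iio ?_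
    have : (m : ℝ) ≤ n := by exact_mod_cast hmn
    gcongr

theorem prim_indicator_Iio (V : Measure ℝ) (W : ℝ → ℝ≥0∞) (x₀ x : ℝ) :
    prim V ((Iio x₀).indicator W) x = prim V W (min x x₀) := by
  rw [prim, prim, setLIntegral_indicator measurableSet_Iio, Iio_inter_Iio, min_comm]

/-- With μ finite, this gives integrability of F^(p-1) from that of F^p. -/
theorem rpow_sub_one_le_one_add {p : ℝ} (hp : 1 < p) (x : ℝ≥0∞) : x ^ (p - 1) ≤ 1 + x ^ p := by
  rcases le_total x 1 with h | h
  · exact (ENNReal.rpow_le_one h (by linarith)).trans le_self_add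
  · exact (ENNReal.rpow_le_rpow_of_exponent_le h (by linarith)).trans le_add_self

theorem mul_abs_rpow {p w : ℝ} (hp : 1 < p) (hw : 0 < w) :
    ENNReal.ofReal (w * |w| ^ (p - 2)) = ENNReal.ofReal w ^ (p - 1) := by
  rw [abs_of_pos hw, ENNReal.ofReal_rpow_of_nonneg hw.le (by linarith)]
  congr 1
  conv_lhs => rw [← Real.rpow_one w]
  rw [← Real.rpow_mul hw.le, one_mul, ← Real.rpow_add hw]
  congr 1; ring

/-! ### Lower bounds and their sharpness. -/

namespace Weights

variable {p : ℝ} {D : EReal} {u v : ℝ → ℝ}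

theorem prim_ne_zero (H : Weights p D u v) {W : ℝ → ℝ≥0∞} {x y : ℝ}
    (hW : AEMeasurable W (wMeasure (vhat p v) D)) (hx : 0 < x) (hy : 0 < y)
    (h : ∀ s ∈ oI D, s < y → W s ≠ 0) : prim (wMeasure (vhat p v) D) W x ≠ 0 := by
  intro h0
  have h1 : prim (wMeasure (vhat p v) D) W (min x y) = 0 :=
    le_antisymm ((prim_mono_right _ _ (min_le_left _ _)).trans_eq h0) zero_le
  rw [prim, lintegral_eq_zero_iff' hW.restrict] at h1
  refine H.V_ne_zero (lt_min hx hy) ?_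
  rw [← Measure.restrict_apply_univ]
  refine measure_mono_null (fun s _ => ?_) (mem_ae_iff.1 (h1.and ((ae_restrict_of_ae ae_mem_oI).and
    (ae_restrict_mem measurableSet_Iio))))
  rintro ⟨h2, h3, h4⟩
  exact h s h3 (lt_of_lt_of_le h4 (min_le_right _ _)) h2

theorem tail_ne_zero (H : Weights p D u v) {φ : ℝ → ℝ≥0∞} {s : ℝ}
    (hφ : AEMeasurable φ (wMeasure u D)) {U : Set ℝ} (hU : IsOpen U) (hUs : U ⊆ Ioi s)
    (hne : (U ∩ oI D).Nonempty) (h : ∀ t ∈ U, t ∈ oI D → φ t ≠ 0) : tail (wMeasure u D) φ s ≠ 0 := by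
  intro h0
  rw [tail, lintegral_eq_zero_iff' hφ.restrict] at h0
  refine wMeasure_ne_zero H.aemeasurable_u H.u_pos hU hne ?_
  rw [← inter_eq_left.2 hUs, ← Measure.restrict_apply hU.measurableSet]
  refine measure_mono_null (fun t ht => ?_) (mem_ae_iff.1 (h0.and (ae_restrict_of_ae ae_mem_oI)))
  rintro ⟨h2, h3⟩
  exact h t ht h3 h2

theorem tail_ne_zero_of_pos (H : Weights p D u v) {φ : ℝ → ℝ≥0∞} {s : ℝ}
    (hφ : AEMeasurable φ (wMeasure u D)) (hs : s ∈ oI D) (h : ∀ t ∈ oI D, φ t ≠ 0) :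
    tail (wMeasure u D) φ s ≠ 0 := by
  obtain ⟨y, hy, hsy⟩ := exists_gt_mem_oI hs
  exact H.tail_ne_zero hφ isOpen_Ioi Subset.rfl ⟨y, hsy, hy⟩ fun t _ => h t

theorem lintegral_ne_zero_of_pos (H : Weights p D u v) {φ : ℝ → ℝ≥0∞}
    (hφ : AEMeasurable φ (wMeasure u D)) (h : ∀ t ∈ oI D, φ t ≠ 0) :
    ∫⁻ x, φ x ∂(wMeasure u D) ≠ 0 := by
  obtain ⟨y, hy⟩ := oI_nonempty H.pos
  refine fun h0 => H.tail_ne_zero_of_pos hφ hy h ?_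
  exact le_antisymm ((setLIntegral_le_lintegral _ _).trans_eq h0) zero_le

theorem opII_eq (H : Weights p D u v) (f : ℝ → ℝ) {x : ℝ} (hx : x ∈ oI D) :
    opII p u v D f x = prim (wMeasure (vhat p v) D)
      (fun s => tail (wMeasure u D) (fun t => ENNReal.ofReal (f t ^ (p - 1))) s
        ^ (Real.conjExponent p - 1)) x ^ (p - 1) / ENNReal.ofReal (f x ^ (p - 1)) := by
  have hI : Iio x ∩ oI D = Ioo 0 x := by
    ext y
    exact ⟨fun h => ⟨h.2.1, h.1⟩, fun h => ⟨h.2, mem_oI_of_le hx h.1 h.2.le⟩⟩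
  rw [prim, setLIntegral_wMeasure H.aemeasurable_vhat _ measurableSet_Iio, hI]
  rfl

theorem opI_eq {f w : ℝ → ℝ} {x : ℝ} (hp : 1 < p) (hw : 0 < w x) :
    opI p u D f w x = tail (wMeasure u D) (fun t => ENNReal.ofReal (f t ^ (p - 1))) x
      / ENNReal.ofReal (w x) ^ (p - 1) := by
  rw [← mul_abs_rpow hp hw]; rfl

theorem prim_FI (H : Weights p D u v) {f w : ℝ → ℝ} (hf : FI p v D f w) {x : ℝ} (hx : x ∈ oI D) :
    0 < f x ∧
    ENNReal.ofReal (f x) = prim (wMeasure (vhat p v) D) (fun s => ENNReal.ofReal (w s)) x := by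
  have h1 := H.ofReal_eq_prim Subset.rfl (fun x hx => Ioc_subset_oI hx)
    (H.tendsto_zero hf.cont hf.zero) hf.quasi.ac hf.quasi.deriv_eq (fun x hx => (hf.pos x hx).le) hx
  have h2 := H.prim_ne_zero (aemeasurable_of_continuousOn hf.quasi.cont).ennreal_ofReal hx.1 hx.1
    fun s hs _ => by simpa using hf.pos s hs
  rw [← h1.2] at h2
  exact ⟨by simpa using h2, h1.2⟩

theorem FI_toFII (H : Weights p D u v) {f w : ℝ → ℝ} (hf : FI p v D f w) : FII D f :=
  ⟨hf.cont, hf.zero, fun _ hx => (H.prim_FI hf hx).1⟩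

/-- The bound on I reads c · tail ≤ w^(p-1). Raise it to the power p*-1, integrate against V, and
raise back to p-1: the constant returns unchanged. -/
theorem iInf_opI_le_iInf_opII (H : Weights p D u v) {f w : ℝ → ℝ} (hf : FI p v D f w) :
    ⨅ x ∈ oI D, (opI p u D f w x)⁻¹ ≤ ⨅ x ∈ oI D, (opII p u v D f x)⁻¹ := by
  have hp := H.one_lt
  have hp1 : 0 < p - 1 := by linarith
  have hq1 := conj_sub_one_pos hp
  set c := ⨅ x ∈ oI D, (opI p u D f w x)⁻¹ with hc
  set φ : ℝ → ℝ≥0∞ := fun t => ENNReal.ofReal (f t ^ (p - 1)) with hφ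
  refine le_iInf₂ fun x hx => ?_
  obtain ⟨hfx, hfp⟩ := H.prim_FI hf hx
  rw [H.opII_eq f hx]
  refine le_inv_div_of_mul_le ENNReal.ofReal_ne_top (by simpa using Real.rpow_pos_of_pos hfx _) ?_
  rw [← ENNReal.ofReal_rpow_of_nonneg hfx.le hp1.le, hfp]
  have h1 : c ^ (Real.conjExponent p - 1) * prim (wMeasure (vhat p v) D)
      (fun s => tail (wMeasure u D) φ s ^ (Real.conjExponent p - 1)) x
      ≤ prim (wMeasure (vhat p v) D) (fun s => ENNReal.ofReal (w s)) x := by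
    rw [prim, ← lintegral_const_mul _ ((measurable_tail _ _).pow_const _)]
    refine lintegral_mono_ae (ae_restrict_of_ae ?_)
    filter_upwards [ae_mem_oI] with s hs
    have h2 : c ≤ (opI p u D f w s)⁻¹ := iInf₂_le s hs
    rw [opI_eq hp (hf.pos s hs)] at h2
    have h3 := mul_le_of_le_inv_div
      (ENNReal.rpow_ne_top_of_nonneg hp1.le ENNReal.ofReal_ne_top) h2
    have h4 := ENNReal.rpow_le_rpow h3 hq1.le
    rwa [ENNReal.mul_rpow_of_nonneg _ _ hq1.le, ← ENNReal.rpow_mul, mul_comm (p - 1),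
      conj_sub_one_mul hp, ENNReal.rpow_one] at h4
  have h5 := ENNReal.rpow_le_rpow h1 hp1.le
  rwa [ENNReal.mul_rpow_of_nonneg _ _ hp1.le, ← ENNReal.rpow_mul, conj_sub_one_mul hp,
    ENNReal.rpow_one] at h5

theorem aemeasurable_rpow_of_continuousOn {ρ : ℝ → ℝ} {f : ℝ → ℝ} (hf : ContinuousOn f (oI D)) :
    AEMeasurable (fun t => ENNReal.ofReal (f t ^ (p - 1))) (wMeasure ρ D) :=
  ((aemeasurable_of_continuousOn hf).pow_const _).ennreal_ofReal

/-- One application of II improves f to a supersolution: with W = (tail of f^(p-1))^(p*-1) and F its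
primitive, c F^(p-1) ≤ f^(p-1), so c · tail(F^(p-1)) ≤ W^(p-1). -/
theorem iInf_opII_le_lam (H : Weights p D u v) {f : ℝ → ℝ} (hf : FII D f) :
    ⨅ x ∈ oI D, (opII p u v D f x)⁻¹ ≤ lam p u v D := by
  have hp := H.one_lt
  have hp1 : 0 < p - 1 := by linarith
  refine le_of_forall_lt_imp_le_of_dense fun c hc => ?_
  rcases eq_or_ne c 0 with rfl | hc0
  · exact zero_le
  set V := wMeasure (vhat p v) D with hV
  set μ := wMeasure u D with hμ
  set φ : ℝ → ℝ≥0∞ := fun t => ENNReal.ofReal (f t ^ (p - 1)) with hφ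
  set W : ℝ → ℝ≥0∞ := fun s => tail μ φ s ^ (Real.conjExponent p - 1) with hW
  have hφm : AEMeasurable φ μ := aemeasurable_rpow_of_continuousOn (hf.cont.mono (oI_subset_cI D))
  have hWm : Measurable W := (measurable_tail _ _).pow_const _
  have hWanti : Antitone W := fun x y h =>
    ENNReal.rpow_le_rpow (tail_anti _ _ h) (conj_sub_one_pos hp).le
  have hWp : ∀ s, W s ^ (p - 1) = tail μ φ s := fun s => by
    rw [hW, ← ENNReal.rpow_mul, conj_sub_one_mul hp, ENNReal.rpow_one]
  have hle : ∀ x ∈ oI D, c * prim V W x ^ (p - 1) ≤ φ x := by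
    intro x hx
    have h1 : c ≤ (opII p u v D f x)⁻¹ := hc.le.trans (iInf₂_le x hx)
    rw [H.opII_eq f hx] at h1
    exact mul_le_of_le_inv_div ENNReal.ofReal_ne_top h1
  refine H.le_lam_of_hardy fun G hG => hardy_of_supersolution hp (F := prim V W)
    hWm.aemeasurable (measurable_prim _ _).aemeasurable hG ?_ ?_
    (Eventually.of_forall fun x => le_rfl) (Eventually.of_forall fun s => ?_)
  · filter_upwards [ae_mem_oI] with s hs h0
    have h1 := hWp s
    rw [h0, ENNReal.zero_rpow_of_pos hp1] at h1
    exact H.tail_ne_zero_of_pos hφm hs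
      (fun t ht => by simpa [hφ] using Real.rpow_pos_of_pos (hf.pos t ht) _) h1.symm
  -- W is decreasing, so W(s) = ∞ would make its primitive at s infinite, against c · (prim W)^(p-1)
  -- ≤ f^(p-1) < ∞ with c > 0.
  · filter_upwards [ae_mem_oI] with s hs h0
    have h1 := antitone_mul_le_prim (V := V) hWanti s
    rw [h0, ENNReal.top_mul (H.V_ne_zero hs.1), top_le_iff] at h1
    have h2 := hle s hs
    rw [h1, ENNReal.top_rpow_of_pos hp1, ENNReal.mul_top hc0, top_le_iff] at h2
    exact ENNReal.ofReal_ne_top h2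
  · rw [hWp, tail, ← lintegral_const_mul' _ _ hc.ne_top]
    refine tail_mono ?_ s
    filter_upwards [ae_mem_oI] with x hx using hle x hx

/-- Supersolutions with constant `c` below the eigenvalue. -/
theorem exists_supersolution (H : Weights p D u v) {c : ℝ≥0∞} (hc0 : c ≠ 0) (hc : c < lam p u v D)
    {η : ℝ → ℝ} {b : ℝ} (hη : Continuous η) (hb : b ∈ oI D)
    (hηpos : ∀ x < b, 0 < η x) (hηb : ∀ x ≥ b, η x = 0) :
    ∃ W : ℝ → ℝ≥0∞, Continuous W ∧ (∀ s, W s ≠ ⊤) ∧ (∀ s ∈ oI D, W s ≠ 0) ∧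
      (∀ x, prim (wMeasure (vhat p v) D) W x ≠ ⊤) ∧
      ∫⁻ x, prim (wMeasure (vhat p v) D) W x ^ (p - 1) ∂(wMeasure u D) ≠ ⊤ ∧
      ∀ s, W s ^ (p - 1) = ENNReal.ofReal (η s) + c * tail (wMeasure u D)
        (fun t => prim (wMeasure (vhat p v) D) W t ^ (p - 1)) s := by
  have hp := H.one_lt
  have hp0 : 0 < p := by linarith
  have hp1 : 0 < p - 1 := by linarith
  have hq1 := conj_sub_one_pos hp
  have hq0 : 0 < Real.conjExponent p := by linarith
  have hfinμ := H.isFiniteMeasure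
  set V := wMeasure (vhat p v) D with hV
  set μ := wMeasure u D with hμ
  have hηfin : ∫⁻ s, ENNReal.ofReal (η s) ^ Real.conjExponent p ∂V ≠ ⊤ := by
    obtain ⟨C, hC⟩ := isCompact_Icc.exists_bound_of_continuousOn (s := Icc 0 b) hη.continuousOn
    have : ∫⁻ s, ENNReal.ofReal (η s) ^ Real.conjExponent p ∂V
        ≤ ∫⁻ s in Iio b, ENNReal.ofReal C ^ Real.conjExponent p ∂V := by
      rw [← lintegral_indicator measurableSet_Iio]
      refine lintegral_mono_ae ?_
      filter_upwards [ae_mem_oI] with s hs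
      by_cases hsb : s < b
      · rw [indicator_of_mem (show s ∈ Iio b from hsb)]
        exact ENNReal.rpow_le_rpow (ENNReal.ofReal_le_ofReal
          ((le_abs_self _).trans (hC s ⟨hs.1.le, hsb.le⟩))) hq0.le
      · simp [hηb s (not_lt.1 hsb), hq0]
    refine ne_top_of_le_ne_top ?_ this
    rw [setLIntegral_const]
    exact ENNReal.mul_ne_top (ENNReal.rpow_ne_top_of_nonneg hq0.le ENNReal.ofReal_ne_top)
      (H.V_lt_top b).ne
  obtain ⟨W, hWm, hWeq, hWfin⟩ := H.hardy_lam.exists_supersolution hp hc H.V_lt_top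
    hη.measurable.ennreal_ofReal hηfin
  have hprim : ∀ x, prim V W x ≠ ⊤ := fun x h => by
    have h1 := holder_prim hp hWm.aemeasurable (V := V) x
    rw [h, ENNReal.top_rpow_of_pos hp0] at h1
    exact ENNReal.mul_ne_top hWfin (ENNReal.rpow_ne_top_of_nonneg hp1.le (H.V_lt_top x).ne)
      (top_le_iff.1 h1)
  have hmass : ∫⁻ x, prim V W x ^ p ∂μ ≠ ⊤ := by
    intro h
    have h1 := H.hardy_lam W hWm.aemeasurable
    rw [h, ENNReal.mul_top (zero_le.trans_lt hc).ne', top_le_iff] at h1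
    exact hWfin h1
  -- This makes the tail finite and continuous, hence W continuous, as the classes of test functions
  -- demand.
  have hmass1 : ∫⁻ x, prim V W x ^ (p - 1) ∂μ ≠ ⊤ := by
    refine ne_top_of_le_ne_top ?_ (lintegral_mono fun x => rpow_sub_one_le_one_add hp _)
    rw [lintegral_add_left measurable_const, lintegral_one]
    exact ENNReal.add_ne_top.2 ⟨measure_ne_top _ _, hmass⟩
  set T := tail μ (fun t => prim V W t ^ (p - 1)) with hT
  have hTfin : ∀ s, T s ≠ ⊤ := fun s =>
    ne_top_of_le_ne_top hmass1 (setLIntegral_le_lintegral _ _)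
  have hWp : ∀ s, W s ^ (p - 1) = ENNReal.ofReal (η s) + c * T s := fun s => by
    rw [hWeq s, ← ENNReal.rpow_mul, conj_sub_one_mul hp, ENNReal.rpow_one]
  have hWne : ∀ s, ENNReal.ofReal (η s) + c * T s ≠ 0 → W s ≠ 0 := fun s h h0 => by
    rw [← hWp, h0, ENNReal.zero_rpow_of_pos hp1] at h
    exact h rfl
  refine ⟨W, ?_, fun s => ?_, fun s hs => hWne s ?_, hprim, hmass1, hWp⟩
  · rw [show W = fun s => (ENNReal.ofReal (η s) + c * T s) ^ (Real.conjExponent p - 1) from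
      funext hWeq]
    exact ENNReal.continuous_rpow_const.comp ((ENNReal.continuous_ofReal.comp hη).add
      ((ENNReal.continuous_const_mul hc.ne_top).comp (continuous_tail hmass1)))
  · rw [hWeq s]
    exact ENNReal.rpow_ne_top_of_nonneg hq1.le (ENNReal.add_ne_top.2
      ⟨ENNReal.ofReal_ne_top, ENNReal.mul_ne_top hc.ne_top (hTfin s)⟩)
  · have h1 : T s ≠ 0 := H.tail_ne_zero_of_pos ((measurable_prim _ _).pow_const _).aemeasurable hs
      fun t ht h0 => by
        rw [ENNReal.rpow_eq_zero_iff_of_pos hp1] at h0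
        refine H.prim_ne_zero hWm.aemeasurable ht.1 hb.1 (fun r hr hrb => hWne r ?_) h0
        simp [hηpos r hrb]
    simp [hc0, h1]

/-- The source η only increases W^(p-1), so the solution satisfies 1/I ≥ c; its role is to keep the
iteration away from the zero solution. -/
theorem lam_le_iSup_opI (H : Weights p D u v) :
    lam p u v D ≤ ⨆ (f : ℝ → ℝ) (w : ℝ → ℝ) (_ : FI p v D f w), ⨅ x ∈ oI D, (opI p u D f w x)⁻¹ := by
  have hp := H.one_lt
  have hp1 : 0 < p - 1 := by linarith
  refine le_of_forall_lt_imp_le_of_dense fun c hc => ?_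
  rcases eq_or_ne c 0 with rfl | hc0
  · exact zero_le
  obtain ⟨b, hb⟩ := oI_nonempty H.pos
  obtain ⟨W, hWc, hWt, hW0, hprim, -, hWp⟩ := H.exists_supersolution hc0 hc
    (η := fun x => max (b - x) 0) (by fun_prop) hb
    (fun x hx => by simpa using hx) (fun x hx => max_eq_right (by linarith))
  set V := wMeasure (vhat p v) D with hV
  have hwpos : ∀ x ∈ oI D, 0 < (W x).toReal := fun x hx => ENNReal.toReal_pos (hW0 x hx) (hWt x)
  have hFI : FI p v D (fun x => (prim V W x).toReal) (fun x => (W x).toReal) :=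
    { cont := (ENNReal.continuousOn_toReal.comp_continuous (continuous_prim hprim)
        hprim).continuousOn
      quasi := H.isQuasiDeriv_prim hWc.measurable hprim Subset.rfl
        (ENNReal.continuousOn_toReal.comp_continuous hWc hWt).continuousOn (measurableSet_oI D)
        fun _ _ => rfl
      zero := by simp [prim_zero wMeasure_Iio_zero, hV]
      pos := hwpos }
  refine le_iSup₂_of_le _ _ (le_iSup_of_le hFI (le_iInf₂ fun x hx => ?_))
  rw [opI_eq hp (hwpos x hx), ENNReal.ofReal_toReal (hWt x)]
  refine le_inv_div_of_mul_le (ENNReal.rpow_ne_top_of_nonneg hp1.le (hWt x))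
    (by simp [ENNReal.rpow_eq_zero_iff_of_pos hp1, hW0 x hx]) ?_
  rw [hWp]
  refine le_trans (le_of_eq ?_) le_add_self
  congr 2
  funext t
  rw [← ENNReal.ofReal_rpow_of_nonneg ENNReal.toReal_nonneg hp1.le, ENNReal.ofReal_toReal (hprim t)]

/-! ### Upper bounds and their sharpness: stopped functions. -/

theorem min_mem_oI {x x₀ : ℝ} (hx : x ∈ oI D) (hx₀ : x₀ ∈ oI D) : min x x₀ ∈ oI D :=
  mem_oI_of_le hx (lt_min hx.1 hx₀.1) (min_le_left _ _)

theorem prim_FtI (H : Weights p D u v) {f w : ℝ → ℝ} {x₀ : ℝ} (hx₀ : x₀ ∈ oI D) (h0 : f 0 = 0)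
    (hc : ContinuousOn f (Icc 0 x₀)) (hq : IsQuasiDeriv p v (Ioo 0 x₀) f w)
    (hw : ∀ x ∈ Ioo 0 x₀, 0 < w x) (hf : ∀ x ∈ cI D, f x = f (min x x₀)) {x : ℝ}
    (hx : x ∈ oI D) : 0 < f x ∧ ENNReal.ofReal (f x) = prim (wMeasure (vhat p v) D)
      ((Iio x₀).indicator fun s => ENNReal.ofReal (w s)) x := by
  set V := wMeasure (vhat p v) D with hV
  set W : ℝ → ℝ≥0∞ := fun s => ENNReal.ofReal (w s) with hW
  have hJ : Ioo 0 x₀ ⊆ oI D := fun y hy => mem_oI_of_le hx₀ hy.1 hy.2.le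
  have h1 : ∀ y ∈ Ioo 0 x₀, 0 ≤ f y ∧ ENNReal.ofReal (f y) = prim V W y := fun y hy =>
    H.ofReal_eq_prim hJ (fun x hx z hz => ⟨hz.1, hz.2.trans_lt hx.2⟩)
      (tendsto_zero_of_continuousOn hc h0 hx₀.1 Subset.rfl) hq.ac hq.deriv_eq
      (fun x hx => (hw x hx).le) hy
  have hlim : Tendsto (fun y => ENNReal.ofReal (f y)) (𝓝[<] x₀) (𝓝 (ENNReal.ofReal (f x₀))) := by
    have h2 := (hc x₀ ⟨hx₀.1.le, le_rfl⟩).mono Ioo_subset_Icc_self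
    rw [ContinuousWithinAt, nhdsWithin_Ioo_eq_nhdsLT hx₀.1] at h2
    exact (ENNReal.continuous_ofReal.tendsto _).comp h2
  -- The quasi-derivative is known only on the open interval; the value at x₀ comes from left
  -- continuity of both sides.
  have hx₀eq : ENNReal.ofReal (f x₀) = prim V W x₀ := by
    refine le_antisymm (le_of_tendsto hlim ?_) (prim_le_of_forall_lt fun y hy => ?_)
    · filter_upwards [Ioo_mem_nhdsLT hx₀.1] with y hy
      rw [(h1 y hy).2]
      exact prim_mono_right _ _ hy.2.le
    · refine ge_of_tendsto hlim ?_
      filter_upwards [Ioo_mem_nhdsLT (max_lt hx₀.1 hy)] with z hz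
      rw [(h1 z ⟨(le_max_left _ _).trans_lt hz.1, hz.2⟩).2]
      exact prim_mono_right _ _ ((le_max_right _ _).trans hz.1.le)
  have hall : ∀ x ∈ oI D, ENNReal.ofReal (f x) = prim V ((Iio x₀).indicator W) x := by
    intro x hx
    rw [prim_indicator_Iio, hf x (oI_subset_cI D hx)]
    rcases lt_or_ge x x₀ with h | h
    · rw [min_eq_left h.le]; exact (h1 x ⟨hx.1, h⟩).2
    · rw [min_eq_right h]; exact hx₀eq
  refine ⟨?_, hall x hx⟩
  have hne := H.prim_ne_zero (x := x) (y := x₀) (W := (Iio x₀).indicator W) ?_ hx.1 hx₀.1 ?_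
  · rw [← hall x hx] at hne
    simpa using hne
  · refine (aemeasurable_indicator_iff measurableSet_Iio).2 ?_
    have h3 : AEMeasurable W (volume.restrict (Ioo 0 x₀)) :=
      (hq.cont.aemeasurable measurableSet_Ioo).ennreal_ofReal
    have h4 : V.restrict (Iio x₀) ≪ volume.restrict (Ioo 0 x₀) := by
      have h5 := (wMeasure_ac (ρ := vhat p v) (D := D)).restrict (Iio x₀)
      rw [Measure.restrict_restrict measurableSet_Iio] at h5
      refine h5.trans (Measure.absolutelyContinuous_of_le (Measure.restrict_mono ?_ le_rfl))
      exact fun y hy => ⟨hy.2.1, hy.1⟩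
    exact h3.mono_ac h4
  · intro s hs hsx
    rw [indicator_of_mem (show s ∈ Iio x₀ from hsx)]
    simpa [hW] using hw s ⟨hs.1, hsx⟩

theorem FtI_toFtII (H : Weights p D u v) {f w : ℝ → ℝ} (h : FtI p v D f w) : FtII D f := by
  obtain ⟨x₀, hx₀, h0, hc, hq, hw, hf, -⟩ := h
  exact ⟨h0, x₀, hx₀, hf, fun x hx => (H.prim_FtI hx₀ h0 hc hq hw hf hx).1, hc⟩

/-- Same integration as for the lower bounds. At and after x₀ the density of f is 0, so nothing has
to be checked there. -/
theorem iSup_opII_le_iSup_opI (H : Weights p D u v) {f w : ℝ → ℝ} (h : FtI p v D f w) :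
    ⨆ x ∈ oI D, (opII p u v D f x)⁻¹ ≤ ⨆ x ∈ oI D, (opI p u D f w x)⁻¹ := by
  have hp := H.one_lt
  have hp1 : 0 < p - 1 := by linarith
  have hq1 := conj_sub_one_pos hp
  obtain ⟨x₀, hx₀, h0, hc, hq, hw, hf, -⟩ := h
  refine le_of_forall_gt_imp_ge_of_dense fun a ha => iSup₂_le fun x hx => ?_
  rcases eq_or_ne a ⊤ with rfl | hat
  · exact le_top
  have ha0 : a ≠ 0 := (zero_le.trans_lt ha).ne'
  obtain ⟨hfx, hfp⟩ := H.prim_FtI hx₀ h0 hc hq hw hf hx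
  set φ : ℝ → ℝ≥0∞ := fun t => ENNReal.ofReal (f t ^ (p - 1)) with hφ
  rw [H.opII_eq f hx]
  refine inv_div_le_of_le_mul ENNReal.ofReal_ne_top (by simpa using Real.rpow_pos_of_pos hfx _)
    hat ha0 ?_
  rw [← ENNReal.ofReal_rpow_of_nonneg hfx.le hp1.le, hfp]
  have h1 : prim (wMeasure (vhat p v) D) ((Iio x₀).indicator fun s => ENNReal.ofReal (w s)) x
      ≤ a ^ (Real.conjExponent p - 1) * prim (wMeasure (vhat p v) D)
      (fun s => tail (wMeasure u D) φ s ^ (Real.conjExponent p - 1)) x := by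
    conv_rhs => rw [prim, ← lintegral_const_mul _ ((measurable_tail _ _).pow_const _)]
    refine lintegral_mono_ae (ae_restrict_of_ae ?_)
    filter_upwards [ae_mem_oI] with s hs
    by_cases hsx : s < x₀
    · rw [indicator_of_mem (show s ∈ Iio x₀ from hsx)]
      have hws := hw s ⟨hs.1, hsx⟩
      have h2 : (opI p u D f w s)⁻¹ ≤ a := (le_iSup₂ (f := fun x (_ : x ∈ oI D) =>
        (opI p u D f w x)⁻¹) s hs).trans ha.le
      rw [opI_eq hp hws] at h2
      have h3 := le_mul_of_inv_div_le
        (ENNReal.rpow_ne_top_of_nonneg hp1.le ENNReal.ofReal_ne_top) ha0 hat h2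
      have h4 := ENNReal.rpow_le_rpow h3 hq1.le
      rwa [ENNReal.mul_rpow_of_nonneg _ _ hq1.le, ← ENNReal.rpow_mul, mul_comm (p - 1),
        conj_sub_one_mul hp, ENNReal.rpow_one] at h4
    · rw [indicator_of_notMem (show s ∉ Iio x₀ from hsx)]
      exact zero_le
  have h5 := ENNReal.rpow_le_rpow h1 hp1.le
  rwa [ENNReal.mul_rpow_of_nonneg _ _ hp1.le, ← ENNReal.rpow_mul, conj_sub_one_mul hp,
    ENNReal.rpow_one] at h5

/-- The test density is (tail of f^(p-1))^(p*-1) cut off at x₀. Cutting makes its primitive bounded,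
hence of finite mass, and costs nothing because f itself is constant beyond x₀. -/
theorem lam_le_iSup_opII_of_FtII (H : Weights p D u v) {f : ℝ → ℝ} (h : FtII D f) :
    lam p u v D ≤ ⨆ x ∈ oI D, (opII p u v D f x)⁻¹ := by
  have hp := H.one_lt
  have hp0 : 0 < p := by linarith
  have hp1 : 0 < p - 1 := by linarith
  have hq1 := conj_sub_one_pos hp
  have hfinμ := H.isFiniteMeasure
  obtain ⟨h0, x₀, hx₀, hf, hpos, hc⟩ := h
  refine le_of_forall_gt_imp_ge_of_dense fun a ha => ?_
  rcases eq_or_ne a ⊤ with rfl | hat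
  · exact le_top
  have ha0 : a ≠ 0 := (zero_le.trans_lt ha).ne'
  set V := wMeasure (vhat p v) D with hV
  set μ := wMeasure u D with hμ
  set φ : ℝ → ℝ≥0∞ := fun t => ENNReal.ofReal (f t ^ (p - 1)) with hφ
  set g : ℝ → ℝ≥0∞ := fun s => tail μ φ s ^ (Real.conjExponent p - 1) with hg
  have hgm : Measurable g := (measurable_tail _ _).pow_const _
  have hgp : ∀ s, g s ^ (p - 1) = tail μ φ s := fun s => by
    rw [hg, ← ENNReal.rpow_mul, conj_sub_one_mul hp, ENNReal.rpow_one]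
  have hfc : ContinuousOn f (oI D) := by
    have h1 : ContinuousOn (fun x => f (min x x₀)) (oI D) :=
      hc.comp (continuous_id.min continuous_const).continuousOn fun x hx =>
        ⟨le_min hx.1.le hx₀.1.le, min_le_right _ _⟩
    exact h1.congr fun x hx => hf x (oI_subset_cI D hx)
  have hφm : AEMeasurable φ μ := aemeasurable_rpow_of_continuousOn hfc
  have hφpos : ∀ t ∈ oI D, φ t ≠ 0 := fun t ht => by
    simpa [hφ] using Real.rpow_pos_of_pos (hpos t ht) _
  have hgpos : ∀ s ∈ oI D, g s ≠ 0 := fun s hs hgs => by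
    have h1 := hgp s
    rw [hgs, ENNReal.zero_rpow_of_pos hp1] at h1
    exact H.tail_ne_zero_of_pos hφm hs hφpos h1.symm
  have hle : ∀ x ∈ oI D, φ x ≤ a * prim V g x ^ (p - 1) := by
    intro x hx
    have h1 : (opII p u v D f x)⁻¹ ≤ a := (le_iSup₂ (f := fun x (_ : x ∈ oI D) =>
      (opII p u v D f x)⁻¹) x hx).trans ha.le
    rw [H.opII_eq f hx] at h1
    exact le_mul_of_inv_div_le ENNReal.ofReal_ne_top ha0 hat h1
  obtain ⟨C, hC⟩ := isCompact_Icc.exists_bound_of_continuousOn hc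
  have hφle : ∀ t ∈ oI D, φ t ≤ ENNReal.ofReal (C ^ (p - 1)) := fun t ht => by
    refine ENNReal.ofReal_le_ofReal (Real.rpow_le_rpow (hpos t ht).le ?_ hp1.le)
    rw [hf t (oI_subset_cI D ht)]
    exact (le_abs_self _).trans (hC _ ⟨le_min ht.1.le hx₀.1.le, min_le_right _ _⟩)
  have hφfin : ∫⁻ x, φ x ∂μ ≠ ⊤ := by
    refine ne_top_of_le_ne_top ?_ (lintegral_mono_ae (ae_mem_oI.mono hφle))
    rw [lintegral_const]
    exact ENNReal.mul_ne_top ENNReal.ofReal_ne_top (measure_ne_top _ _)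
  set B := (∫⁻ x, φ x ∂μ) ^ (Real.conjExponent p - 1) with hB
  have hBt : B ≠ ⊤ := ENNReal.rpow_ne_top_of_nonneg hq1.le hφfin
  have hprim : ∀ x, prim V ((Iio x₀).indicator g) x ≤ B * V (Iio x₀) := fun x => by
    rw [prim_indicator_Iio]
    refine (prim_mono_right _ _ (min_le_right _ _)).trans ?_
    rw [← setLIntegral_const]
    exact lintegral_mono fun s => ENNReal.rpow_le_rpow (setLIntegral_le_lintegral _ _) hq1.le
  refine H.hardy_lam.le_of_subsolution hp hφm
    (W := (Iio x₀).indicator g) (hgm.indicator measurableSet_Iio).aemeasurable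
    (Eventually.of_forall fun s => ?_) ?_ ?_ ?_
  · rw [← hgp s]
    exact ENNReal.rpow_le_rpow (indicator_le_self _ _ _) hp1.le
  · filter_upwards [ae_mem_oI] with x hx
    rw [prim_indicator_Iio]
    have h1 := hle _ (min_mem_oI hx hx₀)
    simp only [hφ] at h1 ⊢
    rwa [hf x (oI_subset_cI D hx)]
  · refine H.lintegral_ne_zero_of_pos ((measurable_prim _ _).pow_const _).aemeasurable
      fun x hx h1 => ?_
    rw [ENNReal.rpow_eq_zero_iff_of_pos hp0] at h1
    refine H.prim_ne_zero (hgm.indicator measurableSet_Iio).aemeasurable hx.1 hx₀.1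
      (fun s hs hsx => ?_) h1
    rw [indicator_of_mem (show s ∈ Iio x₀ from hsx)]
    exact hgpos s hs
  · refine ne_top_of_le_ne_top ?_ (lintegral_mono fun x => ENNReal.rpow_le_rpow (hprim x) hp0.le)
    rw [lintegral_const]
    exact ENNReal.mul_ne_top (ENNReal.rpow_ne_top_of_nonneg hp0.le
      (ENNReal.mul_ne_top hBt (H.V_lt_top _).ne)) (measure_ne_top _ _)

/-- Without stopping, finite mass comes from the hypothesis f · II(f) ∈ L^p(μ): it puts f in L^p(μ),
the dual Hardy inequality gives the test density finite energy, and the Hardy inequality itself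
gives finite mass. Both uses need λ_p > 0. -/
theorem lam_le_iSup_opII_of_FtII' (H : Weights p D u v) {f : ℝ → ℝ} (h : FtII' p u v D f) :
    lam p u v D ≤ ⨆ x ∈ oI D, (opII p u v D f x)⁻¹ := by
  have hp := H.one_lt
  have hp0 : 0 < p := by linarith
  have hp1 : 0 < p - 1 := by linarith
  have hq1 := conj_sub_one_pos hp
  obtain ⟨h0, hc, hnn, ⟨x₁, hx₁, hfx₁⟩, hint⟩ := h
  refine le_of_forall_gt_imp_ge_of_dense fun a ha => ?_
  rcases eq_or_ne a ⊤ with rfl | hat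
  · exact le_top
  have ha0 : a ≠ 0 := (zero_le.trans_lt ha).ne'
  rcases eq_or_ne (lam p u v D) 0 with hlam | hlam
  · rw [hlam]; exact zero_le
  set V := wMeasure (vhat p v) D with hV
  set μ := wMeasure u D with hμ
  set φ : ℝ → ℝ≥0∞ := fun t => ENNReal.ofReal (f t ^ (p - 1)) with hφ
  set g : ℝ → ℝ≥0∞ := fun s => tail μ φ s ^ (Real.conjExponent p - 1) with hg
  have hgm : Measurable g := (measurable_tail _ _).pow_const _
  have hgp : ∀ s, g s ^ (p - 1) = tail μ φ s := fun s => by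
    rw [hg, ← ENNReal.rpow_mul, conj_sub_one_mul hp, ENNReal.rpow_one]
  have hfc : ContinuousOn f (oI D) := hc.mono (oI_subset_cI D)
  have hφm : AEMeasurable φ μ := aemeasurable_rpow_of_continuousOn hfc
  have hII : ∀ x ∈ oI D, (opII p u v D f x)⁻¹ ≤ a := fun x hx =>
    (le_iSup₂ (f := fun x (_ : x ∈ oI D) => (opII p u v D f x)⁻¹) x hx).trans ha.le
  have hle : ∀ x ∈ oI D, φ x ≤ a * prim V g x ^ (p - 1) := by
    intro x hx
    have h1 := hII x hx
    rw [H.opII_eq f hx] at h1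
    exact le_mul_of_inv_div_le ENNReal.ofReal_ne_top ha0 hat h1
  -- Since 1/II(f) ≤ a, one has f ≤ a f II(f).
  have hfL : ∫⁻ x, ENNReal.ofReal (f x) ^ p ∂μ ≠ ⊤ := by
    have h1 : ∀ x ∈ oI D, ENNReal.ofReal (f x) ^ p
        ≤ a ^ p * (ENNReal.ofReal (f x) * opII p u v D f x) ^ p := by
      intro x hx
      rw [← ENNReal.mul_rpow_of_nonneg _ _ hp0.le]
      refine ENNReal.rpow_le_rpow ?_ hp0.le
      have h2 : 1 ≤ a * opII p u v D f x := by
        have h3 : a⁻¹ ≤ opII p u v D f x := ENNReal.inv_le_iff_inv_le.1 (hII x hx)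
        calc 1 = a * a⁻¹ := (ENNReal.mul_inv_cancel ha0 hat).symm
          _ ≤ _ := by gcongr
      calc ENNReal.ofReal (f x) = ENNReal.ofReal (f x) * 1 := (mul_one _).symm
        _ ≤ ENNReal.ofReal (f x) * (a * opII p u v D f x) := by gcongr
        _ = _ := by ring
    refine ne_top_of_le_ne_top ?_ (lintegral_mono_ae (ae_mem_oI.mono h1))
    rw [lintegral_const_mul' _ _ (ENNReal.rpow_ne_top_of_nonneg hp0.le hat)]
    exact ENNReal.mul_ne_top (ENNReal.rpow_ne_top_of_nonneg hp0.le hat) hint.ne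
  have hφq : ∫⁻ x, φ x ^ Real.conjExponent p ∂μ ≠ ⊤ := by
    rw [lintegral_congr_ae (g := fun x => ENNReal.ofReal (f x) ^ p)]
    · exact hfL
    · filter_upwards [ae_mem_oI] with x hx
      simp only [hφ]
      rw [← ENNReal.ofReal_rpow_of_nonneg (hnn x hx) hp1.le, ← ENNReal.rpow_mul,
        sub_one_mul_conj hp]
  have hdual : ∫⁻ s, g s ^ p ∂V ≠ ⊤ := by
    simp_rw [hg, ← ENNReal.rpow_mul, conj_sub_one_mul_self hp]
    exact H.hardy_lam.dual hp hlam H.V_lt_top hφm hφq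
  refine H.hardy_lam.le_of_subsolution hp hφm hgm.aemeasurable
    (Eventually.of_forall fun s => (hgp s).le) (ae_mem_oI.mono hle) ?_ ?_
  · refine H.lintegral_ne_zero_of_pos ((measurable_prim _ _).pow_const _).aemeasurable
      fun x hx h1 => ?_
    rw [ENNReal.rpow_eq_zero_iff_of_pos hp0] at h1
    refine H.prim_ne_zero hgm.aemeasurable hx.1 hx₁.1 (fun s _ hsx hgs => ?_) h1
    have h2 := hgp s
    rw [hgs, ENNReal.zero_rpow_of_pos hp1] at h2
    have hU : IsOpen (Ioi s ∩ (oI D ∩ f ⁻¹' {0}ᶜ)) :=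
      isOpen_Ioi.inter (hfc.isOpen_inter_preimage (isOpen_oI D) isOpen_compl_singleton)
    refine H.tail_ne_zero hφm hU inter_subset_left ⟨x₁, ⟨hsx, hx₁, hfx₁⟩, hx₁⟩
      (fun t ht hto => ?_) h2.symm
    have h3 : 0 < f t := lt_of_le_of_ne (hnn t hto) (Ne.symm ht.2.2)
    simpa [hφ] using Real.rpow_pos_of_pos h3 _
  · intro h1
    have h2 := H.hardy_lam g hgm.aemeasurable
    rw [h1, ENNReal.mul_top hlam, top_le_iff] at h2
    exact hdual h2

/-- Stopped subsolutions with constant `a` above the eigenvalue. -/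
theorem exists_stopped_subsolution (H : Weights p D u v) {a : ℝ≥0∞} (ha : lam p u v D < a)
    (hat : a ≠ ⊤) :
    ∃ x₀ ∈ oI D, ∃ W : ℝ → ℝ≥0∞, Continuous W ∧ Antitone W ∧ (∀ s, W s ≤ 1) ∧
      (∀ s < x₀, W s ≠ 0) ∧ ∀ s < x₀, W s ^ (p - 1) ≤ a * ∫⁻ t in Ioo s x₀,
        prim (wMeasure (vhat p v) D) W t ^ (p - 1) ∂(wMeasure u D) := by
  have hfinμ := H.isFiniteMeasure
  obtain ⟨c, hc, hca⟩ := exists_between ha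
  have hnot : ¬ Hardy p (wMeasure u D) (wMeasure (vhat p v) D) c := fun h =>
    absurd (H.le_lam_of_hardy h) (not_le.2 hc)
  simp only [Hardy, not_forall, not_le] at hnot
  obtain ⟨G, hG, hlt⟩ := hnot
  obtain ⟨α, β, hα, hβ, hαβ, hcov⟩ := exists_exhaustion_Icc H.pos
  -- Monotone convergence: the failure of Hardy already shows when μ is restricted to an interval
  -- away from both ends.
  have h1 : ∫⁻ x, prim (wMeasure (vhat p v) D) G x ^ p ∂(wMeasure u D)
      = ⨆ n, ∫⁻ x in Ioo (α n) (β n), prim (wMeasure (vhat p v) D) G x ^ p ∂(wMeasure u D) := by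
    rw [← setLIntegral_iUnion_of_directed, ← setLIntegral_univ]
    · refine setLIntegral_congr ?_
      filter_upwards [ae_mem_oI (ρ := u) (D := D)] with x hx
      exact propext ⟨fun _ => mem_iUnion.2 (hcov x hx), fun _ => mem_univ x⟩
    · exact Monotone.directed_le fun m n h => Ioo_subset_Ioo (hα h) (hβ h)
  rw [h1, ENNReal.mul_iSup, lt_iSup_iff] at hlt
  obtain ⟨n, hn⟩ := hlt
  obtain ⟨x₀, hx₀, h⟩ := DNCase.exists_stopped_subsolution H.one_lt H.V_lt_top wMeasure_Iio_zero
    wMeasure_Iio_zero (fun x hx => H.V_ne_zero hx) (hαβ n).1 (hαβ n).2.1 hca hat hG hn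
  exact ⟨x₀, mem_oI_of_le (hαβ n).2.2 hx₀.1 hx₀.2, h⟩

theorem prim_ne_top_of_le_one (H : Weights p D u v) {W : ℝ → ℝ≥0∞} (hW : ∀ s, W s ≤ 1) (x : ℝ) :
    prim (wMeasure (vhat p v) D) W x ≠ ⊤ :=
  ne_top_of_le_ne_top (H.V_lt_top x).ne ((prim_mono (Eventually.of_forall hW) x).trans_eq
    (by simp [prim]))

/-- The stopped shooting solution, cut to 0 from x₀ on, satisfies w^(p-1) ≤ a · tail before x₀, that
is 1/I ≤ a. -/
theorem iInf_opI_le_lam (H : Weights p D u v) :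
    ⨅ (f : ℝ → ℝ) (w : ℝ → ℝ) (_ : FtI p v D f w), ⨆ x ∈ oI D, (opI p u D f w x)⁻¹
      ≤ lam p u v D := by
  have hp := H.one_lt
  have hp1 : 0 < p - 1 := by linarith
  refine le_of_forall_gt_imp_ge_of_dense fun a ha => ?_
  rcases eq_or_ne a ⊤ with rfl | hat
  · exact le_top
  have ha0 : a ≠ 0 := (zero_le.trans_lt ha).ne'
  obtain ⟨x₀, hx₀, W, hWc, -, hW1, hW0, hWle⟩ := H.exists_stopped_subsolution ha hat
  set V := wMeasure (vhat p v) D with hV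
  set μ := wMeasure u D with hμ
  have hWt : ∀ s, W s ≠ ⊤ := fun s => ((hW1 s).trans_lt ENNReal.one_lt_top).ne
  set W₀ := (Iio x₀).indicator W with hW₀
  have hW₀1 : ∀ s, W₀ s ≤ 1 := fun s => (indicator_le_self _ _ _).trans (hW1 s)
  have hprim := H.prim_ne_top_of_le_one hW₀1
  have hIio : ∀ s < x₀, W₀ s = W s := fun s hs => indicator_of_mem (show s ∈ Iio x₀ from hs) _
  have hW_min : ∀ x, prim V W₀ x = prim V W₀ (min x x₀) := fun x => by
    rw [hW₀, prim_indicator_Iio, prim_indicator_Iio, min_assoc, min_self]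
  have hcont : Continuous fun x => (prim V W₀ x).toReal :=
    ENNReal.continuousOn_toReal.comp_continuous (continuous_prim hprim) hprim
  have hq : IsQuasiDeriv p v (Ioo 0 x₀) (fun x => (prim V W₀ x).toReal) fun x => (W₀ x).toReal := by
    refine H.isQuasiDeriv_prim (hWc.measurable.indicator measurableSet_Iio) hprim
      (fun y hy => mem_oI_of_le hx₀ hy.1 hy.2.le) ?_ measurableSet_Ioo fun _ _ => rfl
    exact (ENNReal.continuousOn_toReal.comp_continuous hWc hWt).continuousOn.congr
      fun x hx => by rw [hIio x hx.2]; rfl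
  have hwpos : ∀ x < x₀, 0 < (W₀ x).toReal := fun x hx => by
    rw [hIio x hx]; exact ENNReal.toReal_pos (hW0 x hx) (hWt x)
  have hF : FtI p v D (fun x => (prim V W₀ x).toReal) (fun x => (W₀ x).toReal) :=
    ⟨x₀, hx₀, by simp [prim_zero wMeasure_Iio_zero, hV], hcont.continuousOn, hq,
      fun x hx => hwpos x hx.2, fun x _ => by simp only; rw [hW_min x], fun x _ hx => by
        simp [hW₀, not_lt.2 hx]⟩
  have hφ : (fun t => ENNReal.ofReal ((prim V W₀ t).toReal ^ (p - 1)))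
      = fun t => prim V W₀ t ^ (p - 1) := funext fun t => by
    rw [← ENNReal.ofReal_rpow_of_nonneg ENNReal.toReal_nonneg hp1.le,
      ENNReal.ofReal_toReal (hprim t)]
  refine iInf₂_le_of_le _ _ (iInf_le_of_le hF (iSup₂_le fun x hx => ?_))
  rcases lt_or_ge x x₀ with h | h
  · rw [opI_eq hp (hwpos x h), ENNReal.ofReal_toReal (ne_top_of_le_ne_top ENNReal.one_ne_top
      (hW₀1 x)), hφ, hIio x h]
    refine inv_div_le_of_le_mul (ENNReal.rpow_ne_top_of_nonneg hp1.le (hWt x))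
      (by simp [ENNReal.rpow_eq_zero_iff_of_pos hp1, hW0 x h]) hat ha0 ?_
    refine (hWle x h).trans (mul_le_mul_right ?_ _)
    calc _ = ∫⁻ t in Ioo x x₀, prim V W₀ t ^ (p - 1) ∂μ :=
          setLIntegral_congr_fun measurableSet_Ioo fun t ht => by
            rw [prim_congr fun s hs => hIio s (hs.trans ht.2)]
      _ ≤ _ := lintegral_mono_set Ioo_subset_Ioi_self
  -- From x₀ on the denominator of I is 0 while the tail is positive, so I = ∞ and the reciprocal
  -- contributes 0 to the supremum.
  · have h1 : (W₀ x).toReal = 0 := by simp [hW₀, not_lt.2 h]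
    have h2 : tail μ (fun t => prim V W₀ t ^ (p - 1)) x ≠ 0 :=
      H.tail_ne_zero_of_pos ((measurable_prim _ _).pow_const _).aemeasurable hx fun t ht h0 => by
        rw [ENNReal.rpow_eq_zero_iff_of_pos hp1] at h0
        exact H.prim_ne_zero (hWc.measurable.indicator measurableSet_Iio).aemeasurable ht.1 hx₀.1
          (fun s _ hs => by rw [← hW₀, hIio s hs]; exact hW0 s hs) h0
    rw [← hφ, tail] at h2
    rw [opI, h1, zero_mul, ENNReal.ofReal_zero, ENNReal.div_zero h2, ENNReal.inv_top]
    exact zero_le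

end Weights

/-! ### Logarithmic derivatives and the flux. -/

theorem contDiffOn_one_of_hasDerivAt {s : Set ℝ} (hs : IsOpen s) {f f' : ℝ → ℝ}
    (h : ∀ x ∈ s, HasDerivAt f (f' x) x) (hc : ContinuousOn f' s) : ContDiffOn ℝ 1 f s := by
  rw [contDiffOn_one_iff_derivWithin hs.uniqueDiffOn]
  exact ⟨fun x hx => (h x hx).differentiableAt.differentiableWithinAt,
    hc.congr fun x hx => by rw [derivWithin_of_isOpen hs hx, (h x hx).deriv]⟩

/-- At the stopping point h may fail to be differentiable, and then the default derivative is 0;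
otherwise it equals the right derivative, again 0. This realises the convention R(h) = 0 from x₀ on.
-/
theorem deriv_eq_zero_of_forall_ge {h : ℝ → ℝ} {x y : ℝ} (hxy : x < y)
    (hh : ∀ t ∈ Ico x y, h t = 0) : deriv h x = 0 := by
  by_cases hd : DifferentiableAt ℝ h x
  · refine (uniqueDiffWithinAt_Ici x).eq_deriv _ hd.hasDerivAt.hasDerivWithinAt ?_
    refine (hasDerivWithinAt_const x (Ici x) (0 : ℝ)).congr_of_eventuallyEq ?_
      (hh x ⟨le_rfl, hxy⟩)
    filter_upwards [Ico_mem_nhdsGE hxy] with t ht using hh t ht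
  · exact deriv_zero_of_not_differentiableAt hd

theorem opR_eq_zero_of_forall_ge {p : ℝ} {u v h : ℝ → ℝ} {x y : ℝ} (hxy : x < y)
    (hh : ∀ t ∈ Ico x y, h t = 0) : opR p u v h x = 0 := by
  simp [opR, bracket, deriv_eq_zero_of_forall_ge hxy hh, hh x ⟨le_rfl, hxy⟩]

/-- If `f' = h f`, then `v |f'|^(p-2) f' = v h^(p-1) f^(p-1)` has derivative
`-R(h) u f^(p-1)`. -/
theorem hasDerivAt_flux {p : ℝ} {u v h f : ℝ → ℝ} {x : ℝ} (hu : u x ≠ 0) (hh : 0 < h x)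
    (hf : 0 < f x) (hv' : DifferentiableAt ℝ v x) (hh' : DifferentiableAt ℝ h x)
    (hf' : HasDerivAt f (h x * f x) x) :
    HasDerivAt (fun t => v t * h t ^ (p - 1) * f t ^ (p - 1))
      (-(opR p u v h x * (u x * f x ^ (p - 1)))) x := by
  have h1 : ∀ {a : ℝ}, 0 < a → a ^ (p - 1) = a * a ^ (p - 2) := fun {a} ha => by
    conv_rhs => rw [← Real.rpow_one a, ← Real.rpow_mul ha.le, one_mul, ← Real.rpow_add ha]
    congr 1; ring
  refine ((hv'.hasDerivAt.mul (hh'.hasDerivAt.rpow_const (p := p - 1) (Or.inl hh.ne'))).mul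
    (hf'.rpow_const (p := p - 1) (Or.inl hf.ne'))).congr_deriv ?_
  simp only [Pi.mul_apply]
  rw [opR, bracket, abs_of_pos hh, show p - 1 - 1 = p - 2 by ring, h1 hh, h1 hf]
  field_simp
  ring

theorem setLIntegral_Ioo_ofReal {g : ℝ → ℝ} {a b : ℝ} (hab : a ≤ b)
    (hg : ContinuousOn g (Icc a b)) (h0 : ∀ x ∈ Icc a b, 0 ≤ g x) :
    ∫⁻ t in Ioo a b, ENNReal.ofReal (g t) = ENNReal.ofReal (∫ t in a..b, g t) := by
  rw [intervalIntegral.integral_of_le hab, integral_Ioc_eq_integral_Ioo,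
    ofReal_integral_eq_lintegral_ofReal (hg.integrableOn_Icc.mono_set Ioo_subset_Icc_self)]
  filter_upwards [ae_restrict_mem measurableSet_Ioo] with t ht using h0 t (Ioo_subset_Icc_self ht)

theorem Icc_subset_oI {D : EReal} {a b : ℝ} (ha : 0 < a) (hb : b ∈ oI D) : Icc a b ⊆ oI D :=
  fun _ hx => mem_oI_of_le hb (ha.trans_le hx.1) hx.2

theorem uIcc_subset_oI {D : EReal} {a b : ℝ} (ha : a ∈ oI D) (hb : b ∈ oI D) :
    uIcc a b ⊆ oI D := by
  rcases le_total a b with h | h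
  · rw [uIcc_of_le h]; exact Icc_subset_oI ha.1 hb
  · rw [uIcc_of_ge h]; exact Icc_subset_oI hb.1 ha

theorem setLIntegral_Ioo_wMeasure {D : EReal} {ρ φ : ℝ → ℝ} {a b : ℝ} (hab : a ≤ b)
    (hsub : Ioo a b ⊆ oI D) (hρm : AEMeasurable ρ (volume.restrict (oI D)))
    (hρ : ContinuousOn ρ (Icc a b)) (hφ : ContinuousOn φ (Icc a b))
    (hρ0 : ∀ x ∈ Icc a b, 0 ≤ ρ x) (hφ0 : ∀ x ∈ Icc a b, 0 ≤ φ x) :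
    ∫⁻ t in Ioo a b, ENNReal.ofReal (φ t) ∂(wMeasure ρ D)
      = ENNReal.ofReal (∫ t in a..b, ρ t * φ t) := by
  rw [setLIntegral_wMeasure hρm _ measurableSet_Ioo, inter_eq_left.2 hsub,
    ← setLIntegral_Ioo_ofReal (g := fun t => ρ t * φ t) hab (hρ.mul hφ) fun x hx => mul_nonneg (hρ0 x hx) (hφ0 x hx)]
  refine setLIntegral_congr_fun measurableSet_Ioo fun t ht => ?_
  exact (ENNReal.ofReal_mul (hρ0 t (Ioo_subset_Icc_self ht))).symm

theorem tail_le_of_forall_Ioo {D : EReal} (hD : 0 < D) {ρ : ℝ → ℝ} {φ : ℝ → ℝ≥0∞} {a : ℝ}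
    {K : ℝ≥0∞} (h : ∀ b ∈ oI D, ∫⁻ t in Ioo a b, φ t ∂(wMeasure ρ D) ≤ K) :
    tail (wMeasure ρ D) φ a ≤ K := by
  obtain ⟨b, hb, hbm, hbx⟩ := exists_exhaustion hD
  have h1 : Ioi a =ᵐ[wMeasure ρ D] ⋃ n, Ioo a (b n) := by
    filter_upwards [ae_mem_oI] with x hx
    refine propext ⟨fun h => ?_, fun h => ?_⟩
    · obtain ⟨n, hn⟩ := hbx x hx
      exact mem_iUnion.2 ⟨n, h, hn⟩
    · obtain ⟨n, hn⟩ := mem_iUnion.1 h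
      exact hn.1
  rw [tail, Measure.restrict_congr_set h1, setLIntegral_iUnion_of_directed]
  · exact iSup_le fun n => h _ (hbm n)
  · exact Monotone.directed_le fun m n hmn => Ioo_subset_Ioo_right (hb hmn)

theorem hasDerivAt_prim {D : EReal} {ρ φ : ℝ → ℝ} {W : ℝ → ℝ≥0∞} {J : Set ℝ} (hJ : IsOpen J)
    (hJD : J ⊆ oI D) (hρm : AEMeasurable ρ (volume.restrict (oI D))) (hρ : ContinuousOn ρ J)
    (hφ : ContinuousOn φ J) (hρ0 : ∀ x ∈ J, 0 ≤ ρ x) (hφ0 : ∀ x ∈ J, 0 ≤ φ x)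
    (hW : ∀ x ∈ J, W x = ENNReal.ofReal (φ x)) (hfin : ∀ x, prim (wMeasure ρ D) W x ≠ ⊤) {x : ℝ}
    (hx : x ∈ J) : HasDerivAt (fun t => (prim (wMeasure ρ D) W t).toReal) (ρ x * φ x) x := by
  obtain ⟨ε, hε, hball⟩ := Metric.isOpen_iff.1 hJ x hx
  rw [Real.ball_eq_Ioo] at hball
  set a := x - ε / 2 with ha
  have hsub : ∀ {t}, t < x + ε → Icc a t ⊆ J := fun ht s hs =>
    hball ⟨by linarith [hs.1], hs.2.trans_lt ht⟩
  have hc := hρ.mul hφ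
  have h1 : ∀ t ∈ Ioo a (x + ε), (prim (wMeasure ρ D) W t).toReal
      = (prim (wMeasure ρ D) W a).toReal + ∫ s in a..t, ρ s * φ s := by
    intro t ht
    have hs := hsub ht.2
    have h2 : ∫⁻ s in Ico a t, W s ∂(wMeasure ρ D) = ENNReal.ofReal (∫ s in a..t, ρ s * φ s) := by
      rw [← setLIntegral_Ioo_wMeasure ht.1.le (Ioo_subset_Icc_self.trans (hs.trans hJD)) hρm
        (hρ.mono hs) (hφ.mono hs) (fun y hy => hρ0 y (hs hy)) (fun y hy => hφ0 y (hs hy)),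
        setLIntegral_congr Ioo_ae_eq_Ico.symm]
      exact setLIntegral_congr_fun measurableSet_Ioo fun s h => hW s (hs (Ioo_subset_Icc_self h))
    rw [prim_add_Ico _ _ ht.1.le, h2, ENNReal.toReal_add (hfin a) ENNReal.ofReal_ne_top,
      ENNReal.toReal_ofReal]
    exact intervalIntegral.integral_nonneg ht.1.le fun s h =>
      mul_nonneg (hρ0 s (hs h)) (hφ0 s (hs h))
  have hx1 : x ∈ Ioo a (x + ε) := ⟨by linarith, by linarith⟩
  have h3 : HasDerivAt (fun t => ∫ s in a..t, ρ s * φ s) (ρ x * φ x) x := by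
    refine intervalIntegral.integral_hasDerivAt_right ?_ ?_ (hc.continuousAt (hJ.mem_nhds hx))
    · refine ContinuousOn.intervalIntegrable (hc.mono ?_)
      rw [uIcc_of_le hx1.1.le]
      exact hsub hx1.2
    · exact hc.stronglyMeasurableAtFilter hJ x hx
  refine (h3.const_add (prim (wMeasure ρ D) W a).toReal).congr_of_eventuallyEq ?_
  filter_upwards [Ioo_mem_nhds hx1.1 hx1.2] with t ht using h1 t ht

theorem hasDerivAt_tail {D : EReal} {ρ φ : ℝ → ℝ} {W : ℝ → ℝ≥0∞} {J : Set ℝ} (hJ : IsOpen J)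
    (hJD : J ⊆ oI D) (hρm : AEMeasurable ρ (volume.restrict (oI D))) (hρ : ContinuousOn ρ J)
    (hφ : ContinuousOn φ J) (hρ0 : ∀ x ∈ J, 0 ≤ ρ x) (hφ0 : ∀ x ∈ J, 0 ≤ φ x)
    (hW : ∀ x ∈ J, W x = ENNReal.ofReal (φ x)) (hfin : ∫⁻ x, W x ∂(wMeasure ρ D) ≠ ⊤) {x : ℝ}
    (hx : x ∈ J) : HasDerivAt (fun t => (tail (wMeasure ρ D) W t).toReal) (-(ρ x * φ x)) x := by
  have hp : ∀ t, prim (wMeasure ρ D) W t ≠ ⊤ := fun t =>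
    ne_top_of_le_ne_top hfin (setLIntegral_le_lintegral _ _)
  have ht : ∀ t, tail (wMeasure ρ D) W t ≠ ⊤ := fun t =>
    ne_top_of_le_ne_top hfin (setLIntegral_le_lintegral _ _)
  have h1 : ∀ t, (tail (wMeasure ρ D) W t).toReal
      = (∫⁻ x, W x ∂(wMeasure ρ D)).toReal - (prim (wMeasure ρ D) W t).toReal := by
    intro t
    rw [eq_sub_iff_add_eq, ← ENNReal.toReal_add (ht t) (hp t), prim,
      setLIntegral_congr Iio_ae_eq_Iic, tail, add_comm, ← compl_Iic,
      lintegral_add_compl _ measurableSet_Iic]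
  simp_rw [h1]
  simpa using (hasDerivAt_prim hJ hJD hρm hρ hφ hρ0 hφ0 hW hp hx).const_sub
    (∫⁻ x, W x ∂(wMeasure ρ D)).toReal

/-- f is the exponential of a primitive of h based at an interior point; divergence of ∫h at 0 is
exactly what makes f vanish there. -/
theorem exists_log_primitive {D : EReal} (hD : 0 < D) {h : ℝ → ℝ} (hc : ContinuousOn h (oI D))
    (h0 : ∀ x ∈ oI D, 0 ≤ h x) (hdiv : DivergesAtZero h) :
    ∃ f : ℝ → ℝ, (∀ x, 0 < f x) ∧ (∀ x ∈ oI D, HasDerivAt f (h x * f x) x) ∧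
      Tendsto f (𝓝[>] 0) (𝓝 0) := by
  obtain ⟨x₁, hx₁⟩ := oI_nonempty hD
  have hint : ∀ {a b}, a ∈ oI D → b ∈ oI D → IntervalIntegrable h volume a b := fun ha hb =>
    (hc.mono (uIcc_subset_oI ha hb)).intervalIntegrable
  have hF : ∀ x ∈ oI D, HasDerivAt (fun x => ∫ t in x₁..x, h t) (h x) x := fun x hx =>
    intervalIntegral.integral_hasDerivAt_right (hint hx₁ hx)
      (hc.stronglyMeasurableAtFilter (isOpen_oI D) x hx)
      (hc.continuousAt ((isOpen_oI D).mem_nhds hx))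
  refine ⟨fun x => Real.exp (∫ t in x₁..x, h t), fun x => Real.exp_pos _, fun x hx => ?_, ?_⟩
  · rw [mul_comm]; exact (hF x hx).exp
  refine Real.tendsto_exp_atBot.comp (tendsto_atBot.2 fun K => ?_)
  have htop : ∫⁻ t in Ioo 0 x₁, ENNReal.ofReal (h t) = ⊤ := by
    obtain ⟨ε, hε, hεx⟩ := (hdiv.and (Ioo_mem_nhdsGT hx₁.1)).exists
    exact top_le_iff.1 (hε.symm.le.trans (lintegral_mono_set (Ioo_subset_Ioo_right hεx.2.le)))
  obtain ⟨δ, hδ, hδK⟩ : ∃ δ ∈ Ioo 0 x₁, -K < ∫ t in δ..x₁, h t := by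
    by_contra! hcon
    have h1 : Ioo 0 x₁ = ⋃ n : ℕ, Ioo (x₁ / (n + 2)) x₁ := by
      ext y
      simp only [mem_iUnion, mem_Ioo]
      refine ⟨fun hy => ?_, fun ⟨n, hn⟩ => ⟨lt_trans (div_pos hx₁.1 (by positivity)) hn.1, hn.2⟩⟩
      obtain ⟨n, hn⟩ := exists_nat_gt (x₁ / y)
      refine ⟨n, ?_, hy.2⟩
      rw [div_lt_iff₀ hy.1] at hn
      rw [div_lt_iff₀ (by positivity)]
      nlinarith [hy.1]
    rw [h1, setLIntegral_iUnion_of_directed] at htop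
    · refine ENNReal.ofReal_ne_top (r := -K) (top_le_iff.1 (htop.symm.le.trans (iSup_le fun n => ?_)))
      have hpos : 0 < x₁ / ((n : ℝ) + 2) := div_pos hx₁.1 (by positivity)
      have hlt : x₁ / ((n : ℝ) + 2) < x₁ := div_lt_self hx₁.1 (by
        have : (0 : ℝ) ≤ n := n.cast_nonneg
        linarith)
      have hs := Icc_subset_oI hpos hx₁
      rw [setLIntegral_Ioo_ofReal hlt.le (hc.mono hs) fun x hx => h0 x (hs hx)]
      exact ENNReal.ofReal_le_ofReal (hcon _ ⟨hpos, hlt⟩)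
    · refine Monotone.directed_le fun m n hmn => Ioo_subset_Ioo_left ?_
      have : (m : ℝ) ≤ n := by exact_mod_cast hmn
      have := hx₁.1
      gcongr
  have hδD : δ ∈ oI D := mem_oI_of_le hx₁ hδ.1 hδ.2.le
  filter_upwards [Ioo_mem_nhdsGT hδ.1] with x hx
  have hxD : x ∈ oI D := mem_oI_of_le hδD hx.1 hx.2.le
  have h2 : 0 ≤ ∫ t in x..δ, h t := intervalIntegral.integral_nonneg hx.2.le fun t ht =>
    h0 t (Icc_subset_oI hx.1 hδD ht)
  have h3 := intervalIntegral.integral_add_adjacent_intervals (hint hxD hδD) (hint hδD hx₁)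
  rw [intervalIntegral.integral_symm]
  linarith

/-- If h were integrable at 0, log f would stay bounded below there, against f → 0. -/
theorem divergesAtZero_of_hasDerivAt {D : EReal} (hD : 0 < D) {f h : ℝ → ℝ}
    (hc : ContinuousOn h (oI D)) (h0 : ∀ x ∈ oI D, 0 ≤ h x) (hf : ∀ x ∈ oI D, 0 < f x)
    (hd : ∀ x ∈ oI D, HasDerivAt f (h x * f x) x) (ht : Tendsto f (𝓝[>] 0) (𝓝 0)) :
    DivergesAtZero h := by
  obtain ⟨x₁, hx₁⟩ := oI_nonempty hD
  filter_upwards [Ioo_mem_nhdsGT hx₁.1] with ε hε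
  have hεD : ε ∈ oI D := mem_oI_of_le hx₁ hε.1 hε.2.le
  by_contra hM
  set M := ∫⁻ x in Ioo 0 ε, ENNReal.ofReal (h x) with hMdef
  have hlog : ∀ x ∈ oI D, HasDerivAt (fun x => Real.log (f x)) (h x) x := fun x hx => by
    have := (hd x hx).log (hf x hx).ne'
    rwa [mul_div_cancel_right₀ _ (hf x hx).ne'] at this
  have hb : ∀ δ ∈ Ioo 0 ε, Real.log (f ε) - M.toReal ≤ Real.log (f δ) := by
    intro δ hδ
    have hs := Icc_subset_oI hδ.1 hεD
    have h1 : ∫ t in δ..ε, h t = Real.log (f ε) - Real.log (f δ) := by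
      refine intervalIntegral.integral_eq_sub_of_hasDerivAt (fun x hx => hlog x ?_) ?_
      · rw [uIcc_of_le hδ.2.le] at hx; exact hs hx
      · refine ContinuousOn.intervalIntegrable (hc.mono ?_)
        rw [uIcc_of_le hδ.2.le]; exact hs
    have h2 := setLIntegral_Ioo_ofReal hδ.2.le (hc.mono hs) fun x hx => h0 x (hs hx)
    have h3 : ENNReal.ofReal (∫ t in δ..ε, h t) ≤ M :=
      h2.symm.le.trans (lintegral_mono_set (Ioo_subset_Ioo_left hδ.1.le))
    rw [ENNReal.ofReal_le_iff_le_toReal hM, h1] at h3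
    linarith
  have h4 : Tendsto (fun x => Real.log (f x)) (𝓝[>] 0) atBot := by
    refine Real.tendsto_log_nhdsGT_zero.comp (tendsto_nhdsWithin_iff.2 ⟨ht, ?_⟩)
    filter_upwards [Ioo_mem_nhdsGT hε.1] with x hx using hf x (mem_oI_of_le hεD hx.1 hx.2.le)
  obtain ⟨δ, hδ, hδε⟩ := ((h4.eventually_lt_atBot (Real.log (f ε) - M.toReal)).and
    (Ioo_mem_nhdsGT hε.1)).exists
  exact absurd (hb δ hδε) (not_le.2 hδ)

theorem ofReal_flux {p v h f : ℝ} (hp : 1 < p) (hv : 0 < v) (hh : 0 ≤ h) (hf : 0 < f) :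
    ENNReal.ofReal (v ^ (Real.conjExponent p - 1) * (h * f)) ^ (p - 1)
      = ENNReal.ofReal (v * h ^ (p - 1) * f ^ (p - 1)) := by
  have hvq := (Real.rpow_pos_of_pos hv (Real.conjExponent p - 1)).le
  rw [ENNReal.ofReal_rpow_of_nonneg (by positivity) (by linarith),
    Real.mul_rpow hvq (by positivity), Real.mul_rpow hh hf.le, ← Real.rpow_mul hv.le,
    conj_sub_one_mul hp, Real.rpow_one, mul_assoc]

/-! ### Differential form: bounds from admissible h. -/

namespace Weights

variable {p : ℝ} {D : EReal} {u v : ℝ → ℝ}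

theorem ofReal_eq_prim_of_hasDerivAt (H : Weights p D u v) {f h : ℝ → ℝ}
    (hvpos : ∀ x ∈ oI D, 0 < v x) (hc : ContinuousOn h (oI D)) (h0 : ∀ x ∈ oI D, 0 ≤ h x)
    (hf : ∀ x, 0 < f x) (hd : ∀ x ∈ oI D, HasDerivAt f (h x * f x) x)
    (ht : Tendsto f (𝓝[>] 0) (𝓝 0)) {x : ℝ} (hx : x ∈ oI D) :
    ENNReal.ofReal (f x) = prim (wMeasure (vhat p v) D)
      (fun s => ENNReal.ofReal (v s ^ (Real.conjExponent p - 1) * (h s * f s))) x := by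
  have hfc : ContinuousOn f (oI D) := fun x hx => (hd x hx).continuousAt.continuousWithinAt
  have hC := contDiffOn_one_of_hasDerivAt (isOpen_oI D) hd (hc.mul hfc)
  refine (H.ofReal_eq_prim Subset.rfl (fun x hx => Ioc_subset_oI hx) ht (fun a ha b hb =>
    (hC.mono (uIcc_subset_oI ha hb)).absolutelyContinuousOnInterval) ?_ (fun y hy => ?_) hx).2
  · filter_upwards [ae_restrict_mem (measurableSet_oI D)] with y hy
    rw [(hd y hy).deriv]
  · exact mul_nonneg (Real.rpow_nonneg (hvpos y hy).le _) (mul_nonneg (h0 y hy) (hf y).le)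

/-- R(h) ≥ c bounds the decrease of the flux from below, and integration makes f = exp ∫h a
supersolution with constant c. -/
theorem iInf_opR_le_lam (H : Weights p D u v) (hupos : ∀ x ∈ oI D, 0 < u x)
    (hvpos : ∀ x ∈ oI D, 0 < v x) (huc : ContinuousOn u (oI D)) (hv1 : ContDiffOn ℝ 1 v (oI D))
    {h : ℝ → ℝ} (hh : HClass D h) :
    ⨅ x ∈ oI D, (opR p u v h x : EReal) ≤ (lam p u v D : EReal) := by
  have hp := H.one_lt
  have hp1 : 0 < p - 1 := by linarith
  by_contra! hlt
  obtain ⟨c, hc1, hc2⟩ := EReal.lt_iff_exists_real_btwn.1 hlt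
  have hcR : ∀ x ∈ oI D, c ≤ opR p u v h x := fun x hx => by
    exact_mod_cast (hc2.trans_le (iInf₂_le x hx)).le
  have hc0 : 0 < c := by exact_mod_cast (EReal.coe_ennreal_nonneg _).trans_lt hc1
  suffices hs : ENNReal.ofReal c ≤ lam p u v D by
    refine absurd hc1 (not_lt.2 ?_)
    refine le_trans ?_ (EReal.coe_ennreal_le_coe_ennreal_iff.2 hs)
    rw [EReal.coe_ennreal_ofReal]
    exact_mod_cast le_max_left c 0
  have hhc := hh.smooth.continuousOn
  have hh0 : ∀ x ∈ oI D, 0 ≤ h x := fun x hx => (hh.pos x hx).le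
  obtain ⟨f, hf, hd, ht⟩ := exists_log_primitive H.pos hhc hh0 hh.div
  have hfc : ContinuousOn f (oI D) := fun x hx => (hd x hx).continuousAt.continuousWithinAt
  have hfp : ContinuousOn (fun x => f x ^ (p - 1)) (oI D) :=
    hfc.rpow_const fun x _ => Or.inl (hf x).ne'
  set w : ℝ → ℝ := fun s => v s ^ (Real.conjExponent p - 1) * (h s * f s) with hw
  have hwc : ContinuousOn w (oI D) :=
    (hv1.continuousOn.rpow_const fun x hx => Or.inl (hvpos x hx).ne').mul (hhc.mul hfc)
  have hprim := fun x hx => H.ofReal_eq_prim_of_hasDerivAt hvpos hhc hh0 hf hd ht (x := x) hx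
  have hflux : ∀ a ∈ oI D, ∀ b ∈ oI D, a < b →
      c * ∫ t in a..b, u t * f t ^ (p - 1) ≤ v a * h a ^ (p - 1) * f a ^ (p - 1) := by
    intro a ha b hb hab
    have hsub := Icc_subset_oI ha.1 hb
    have hder : ∀ x ∈ oI D, _ := fun x hx => hasDerivAt_flux (p := p) (u := u)
      (hupos x hx).ne' (hh.pos x hx) (hf x) ((hv1.differentiableOn one_ne_zero).differentiableAt
        ((isOpen_oI D).mem_nhds hx)) ((hh.smooth.differentiableOn one_ne_zero).differentiableAt
        ((isOpen_oI D).mem_nhds hx)) (hd x hx)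
    have h1 := intervalIntegral.sub_le_integral_of_hasDeriv_right_of_le hab.le
      (fun x hx => (hder x (hsub hx)).continuousAt.continuousWithinAt)
      (fun x hx => (hder x (hsub (Ioo_subset_Icc_self hx))).hasDerivWithinAt)
      (φ := fun t => -(c * (u t * f t ^ (p - 1))))
      ((((huc.mono hsub).mul (hfp.mono hsub)).const_mul c).neg.integrableOn_Icc)
      (fun x hx => by
        have hxD := hsub (Ioo_subset_Icc_self hx)
        refine neg_le_neg (mul_le_mul_of_nonneg_right (hcR x hxD) ?_)
        exact mul_nonneg (hupos x hxD).le (Real.rpow_nonneg (hf x).le _))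
    rw [intervalIntegral.integral_neg, intervalIntegral.integral_const_mul] at h1
    -- The flux at the right end is simply dropped, so no boundary condition at D is needed.
    have h2 : 0 ≤ v b * h b ^ (p - 1) * f b ^ (p - 1) :=
      mul_nonneg (mul_nonneg (hvpos b hb).le (Real.rpow_nonneg (hh0 b hb) _))
        (Real.rpow_nonneg (hf b).le _)
    linarith
  refine H.le_lam_of_hardy fun G hG => hardy_of_supersolution hp
    (W := fun s => ENNReal.ofReal (w s)) (F := fun x => ENNReal.ofReal (f x))
    (aemeasurable_of_continuousOn hwc).ennreal_ofReal
    (aemeasurable_of_continuousOn hfc).ennreal_ofReal hG ?_ ?_ ?_ ?_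
  · filter_upwards [ae_mem_oI] with s hs
    have : 0 < w s := mul_pos (Real.rpow_pos_of_pos (hvpos s hs) _) (mul_pos (hh.pos s hs) (hf s))
    simpa using this
  · exact Eventually.of_forall fun s => ENNReal.ofReal_ne_top
  · filter_upwards [ae_mem_oI] with x hx using (hprim x hx).symm.le
  · filter_upwards [ae_mem_oI] with s hs
    rw [hw, ofReal_flux hp (hvpos s hs) (hh0 s hs) (hf s), mul_comm,
      ← ENNReal.le_div_iff_mul_le (Or.inl (by simpa using hc0)) (Or.inl ENNReal.ofReal_ne_top)]
    refine tail_le_of_forall_Ioo H.pos fun b hb => ?_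
    rcases le_or_gt b s with hbs | hsb
    · rw [Ioo_eq_empty (not_lt.2 hbs)]; simp
    have hsub := Icc_subset_oI hs.1 hb
    simp_rw [ENNReal.ofReal_rpow_of_nonneg (hf _).le hp1.le]
    rw [setLIntegral_Ioo_wMeasure hsb.le (Ioo_subset_Icc_self.trans hsub) H.aemeasurable_u
      (huc.mono hsub) (hfp.mono hsub) (fun x hx => (hupos x (hsub hx)).le)
      (fun x _ => Real.rpow_nonneg (hf x).le _), ENNReal.le_div_iff_mul_le
      (Or.inl (by simpa using hc0)) (Or.inl ENNReal.ofReal_ne_top), mul_comm,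
      ← ENNReal.ofReal_mul hc0.le]
    exact ENNReal.ofReal_le_ofReal (hflux s hs b hb hsb)

/-- On (0, x₀) the bound R(h) ≤ c integrates to a subsolution; f is constant after x₀, hence
bounded, so its mass is finite. -/
theorem lam_le_iSup_opR_of_Ht (H : Weights p D u v) (hupos : ∀ x ∈ oI D, 0 < u x)
    (hvpos : ∀ x ∈ oI D, 0 < v x) (huc : ContinuousOn u (oI D)) (hv1 : ContDiffOn ℝ 1 v (oI D))
    {h : ℝ → ℝ} (hh : Ht p v D h) :
    (lam p u v D : EReal) ≤ ⨆ x ∈ oI D, (opR p u v h x : EReal) := by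
  have hp := H.one_lt
  have hp0 : 0 < p := by linarith
  have hp1 : 0 < p - 1 := by linarith
  have hfinμ := H.isFiniteMeasure
  obtain ⟨x₀, hh⟩ := hh
  have hx₀ := hh.mem
  by_contra! hlt
  obtain ⟨c, hc1, hc2⟩ := EReal.lt_iff_exists_real_btwn.1 hlt
  have hcR : ∀ x ∈ oI D, opR p u v h x ≤ c := fun x hx => by
    exact_mod_cast ((le_iSup₂ (f := fun x (_ : x ∈ oI D) => (opR p u v h x : EReal)) x hx).trans_lt
      hc1).le
  have hvan : ∀ x ∈ oI D, x₀ ≤ x → h x = 0 := fun x hx => hh.vanish x (oI_subset_cI D hx)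
  -- The supremum includes x₀, where R(h) = 0.
  have hc0 : 0 ≤ c := by
    obtain ⟨y, hy, hxy⟩ := exists_gt_mem_oI hx₀
    have := hcR x₀ hx₀
    rwa [opR_eq_zero_of_forall_ge hxy fun t ht => hvan t
      (mem_oI_of_le hy (hx₀.1.trans_le ht.1) ht.2.le) ht.1] at this
  suffices hs : lam p u v D ≤ ENNReal.ofReal c by
    refine absurd hc2 (not_lt.2 ?_)
    refine (EReal.coe_ennreal_le_coe_ennreal_iff.2 hs).trans ?_
    rw [EReal.coe_ennreal_ofReal]
    simp [hc0]
  have hhc : ContinuousOn h (oI D) := by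
    have h1 : ContinuousOn (fun x => h (min x x₀)) (oI D) :=
      hh.cont.comp (continuous_id.min continuous_const).continuousOn fun x hx =>
        ⟨lt_min hx.1 hx₀.1, min_le_right _ _⟩
    refine h1.congr fun x hx => ?_
    beta_reduce
    rcases le_total x x₀ with h2 | h2
    · rw [min_eq_left h2]
    · rw [min_eq_right h2, hvan x hx h2, hvan x₀ hx₀ le_rfl]
  have hh0 : ∀ x ∈ oI D, 0 ≤ h x := fun x hx => by
    rcases lt_or_ge x x₀ with h2 | h2
    · exact (hh.pos x ⟨hx.1, h2⟩).le
    · exact (hvan x hx h2).ge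
  obtain ⟨f, hf, hd, ht⟩ := exists_log_primitive H.pos hhc hh0 hh.div
  have hfc : ContinuousOn f (oI D) := fun x hx => (hd x hx).continuousAt.continuousWithinAt
  have hfp : ContinuousOn (fun x => f x ^ (p - 1)) (oI D) :=
    hfc.rpow_const fun x _ => Or.inl (hf x).ne'
  set w : ℝ → ℝ := fun s => v s ^ (Real.conjExponent p - 1) * (h s * f s) with hw
  have hwc : ContinuousOn w (oI D) :=
    (hv1.continuousOn.rpow_const fun x hx => Or.inl (hvpos x hx).ne').mul (hhc.mul hfc)
  have hprim := fun x hx => H.ofReal_eq_prim_of_hasDerivAt hvpos hhc hh0 hf hd ht (x := x) hx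
  have hyc : ContinuousOn (fun t => v t * h t ^ (p - 1) * f t ^ (p - 1)) (oI D) :=
    (hv1.continuousOn.mul (hhc.rpow_const fun x _ => Or.inr hp1.le)).mul hfp
  have hsubJ : Ioo 0 x₀ ⊆ oI D := fun x hx => mem_oI_of_le hx₀ hx.1 hx.2.le
  have hflux : ∀ a ∈ Ioo 0 x₀, v a * h a ^ (p - 1) * f a ^ (p - 1)
      ≤ c * ∫ t in a..x₀, u t * f t ^ (p - 1) := by
    intro a ha
    have hsub := Icc_subset_oI ha.1 hx₀
    have hder : ∀ x ∈ Ioo 0 x₀, _ := fun x hx => hasDerivAt_flux (p := p) (u := u)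
      (hupos x (hsubJ hx)).ne' (hh.pos x hx) (hf x)
      ((hv1.differentiableOn one_ne_zero).differentiableAt
        ((isOpen_oI D).mem_nhds (hsubJ hx))) ((hh.smooth.differentiableOn one_ne_zero).differentiableAt
        (isOpen_Ioo.mem_nhds hx)) (hd x (hsubJ hx))
    have h1 := intervalIntegral.integral_le_sub_of_hasDeriv_right_of_le ha.2.le
      (hyc.mono hsub)
      (fun x hx => (hder x ⟨ha.1.trans hx.1, hx.2⟩).hasDerivWithinAt)
      (φ := fun t => -(c * (u t * f t ^ (p - 1))))
      ((((huc.mono hsub).mul (hfp.mono hsub)).const_mul c).neg.integrableOn_Icc)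
      (fun x hx => by
        have hxD := hsub (Ioo_subset_Icc_self hx)
        refine neg_le_neg (mul_le_mul_of_nonneg_right (hcR x hxD) ?_)
        exact mul_nonneg (hupos x hxD).le (Real.rpow_nonneg (hf x).le _))
    -- The boundary term at x₀ disappears because h x₀ = 0 and p - 1 > 0.
    rw [intervalIntegral.integral_neg, intervalIntegral.integral_const_mul, hvan x₀ hx₀ le_rfl,
      Real.zero_rpow hp1.ne'] at h1
    linarith
  set V := wMeasure (vhat p v) D with hV
  set μ := wMeasure u D with hμ
  set W : ℝ → ℝ≥0∞ := fun s => ENNReal.ofReal (w s) with hWdef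
  have hWm : AEMeasurable W V := (aemeasurable_of_continuousOn hwc).ennreal_ofReal
  have hW0 : ∀ s ∈ oI D, x₀ ≤ s → W s = 0 := fun s hs hxs => by
    simp [hWdef, hw, hvan s hs hxs]
  have hprimx : ∀ x ∈ oI D, prim V W x ≤ ENNReal.ofReal (f x₀) := by
    intro x hx
    rw [hprim x₀ hx₀]
    rcases le_total x x₀ with h2 | h2
    · exact prim_mono_right _ _ h2
    · rw [prim_add_Ico _ _ h2]
      have : ∫⁻ s in Ico x₀ x, W s ∂V = 0 := by
        rw [setLIntegral_congr_fun measurableSet_Ico (g := fun _ => 0)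
          fun s hs => hW0 s (mem_oI_of_le hx (hx₀.1.trans_le hs.1) hs.2.le) hs.1]
        simp
      rw [this, add_zero]
  refine H.hardy_lam.le_of_subsolution hp (φ := fun x => ENNReal.ofReal c * prim V W x ^ (p - 1))
    (((measurable_prim _ _).pow_const _).const_mul _).aemeasurable hWm ?_
    (Eventually.of_forall fun x => le_rfl) ?_ ?_
  · filter_upwards [ae_mem_oI] with s hs
    rcases lt_or_ge s x₀ with hsx | hsx
    · have hsub := Icc_subset_oI hs.1 hx₀
      calc W s ^ (p - 1) = ENNReal.ofReal (v s * h s ^ (p - 1) * f s ^ (p - 1)) :=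
            ofReal_flux hp (hvpos s hs) (hh0 s hs) (hf s)
        _ ≤ ENNReal.ofReal (c * ∫ t in s..x₀, u t * f t ^ (p - 1)) :=
            ENNReal.ofReal_le_ofReal (hflux s ⟨hs.1, hsx⟩)
        _ = ENNReal.ofReal c * ∫⁻ t in Ioo s x₀, ENNReal.ofReal (f t ^ (p - 1)) ∂μ := by
            rw [ENNReal.ofReal_mul hc0, setLIntegral_Ioo_wMeasure hsx.le
              (Ioo_subset_Icc_self.trans hsub) H.aemeasurable_u
              (huc.mono hsub) (hfp.mono hsub) (fun x hx => (hupos x (hsub hx)).le)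
              (fun x _ => Real.rpow_nonneg (hf x).le _)]
        _ = ∫⁻ t in Ioo s x₀, ENNReal.ofReal c * prim V W t ^ (p - 1) ∂μ := by
            rw [← lintegral_const_mul' _ _ ENNReal.ofReal_ne_top]
            refine setLIntegral_congr_fun measurableSet_Ioo fun t ht => ?_
            rw [← hprim t (hsub (Ioo_subset_Icc_self ht)),
              ENNReal.ofReal_rpow_of_nonneg (hf t).le hp1.le]
        _ ≤ _ := lintegral_mono_set Ioo_subset_Ioi_self
    · rw [hW0 s hs hsx, ENNReal.zero_rpow_of_pos hp1]
      exact zero_le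
  · refine H.lintegral_ne_zero_of_pos ((measurable_prim _ _).pow_const _).aemeasurable
      fun x hx h1 => ?_
    rw [ENNReal.rpow_eq_zero_iff_of_pos hp0, ← hprim x hx] at h1
    exact absurd h1 (by simpa using hf x)
  · refine ne_top_of_le_ne_top (b := ∫⁻ _, ENNReal.ofReal (f x₀) ^ p ∂μ) ?_ (lintegral_mono_ae ?_)
    · rw [lintegral_const]
      exact ENNReal.mul_ne_top (ENNReal.rpow_ne_top_of_nonneg hp0.le ENNReal.ofReal_ne_top)
        (measure_ne_top _ _)
    · filter_upwards [ae_mem_oI] with x hx using ENNReal.rpow_le_rpow (hprimx x hx) hp0.le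

end Weights

/-! ### Differential form: nearly optimal h. -/

theorem hasDerivAt_max_sq (t : ℝ) : HasDerivAt (fun t : ℝ => max t 0 ^ 2) (2 * max t 0) t := by
  rcases lt_trichotomy t 0 with h | rfl | h
  · rw [max_eq_right h.le, mul_zero]
    refine (hasDerivAt_const t (0 : ℝ)).congr_of_eventuallyEq ?_
    filter_upwards [Iio_mem_nhds h] with s hs
    simp [max_eq_right (mem_Iio.1 hs).le]
  · rw [max_self, mul_zero, hasDerivAt_iff_isLittleO_nhds_zero]
    have h1 : (fun h : ℝ => h ^ 2) =o[𝓝 0] fun h : ℝ => h := by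
      simpa using Asymptotics.isLittleO_pow_id (𝕜 := ℝ) one_lt_two
    refine Asymptotics.IsBigO.trans_isLittleO (.of_bound 1 (Eventually.of_forall fun s => ?_)) h1
    simp only [zero_add, max_self, smul_eq_mul, mul_zero, sub_zero, norm_pow, one_mul,
      Real.norm_eq_abs, ne_eq, OfNat.ofNat_ne_zero, not_false_eq_true, zero_pow]
    refine pow_le_pow_left₀ (abs_nonneg _) ?_ 2
    rw [abs_of_nonneg (le_max_right s 0)]
    exact max_le (le_abs_self s) (abs_nonneg s)
  · rw [max_eq_left h.le]
    have h1 : HasDerivAt (fun s : ℝ => s ^ 2) (2 * t) t := by simpa using hasDerivAt_pow 2 t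
    refine h1.congr_of_eventuallyEq ?_
    filter_upwards [Ioi_mem_nhds h] with s hs
    rw [max_eq_left (mem_Ioi.1 hs).le]

namespace Weights

variable {p : ℝ} {D : EReal} {u v : ℝ → ℝ}

theorem continuousOn_logDeriv (hvpos : ∀ x ∈ ocI D, 0 < v x) (hvc : ContinuousOn v (ocI D))
    {f w : ℝ → ℝ} (hw : Continuous w) (hfc : Continuous f) (hf : ∀ x > 0, 0 < f x) :
    ContinuousOn (fun x => vhat p v x * w x / f x) (ocI D) :=
  ((hvc.rpow_const fun x hx => Or.inl (hvpos x hx).ne').mul hw.continuousOn).div hfc.continuousOn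
    fun x hx => (hf x hx.1).ne'

/-- For h = v̂ w / f the flux v h^(p-1) f^(p-1) is w^(p-1), because v = v̂^(1-p). Comparing its
derivative with the general flux formula identifies R(h). -/
theorem opR_logDeriv (hp : 1 < p) {J : Set ℝ} (hJ : IsOpen J) (hJD : J ⊆ oI D)
    (hupos : ∀ x ∈ oI D, 0 < u x) (hvpos : ∀ x ∈ oI D, 0 < v x) (hv1 : ContDiffOn ℝ 1 v (oI D))
    {f w y' : ℝ → ℝ} (hf : ∀ x ∈ J, 0 < f x)
    (hd : ∀ x ∈ J, HasDerivAt f (vhat p v x * w x) x) (hw : ∀ x ∈ J, 0 < w x)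
    (hy : ∀ x ∈ J, HasDerivAt (fun t => w t ^ (p - 1)) (y' x) x) (hyc : ContinuousOn y' J) :
    ContDiffOn ℝ 1 (fun x => vhat p v x * w x / f x) J ∧
    ∀ x ∈ J, opR p u v (fun x => vhat p v x * w x / f x) x * (u x * f x ^ (p - 1)) = -y' x := by
  have hvh : ContDiffOn ℝ 1 (vhat p v) J :=
    (hv1.mono hJD).rpow_const_of_ne fun x hx => (hvpos x (hJD hx)).ne'
  have hw1 : ContDiffOn ℝ 1 w J := by
    refine ((contDiffOn_one_of_hasDerivAt hJ hy hyc).rpow_const_of_ne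
      (p := Real.conjExponent p - 1) fun x hx => ?_).congr fun x hx => ?_
    · exact (Real.rpow_pos_of_pos (hw x hx) _).ne'
    · rw [← Real.rpow_mul (hw x hx).le, mul_comm, conj_sub_one_mul hp, Real.rpow_one]
  have hf1 : ContDiffOn ℝ 1 f J :=
    contDiffOn_one_of_hasDerivAt hJ hd (hvh.continuousOn.mul hw1.continuousOn)
  have hh : ContDiffOn ℝ 1 (fun x => vhat p v x * w x / f x) J :=
    (hvh.mul hw1).div hf1 fun x hx => (hf x hx).ne'
  refine ⟨hh, fun x hx => ?_⟩
  have hvx := vhat_pos (p := p) (hvpos x (hJD hx))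
  have h1 := hasDerivAt_flux (p := p) (u := u) (v := v) (h := fun x => vhat p v x * w x / f x)
    (hupos x (hJD hx)).ne'
    (div_pos (mul_pos hvx (hw x hx)) (hf x hx)) (hf x hx)
    ((hv1.differentiableOn one_ne_zero).differentiableAt ((isOpen_oI D).mem_nhds (hJD hx)))
    ((hh.differentiableOn one_ne_zero).differentiableAt (hJ.mem_nhds hx))
    (by rw [div_mul_cancel₀ _ (hf x hx).ne']; exact hd x hx)
  have h2 : (fun t => v t * (vhat p v t * w t / f t) ^ (p - 1) * f t ^ (p - 1))
      =ᶠ[𝓝 x] fun t => w t ^ (p - 1) := by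
    filter_upwards [hJ.mem_nhds hx] with t ht
    have hvt := vhat_pos (p := p) (hvpos t (hJD ht))
    rw [mul_assoc, ← Real.mul_rpow (div_pos (mul_pos hvt (hw t ht)) (hf t ht)).le (hf t ht).le,
      div_mul_cancel₀ _ (hf t ht).ne', Real.mul_rpow hvt.le (hw t ht).le, ← mul_assoc]
    conv_lhs => rw [← vhat_rpow hp (hvpos t (hJD ht)), ← Real.rpow_add hvt]
    simp
  have h3 := (h1.congr_of_eventuallyEq h2.symm).unique (hy x hx)
  linarith

theorem exists_HClass (H : Weights p D u v) (hupos : ∀ x ∈ oI D, 0 < u x)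
    (hvpos : ∀ x ∈ ocI D, 0 < v x) (huc : ContinuousOn u (oI D)) (hv1 : ContDiffOn ℝ 1 v (oI D))
    (hvc : ContinuousOn v (ocI D)) {c : ℝ} (hc : (c : EReal) < (lam p u v D : EReal)) :
    ∃ h, HClass D h ∧ ∀ x ∈ oI D, c ≤ opR p u v h x := by
  have hp := H.one_lt
  have hp1 : 0 < p - 1 := by linarith
  have hvpos' : ∀ x ∈ oI D, 0 < v x := fun x hx => hvpos x ⟨hx.1, hx.2.le⟩
  have hvhc : ContinuousOn (vhat p v) (oI D) :=
    hv1.continuousOn.rpow_const fun x hx => Or.inl (hvpos' x hx).ne'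
  set V := wMeasure (vhat p v) D with hV
  set μ := wMeasure u D with hμ
  suffices hs : ∃ w y' : ℝ → ℝ, Continuous w ∧ (∀ x ∈ oI D, 0 < w x) ∧ (∀ x, 0 ≤ w x) ∧
      (∀ x, prim V (fun s => ENNReal.ofReal (w s)) x ≠ ⊤) ∧
      (∀ x ∈ oI D, HasDerivAt (fun t => w t ^ (p - 1)) (y' x) x) ∧ ContinuousOn y' (oI D) ∧
      ∀ x ∈ oI D, c * (u x * (prim V (fun s => ENNReal.ofReal (w s)) x).toReal ^ (p - 1))
        ≤ -y' x by
    obtain ⟨w, y', hwc, hwpos, hw0, hfin, hy, hyc, hle⟩ := hs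
    set f : ℝ → ℝ := fun x => (prim V (fun s => ENNReal.ofReal (w s)) x).toReal with hf
    have hfc : Continuous f :=
      ENNReal.continuousOn_toReal.comp_continuous (continuous_prim hfin) hfin
    obtain ⟨x₁, hx₁⟩ := oI_nonempty H.pos
    have hfpos : ∀ x > 0, 0 < f x := fun x hx => ENNReal.toReal_pos
      (H.prim_ne_zero hwc.measurable.ennreal_ofReal.aemeasurable hx hx₁.1 fun s hs _ => by
        simpa using hwpos s hs) (hfin x)
    have hd : ∀ x ∈ oI D, HasDerivAt f (vhat p v x * w x) x := fun x hx =>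
      hasDerivAt_prim (isOpen_oI D) Subset.rfl H.aemeasurable_vhat hvhc hwc.continuousOn
        (fun x hx => (vhat_pos (hvpos' x hx)).le) (fun x _ => hw0 x) (fun _ _ => rfl) hfin hx
    obtain ⟨h1, h2⟩ := opR_logDeriv (u := u) hp (isOpen_oI D) Subset.rfl hupos hvpos' hv1
      (fun x hx => hfpos x hx.1) hd hwpos hy hyc
    have hpos : ∀ x ∈ oI D, 0 < vhat p v x * w x / f x := fun x hx =>
      div_pos (mul_pos (vhat_pos (hvpos' x hx)) (hwpos x hx)) (hfpos x hx.1)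
    refine ⟨_, ⟨h1, continuousOn_logDeriv hvpos hvc hwc hfc hfpos, hpos,
      divergesAtZero_of_hasDerivAt H.pos h1.continuousOn (fun x hx => (hpos x hx).le)
        (fun x hx => hfpos x hx.1) (fun x hx => ?_) ?_⟩, fun x hx => ?_⟩
    · rw [div_mul_cancel₀ _ (hfpos x hx.1).ne']; exact hd x hx
    · have h3 : f 0 = 0 := by simp [hf, hV, prim_zero wMeasure_Iio_zero]
      simpa only [h3] using (hfc.tendsto 0).mono_left (nhdsWithin_le_nhds (s := Ioi 0))
    · refine le_of_mul_le_mul_right ((hle x hx).trans_eq (h2 x hx).symm) ?_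
      exact mul_pos (hupos x hx) (Real.rpow_pos_of_pos (hfpos x hx.1) _)
  -- For c ≤ 0 a constant flux suffices: it gives R(h) = 0.
  rcases le_or_gt c 0 with hc0 | hc0
  · refine ⟨fun _ => 1, fun _ => 0, continuous_const, fun _ _ => one_pos, fun _ => zero_le_one,
      fun x => ?_, fun x _ => hasDerivAt_const _ _, continuousOn_const, fun x hx => ?_⟩
    · simpa [prim] using (H.V_lt_top x).ne
    · rw [neg_zero]
      exact mul_nonpos_of_nonpos_of_nonneg hc0
        (mul_nonneg (hupos x hx).le (Real.rpow_nonneg ENNReal.toReal_nonneg _))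
  have hcl : ENNReal.ofReal c < lam p u v D := by
    rw [← EReal.coe_ennreal_lt_coe_ennreal_iff, EReal.coe_ennreal_ofReal, max_eq_left hc0.le]
    exact hc
  obtain ⟨b, hb⟩ := oI_nonempty H.pos
  -- The source is squared so that it, and with it the flux, is C¹ across b; being decreasing, it
  -- adds a nonnegative term to R(h).
  obtain ⟨W, hWc, hWt, hW0, hWp, hint, hWeq⟩ := H.exists_supersolution
    (η := fun x => max (b - x) 0 ^ 2) (by simpa using hc0) hcl (by fun_prop) hb
    (fun x hx => by
      have : 0 < max (b - x) 0 := lt_max_of_lt_left (by linarith)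
      positivity) (fun x hx => by simp [max_eq_right (sub_nonpos.2 hx)])
  have hWof : (fun s => ENNReal.ofReal (W s).toReal) = W :=
    funext fun s => ENNReal.ofReal_toReal (hWt s)
  have htail : ∀ s, tail μ (fun t => prim V W t ^ (p - 1)) s ≠ ⊤ := fun s =>
    ne_top_of_le_ne_top hint (setLIntegral_le_lintegral _ _)
  have hfc : Continuous fun x => (prim V W x).toReal :=
    ENNReal.continuousOn_toReal.comp_continuous (continuous_prim hWp) hWp
  have hfp : Continuous fun x => (prim V W x).toReal ^ (p - 1) :=
    hfc.rpow_const fun x => Or.inr hp1.le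
  refine ⟨fun s => (W s).toReal, fun x => -(2 * max (b - x) 0)
      - c * (u x * (prim V W x).toReal ^ (p - 1)),
    ENNReal.continuousOn_toReal.comp_continuous hWc hWt,
    fun x hx => ENNReal.toReal_pos (hW0 x hx) (hWt x), fun _ => ENNReal.toReal_nonneg,
    by rw [hWof]; exact hWp, fun x hx => ?_, ?_, fun x hx => ?_⟩
  · have h1 : (fun t => (W t).toReal ^ (p - 1)) = fun t => max (b - t) 0 ^ 2
        + c * (tail μ (fun t => prim V W t ^ (p - 1)) t).toReal := by
      funext t
      rw [ENNReal.toReal_rpow, hWeq, ENNReal.toReal_add ENNReal.ofReal_ne_top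
        (ENNReal.mul_ne_top ENNReal.ofReal_ne_top (htail t)), ENNReal.toReal_mul,
        ENNReal.toReal_ofReal (by positivity), ENNReal.toReal_ofReal hc0.le]
    rw [h1]
    have h2 : HasDerivAt (fun t => max (b - t) 0 ^ 2) (-(2 * max (b - x) 0)) x := by
      exact ((hasDerivAt_max_sq (b - x)).comp x ((hasDerivAt_id x).const_sub b)).congr_deriv
        (by ring)
    have h3 := hasDerivAt_tail (isOpen_oI D) Subset.rfl H.aemeasurable_u huc
      hfp.continuousOn (fun x hx => (hupos x hx).le)
      (fun x _ => Real.rpow_nonneg ENNReal.toReal_nonneg _) (fun t _ => by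
        rw [← ENNReal.ofReal_rpow_of_nonneg ENNReal.toReal_nonneg hp1.le,
          ENNReal.ofReal_toReal (hWp t)]) hint hx
    exact (h2.add (h3.const_mul c)).congr_deriv (by ring)
  · exact (by fun_prop : Continuous fun x => -(2 * max (b - x) 0)).continuousOn.sub
      ((huc.mul hfp.continuousOn).const_mul c)
  · rw [hWof]
    have := le_max_right (b - x) 0
    linarith

/-- The shooting solution satisfies only an inequality, so one iteration replaces W by w with
w^(p-1) = c ∫_x^(x₀) f^(p-1) dμ, f = prim W. Then w ≥ W, F = prim w ≥ f before x₀, and R(h) = c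
(f/F)^(p-1) ≤ c. A bound F ≤ k f gives the uniform lower bound. -/
theorem exists_HtUnif (H : Weights p D u v) (hupos : ∀ x ∈ oI D, 0 < u x)
    (hvpos : ∀ x ∈ ocI D, 0 < v x) (huc : ContinuousOn u (oI D)) (hv1 : ContDiffOn ℝ 1 v (oI D))
    (hvc : ContinuousOn v (ocI D)) {c : ℝ} (hc : (lam p u v D : EReal) < (c : EReal)) :
    ∃ h, HtUnif p u v D h ∧ ∀ x ∈ oI D, opR p u v h x ≤ c := by
  have hp := H.one_lt
  have hp1 : 0 < p - 1 := by linarith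
  have hq1 := conj_sub_one_pos hp
  have hfinμ := H.isFiniteMeasure
  have hvpos' : ∀ x ∈ oI D, 0 < v x := fun x hx => hvpos x ⟨hx.1, hx.2.le⟩
  have hvhc : ContinuousOn (vhat p v) (oI D) :=
    hv1.continuousOn.rpow_const fun x hx => Or.inl (hvpos' x hx).ne'
  have hc0 : 0 < c := by exact_mod_cast (EReal.coe_ennreal_nonneg _).trans_lt hc
  have hcl : lam p u v D < ENNReal.ofReal c := by
    rw [← EReal.coe_ennreal_lt_coe_ennreal_iff, EReal.coe_ennreal_ofReal, max_eq_left hc0.le]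
    exact hc
  obtain ⟨x₀, hx₀, W, hWc, hWanti, hW1, hW0, hWle⟩ :=
    H.exists_stopped_subsolution hcl ENNReal.ofReal_ne_top
  set V := wMeasure (vhat p v) D with hV
  set μ := wMeasure u D with hμ
  have hWt : ∀ s, W s ≠ ⊤ := fun s => ne_top_of_le_ne_top ENNReal.one_ne_top (hW1 s)
  have hfin : ∀ x, prim V W x ≠ ⊤ := H.prim_ne_top_of_le_one hW1
  have hfc : Continuous fun x => (prim V W x).toReal :=
    ENNReal.continuousOn_toReal.comp_continuous (continuous_prim hfin) hfin
  have hfp : Continuous fun x => (prim V W x).toReal ^ (p - 1) :=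
    hfc.rpow_const fun x => Or.inr hp1.le
  have hfpos : ∀ x > 0, 0 < (prim V W x).toReal := fun x hx => ENNReal.toReal_pos
    (H.prim_ne_zero hWc.measurable.aemeasurable hx hx₀.1 fun s _ hs => hW0 s hs) (hfin x)
  set Φ : ℝ → ℝ≥0∞ := (Iio x₀).indicator fun t => prim V W t ^ (p - 1) with hΦ
  have hΦint : ∫⁻ t, Φ t ∂μ ≠ ⊤ := by
    refine ne_top_of_le_ne_top (b := ∫⁻ _, prim V W x₀ ^ (p - 1) ∂μ) ?_ (lintegral_mono fun t => ?_)
    · rw [lintegral_const]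
      exact ENNReal.mul_ne_top (ENNReal.rpow_ne_top_of_nonneg hp1.le (hfin x₀)) (measure_ne_top _ _)
    · refine indicator_le' (f := fun t => prim V W t ^ (p - 1))
        (g := fun _ => prim V W x₀ ^ (p - 1)) (fun t ht => ?_) (fun _ _ => zero_le) t
      exact ENNReal.rpow_le_rpow (prim_mono_right _ _ (mem_Iio.1 ht).le) hp1.le
  have htail : ∀ s, tail μ Φ s = ∫⁻ t in Ioo s x₀, prim V W t ^ (p - 1) ∂μ := fun s => by
    rw [tail, hΦ, setLIntegral_indicator measurableSet_Iio, inter_comm, Ioi_inter_Iio]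
  have htop : ∀ s, tail μ Φ s ≠ ⊤ := fun s =>
    ne_top_of_le_ne_top hΦint (setLIntegral_le_lintegral _ _)
  set w : ℝ → ℝ := fun s => (c * (tail μ Φ s).toReal) ^ (Real.conjExponent p - 1) with hw
  have hbase : ∀ s, 0 ≤ c * (tail μ Φ s).toReal := fun s =>
    mul_nonneg hc0.le ENNReal.toReal_nonneg
  have hw0 : ∀ s, 0 ≤ w s := fun s => Real.rpow_nonneg (hbase s) _
  have hwc : Continuous w :=
    ((ENNReal.continuousOn_toReal.comp_continuous (continuous_tail hΦint) htop).const_mul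
      c).rpow_const fun x => Or.inr hq1.le
  have hwp : ∀ s, w s ^ (p - 1) = c * (tail μ Φ s).toReal := fun s => by
    rw [hw, ← Real.rpow_mul (hbase s), conj_sub_one_mul hp, Real.rpow_one]
  have hwx₀ : ∀ s, x₀ ≤ s → w s = 0 := fun s hs => by
    simp [hw, htail, Ioo_eq_empty (not_lt.2 hs), Real.zero_rpow hq1.ne']
  have hWw : ∀ s < x₀, W s ≤ ENNReal.ofReal (w s) := fun s hs => by
    rw [← ENNReal.rpow_le_rpow_iff hp1, ENNReal.ofReal_rpow_of_nonneg (hw0 s) hp1.le, hwp,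
      ENNReal.ofReal_mul hc0.le, ENNReal.ofReal_toReal (htop s), htail]
    exact hWle s hs
  have hwpos : ∀ s < x₀, 0 < w s := fun s hs =>
    ENNReal.ofReal_pos.1 ((pos_iff_ne_zero.2 (hW0 s hs)).trans_le (hWw s hs))
  set K := (c * (∫⁻ t, Φ t ∂μ).toReal) ^ (Real.conjExponent p - 1) with hK
  have hwK : ∀ s, w s ≤ K := fun s => by
    refine Real.rpow_le_rpow (hbase s) (mul_le_mul_of_nonneg_left ?_ hc0.le) hq1.le
    exact ENNReal.toReal_mono hΦint (setLIntegral_le_lintegral _ _)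
  set F : ℝ → ℝ≥0∞ := prim V fun s => ENNReal.ofReal (w s) with hF
  have hFV : ∀ x, F x ≤ ENNReal.ofReal K * V (Iio x) := fun x => by
    rw [← setLIntegral_const]
    exact setLIntegral_mono measurable_const fun s _ => ENNReal.ofReal_le_ofReal (hwK s)
  have hFt : ∀ x, F x ≠ ⊤ := fun x => ne_top_of_le_ne_top
    (ENNReal.mul_ne_top ENNReal.ofReal_ne_top (H.V_lt_top x).ne) (hFV x)
  have hfF : ∀ x ≤ x₀, prim V W x ≤ F x := fun x hx =>
    setLIntegral_mono hwc.measurable.ennreal_ofReal fun s hs => hWw s (lt_of_lt_of_le hs hx)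
  have hFpos : ∀ x > 0, 0 < (F x).toReal := fun x hx => ENNReal.toReal_pos
    (H.prim_ne_zero hwc.measurable.ennreal_ofReal.aemeasurable hx hx₀.1 fun s _ hs => by
      simpa using hwpos s hs) (hFt x)
  have hFc : Continuous fun x => (F x).toReal :=
    ENNReal.continuousOn_toReal.comp_continuous (continuous_prim hFt) hFt
  have hd : ∀ x ∈ oI D, HasDerivAt (fun x => (F x).toReal) (vhat p v x * w x) x := fun x hx =>
    hasDerivAt_prim (isOpen_oI D) Subset.rfl H.aemeasurable_vhat hvhc hwc.continuousOn
      (fun x hx => (vhat_pos (hvpos' x hx)).le) (fun x _ => hw0 x) (fun _ _ => rfl) hFt hx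
  have hJD : Ioo 0 x₀ ⊆ oI D := fun x hx => mem_oI_of_le hx₀ hx.1 hx.2.le
  have hy : ∀ x ∈ Ioo 0 x₀, HasDerivAt (fun t => w t ^ (p - 1))
      (-(c * (u x * (prim V W x).toReal ^ (p - 1)))) x := fun x hx => by
    simp_rw [hwp]
    have h3 := hasDerivAt_tail (W := Φ) isOpen_Ioo hJD H.aemeasurable_u (huc.mono hJD)
      hfp.continuousOn (fun x hx => (hupos x (hJD hx)).le)
      (fun x _ => Real.rpow_nonneg ENNReal.toReal_nonneg _) (fun t ht => by
        rw [← ENNReal.ofReal_rpow_of_nonneg ENNReal.toReal_nonneg hp1.le,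
          ENNReal.ofReal_toReal (hfin t), hΦ, indicator_of_mem (show t ∈ Iio x₀ from ht.2)])
      hΦint hx
    exact (h3.const_mul c).congr_deriv (by ring)
  obtain ⟨h1, h2⟩ := opR_logDeriv (u := u) hp isOpen_Ioo hJD hupos hvpos' hv1
    (fun x hx => hFpos x hx.1) (fun x hx => hd x (hJD hx)) (fun x hx => hwpos x hx.2) hy
    (((huc.mono hJD).mul hfp.continuousOn).const_mul c).neg
  set h : ℝ → ℝ := fun x => vhat p v x * w x / (F x).toReal with hh
  have hR : ∀ x ∈ Ioo 0 x₀, opR p u v h x * (F x).toReal ^ (p - 1)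
      = c * (prim V W x).toReal ^ (p - 1) := fun x hx => by
    have := h2 x hx
    rw [neg_neg] at this
    refine mul_left_cancel₀ (hupos x (hJD hx)).ne' ?_
    linarith
  -- F and f are comparable even at 0: w is bounded by K, while W is decreasing and hence at least
  -- W(m) > 0 on (0, m]. Beyond m the ratio V(-∞, x₀)/V(-∞, m) covers the growth of V.
  obtain ⟨k, hk0, hk⟩ : ∃ k > 0, ∀ x ∈ Ioo 0 x₀, (F x).toReal ≤ k * (prim V W x).toReal := by
    set m := x₀ / 2 with hm
    have hm0 : 0 < m := half_pos hx₀.1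
    have hmx : m < x₀ := half_lt_self hx₀.1
    set A := ENNReal.ofReal K * (1 + V (Iio x₀) / V (Iio m)) * (W m)⁻¹ with hA
    have hAt : A ≠ ⊤ := ENNReal.mul_ne_top (ENNReal.mul_ne_top ENNReal.ofReal_ne_top
      (ENNReal.add_ne_top.2 ⟨ENNReal.one_ne_top, ENNReal.div_ne_top (H.V_lt_top _).ne
        (H.V_ne_zero hm0)⟩)) (ENNReal.inv_ne_top.2 (hW0 m hmx))
    have hVle : ∀ x ∈ Ioo 0 x₀, V (Iio x) ≤ (1 + V (Iio x₀) / V (Iio m)) * V (Iio (min x m)) := by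
      intro x hx
      rcases le_total x m with hxm | hxm
      · rw [min_eq_left hxm, add_mul, one_mul]
        exact le_self_add
      · rw [min_eq_right hxm, add_mul, ENNReal.div_mul_cancel (H.V_ne_zero hm0)
          (H.V_lt_top m).ne]
        exact (measure_mono (Iio_subset_Iio hx.2.le)).trans le_add_self
    have hWm : ∀ x ∈ Ioo 0 x₀, V (Iio (min x m)) ≤ (W m)⁻¹ * prim V W x := fun x hx => by
      rw [mul_comm, ← div_eq_mul_inv, ENNReal.le_div_iff_mul_le (Or.inl (hW0 m hmx))
        (Or.inl (hWt m)), mul_comm]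
      calc W m * V (Iio (min x m)) ≤ W (min x m) * V (Iio (min x m)) :=
            mul_le_mul_left (hWanti (min_le_right _ _)) _
        _ ≤ _ := antitone_mul_le_prim hWanti _
        _ ≤ _ := prim_mono_right _ _ (min_le_left _ _)
    have hFA : ∀ x ∈ Ioo 0 x₀, F x ≤ A * prim V W x := fun x hx => by
      calc F x ≤ ENNReal.ofReal K * V (Iio x) := hFV x
        _ ≤ ENNReal.ofReal K * ((1 + V (Iio x₀) / V (Iio m)) * ((W m)⁻¹ * prim V W x)) :=
            mul_le_mul_right ((hVle x hx).trans (mul_le_mul_right (hWm x hx) _)) _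
        _ = _ := by rw [hA]; ring
    refine ⟨A.toReal + 1, add_pos_of_nonneg_of_pos ENNReal.toReal_nonneg one_pos, fun x hx => ?_⟩
    have h3 := ENNReal.toReal_mono (ENNReal.mul_ne_top hAt (hfin x)) (hFA x hx)
    rw [ENNReal.toReal_mul] at h3
    linarith [(hfpos x hx.1).le]
  have hRle : ∀ x ∈ Ioo 0 x₀, opR p u v h x ≤ c := fun x hx => by
    refine le_of_mul_le_mul_right ((hR x hx).trans_le ?_)
      (Real.rpow_pos_of_pos (hFpos x hx.1) (p - 1))
    refine mul_le_mul_of_nonneg_left (Real.rpow_le_rpow ENNReal.toReal_nonneg ?_ hp1.le) hc0.le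
    exact ENNReal.toReal_mono (hFt x) (hfF x hx.2.le)
  have hRge : ∀ x ∈ Ioo 0 x₀, c / k ^ (p - 1) ≤ opR p u v h x := fun x hx => by
    refine le_of_mul_le_mul_right (le_trans ?_ (hR x hx).symm.le)
      (Real.rpow_pos_of_pos (hFpos x hx.1) (p - 1))
    rw [div_mul_eq_mul_div, div_le_iff₀ (Real.rpow_pos_of_pos hk0 _), mul_assoc, mul_comm (_ ^ _),
      ← Real.mul_rpow hk0.le ENNReal.toReal_nonneg]
    exact mul_le_mul_of_nonneg_left (Real.rpow_le_rpow (hFpos x hx.1).le (hk x hx) hp1.le) hc0.le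
  have hδ : 0 < c / k ^ (p - 1) := div_pos hc0 (Real.rpow_pos_of_pos hk0 _)
  have hpos : ∀ x ∈ Ioo 0 x₀, 0 < h x := fun x hx =>
    div_pos (mul_pos (vhat_pos (hvpos' x (hJD hx))) (hwpos x hx.2)) (hFpos x hx.1)
  have hvan : ∀ x, x₀ ≤ x → h x = 0 := fun x hx => by simp [hh, hwx₀ x hx]
  have hcont : ContinuousOn h (ocI D) := continuousOn_logDeriv hvpos hvc hwc hFc hFpos
  refine ⟨h, ⟨x₀, ⟨hx₀, hcont.mono fun x hx => ⟨hx.1, (Ioc_subset_oI hx₀ hx).2.le⟩, h1, hpos,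
    fun x _ => hvan x, ?_, fun x hx => ?_⟩, _, hδ, fun x hx => ?_⟩, fun x hx => ?_⟩
  · refine divergesAtZero_of_hasDerivAt H.pos (hcont.mono fun x hx => ⟨hx.1, hx.2.le⟩)
      (fun x hx => ?_) (fun x hx => hFpos x hx.1) (fun x hx => ?_) ?_
    · exact div_nonneg (mul_nonneg (vhat_pos (hvpos' x hx)).le (hw0 x)) ENNReal.toReal_nonneg
    · rw [hh, div_mul_cancel₀ _ (hFpos x hx.1).ne']; exact hd x hx
    · have h3 : (F 0).toReal = 0 := by simp [hF, hV, prim_zero wMeasure_Iio_zero]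
      simpa only [h3] using (hFc.tendsto 0).mono_left (nhdsWithin_le_nhds (s := Ioi 0))
  · have h3 := hδ.trans_le (hRge x hx)
    rw [opR, neg_pos] at h3
    by_contra! h4
    refine absurd h3 (not_lt.2 (mul_nonneg (inv_nonneg.2 (hupos x (hJD hx)).le) (mul_nonneg ?_ h4)))
    exact Real.rpow_nonneg (abs_nonneg _) _
  · have h3 := hRge x hx
    rw [opR] at h3
    linarith
  · rcases lt_or_ge x x₀ with h3 | h3
    · exact hRle x ⟨hx.1, h3⟩
    · rw [opR_eq_zero_of_forall_ge (lt_add_one x) fun t ht => hvan t (h3.trans ht.1)]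
      exact hc0.le

end Weights

end

end DNCase

/-! ### Assembly: each formula closes a chain of inequalities through λ_p. -/

theorem theorem4p1 (p : ℝ) (hp : 1 < p) (D : EReal) (hD : 0 < D) (u v : ℝ → ℝ)
    (hu : ∀ᵐ x ∂(volume.restrict (oI D)), 0 < u x)
    (hv : ∀ᵐ x ∂(volume.restrict (oI D)), 0 < v x)
    (hu_loc : LocallyIntegrableOn u (cI D)) (hv_loc : LocallyIntegrableOn (vhat p v) (cI D))
    (hmu : wMeasure u D (oI D) < ⊤) :
    -- the two classical descriptions of the eigenvalue
    (LocallyIntegrableOn v (oI D) → lamC1 p u v D = lam p u v D) ∧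
    -- single integral forms
    (⨅ (f : ℝ → ℝ) (w : ℝ → ℝ) (_ : FtI p v D f w), ⨆ x ∈ oI D, (opI p u D f w x)⁻¹)
      = lam p u v D ∧
    lam p u v D
      = (⨆ (f : ℝ → ℝ) (w : ℝ → ℝ) (_ : FI p v D f w), ⨅ x ∈ oI D, (opI p u D f w x)⁻¹) ∧
    -- double integral forms
    lam p u v D
      = (⨅ (f : ℝ → ℝ) (_ : ∃ w, FtI p v D f w), ⨆ x ∈ oI D, (opII p u v D f x)⁻¹) ∧
    lam p u v D
      = (⨅ (f : ℝ → ℝ) (_ : FtII D f ∨ FtII' p u v D f),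
          ⨆ x ∈ oI D, (opII p u v D f x)⁻¹) ∧
    lam p u v D
      = (⨆ (f : ℝ → ℝ) (_ : ∃ w, FI p v D f w), ⨅ x ∈ oI D, (opII p u v D f x)⁻¹) ∧
    lam p u v D
      = (⨆ (f : ℝ → ℝ) (_ : FII D f), ⨅ x ∈ oI D, (opII p u v D f x)⁻¹) ∧
    -- differential forms
    ((∀ x ∈ oI D, 0 < u x) → (∀ x ∈ ocI D, 0 < v x) →
      ContinuousOn u (oI D) → ContDiffOn ℝ 1 v (oI D) → ContinuousOn v (ocI D) →
      (⨅ (h : ℝ → ℝ) (_ : Ht p v D h), ⨆ x ∈ oI D, (opR p u v h x : EReal))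
        = (lam p u v D : EReal) ∧
      (⨅ (h : ℝ → ℝ) (_ : HtUnif p u v D h), ⨆ x ∈ oI D, (opR p u v h x : EReal))
        = (lam p u v D : EReal) ∧
      (lam p u v D : EReal)
        = (⨆ (h : ℝ → ℝ) (_ : HClass D h), ⨅ x ∈ oI D, (opR p u v h x : EReal))) := by
  have H : Weights p D u v := ⟨hp, hD, hu, hv, hu_loc, hv_loc, hmu⟩
  refine ⟨fun h => H.lamC1_eq_lam h, ?_, ?_, ?_, ?_, ?_, ?_, fun hupos hvpos huc hv1 hvc => ?_⟩
  · refine le_antisymm H.iInf_opI_le_lam (le_iInf₂ fun f w => le_iInf fun hf => ?_)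
    exact (H.lam_le_iSup_opII_of_FtII (H.FtI_toFtII hf)).trans (H.iSup_opII_le_iSup_opI hf)
  · refine le_antisymm H.lam_le_iSup_opI (iSup₂_le fun f w => iSup_le fun hf => ?_)
    exact (H.iInf_opI_le_iInf_opII hf).trans (H.iInf_opII_le_lam (H.FI_toFII hf))
  · refine le_antisymm (le_iInf₂ fun f ⟨w, hf⟩ =>
      H.lam_le_iSup_opII_of_FtII (H.FtI_toFtII hf)) ?_
    refine le_trans (le_iInf₂ fun f w => le_iInf fun hf => ?_) H.iInf_opI_le_lam
    exact iInf₂_le_of_le f ⟨w, hf⟩ (H.iSup_opII_le_iSup_opI hf)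
  · refine le_antisymm (le_iInf₂ fun f hf => hf.elim H.lam_le_iSup_opII_of_FtII
      H.lam_le_iSup_opII_of_FtII') ?_
    refine le_trans (le_iInf₂ fun f w => le_iInf fun hf => ?_) H.iInf_opI_le_lam
    exact iInf₂_le_of_le f (Or.inl (H.FtI_toFtII hf)) (H.iSup_opII_le_iSup_opI hf)
  · refine le_antisymm ?_ (iSup₂_le fun f ⟨w, hf⟩ => H.iInf_opII_le_lam (H.FI_toFII hf))
    refine H.lam_le_iSup_opI.trans (iSup₂_le fun f w => iSup_le fun hf => ?_)
    exact (H.iInf_opI_le_iInf_opII hf).trans (le_iSup₂_of_le f ⟨w, hf⟩ le_rfl)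
  · refine le_antisymm ?_ (iSup₂_le fun f hf => H.iInf_opII_le_lam hf)
    refine H.lam_le_iSup_opI.trans (iSup₂_le fun f w => iSup_le fun hf => ?_)
    exact (H.iInf_opI_le_iInf_opII hf).trans (le_iSup₂_of_le f (H.FI_toFII hf) le_rfl)
  have hvpos' : ∀ x ∈ oI D, 0 < v x := fun x hx => hvpos x ⟨hx.1, hx.2.le⟩
  have hle : ⨅ (h : ℝ → ℝ) (_ : HtUnif p u v D h), ⨆ x ∈ oI D, (opR p u v h x : EReal)
      ≤ (lam p u v D : EReal) := by
    by_contra! hlt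
    obtain ⟨c, hc1, hc2⟩ := EReal.lt_iff_exists_real_btwn.1 hlt
    obtain ⟨h, hh, hR⟩ := H.exists_HtUnif hupos hvpos huc hv1 hvc hc1
    refine absurd hc2 (not_lt.2 (iInf₂_le_of_le h hh (iSup₂_le fun x hx => ?_)))
    exact_mod_cast hR x hx
  have hge : (lam p u v D : EReal)
      ≤ ⨅ (h : ℝ → ℝ) (_ : Ht p v D h), ⨆ x ∈ oI D, (opR p u v h x : EReal) :=
    le_iInf₂ fun h hh => H.lam_le_iSup_opR_of_Ht hupos hvpos' huc hv1 hh
  have hmid : ⨅ (h : ℝ → ℝ) (_ : Ht p v D h), ⨆ x ∈ oI D, (opR p u v h x : EReal)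
      ≤ ⨅ (h : ℝ → ℝ) (_ : HtUnif p u v D h), ⨆ x ∈ oI D, (opR p u v h x : EReal) :=
    le_iInf₂ fun h ⟨x₀, hh, _⟩ => iInf₂_le h ⟨x₀, hh⟩
  refine ⟨le_antisymm (hmid.trans hle) hge, le_antisymm hle (hge.trans hmid), le_antisymm ?_
    (iSup₂_le fun h hh => H.iInf_opR_le_lam hupos hvpos' huc hv1 hh)⟩
  by_contra! hlt
  obtain ⟨c, hc1, hc2⟩ := EReal.lt_iff_exists_real_btwn.1 hlt
  obtain ⟨h, hh, hR⟩ := H.exists_HClass hupos hvpos huc hv1 hvc hc2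
  refine absurd hc1 (not_lt.2 (le_iSup₂_of_le h hh (le_iInf₂ fun x hx => ?_)))
  exact_mod_cast hR x hx
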